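/- **Setup.** Fix $\rho\in[0,1]$. For each $m\ge 1$ let $\delta_{0m},\delta_{Am}>0$, $p_m\in(0,1)$, $\sigma_{\epsilon m}>0$, $\sigma_{0m}\ge 0$, $\tau_m>0$. Let $(\theta_i,\mu_i)$, $1\le i\le m$, be i.i.d. with $\theta_i\sim\mathrm{Bernoulli}(p_m)$ and $\mu_i\mid\theta_i\sim N(0,\sigma_{0m}^2+\theta_i\tau_m^2)$. Given $(\theta,\mu)$, the observed vector $X=(X_1,\dots,X_m)$ is $N(\mu,\Sigma)$ with $\Sigma_{ii}=\sigma_{\epsilon m}^2$ and $\Sigma_{ij}=\rho\,\sigma_{\epsilon m}^2$ for $i\ne j$. In the associated reduced model one has instead a vector $Z$ whose coordinates, given $(\theta,\mu)$, are independent with $Z_i\sim N(\mu_i,\sigma_{\epsilon m}^2(1-\rho))$; thus $X$ has the law of $(Z_i+Q)_i$ with $Q\sim N(0,\rho\,\sigma_{\epsilon m}^2)$ independent of $(\theta,\mu,Z)$, and the observable deviations $U_i=X_i-\bar X$ have the law of $Z_i-\bar Z$ (jointly with $\theta$). The hypotheses $H_{0i}:\theta_i=0$ are tested against $H_{Ai}:\theta_i=1$.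 The risk of a rule is its expected total loss, with loss $\delta_{0m}$ for each false rejection and $\delta_{Am}$ for each false acceptance. Put $$\sigma_m^2=\sigma_{\epsilon m}^2(1-\rho)+\sigma_{0m}^2,\quad u_m=\frac{\tau_m^2}{\sigma_m^2},\quad \delta_m=\frac{\delta_{0m}}{\delta_{Am}},\quad f_m=\frac{1-p_m}{p_m},\quad v_m=u_m f_m^2\delta_m^2,\quad r_\alpha=\frac{\alpha}{1-\alpha}.$$ The optimal risk $R_{\mathrm{opt},m}$ is the risk of the Bayes rule based on $Z$, which rejects $H_{0i}$ when $\varphi_A(Z_i)/\varphi_0(Z_i)\ge f_m\delta_m$, where $\varphi_0,\varphi_A$ are the densities of $N(0,\sigma_m^2)$ and $N(0,\sigma_m^2+\tau_m^2)$. A sequence of rules with risks $R_m$ is ABOS (asymptotically Bayes optimal under sparsity) if $R_m/R_{\mathrm{opt},m}\to1$. The Benjamini–Hochberg (BH) procedure at level $\alpha$ based on a vector $Y$ uses the p-values $2(1-\Phi(|Y_i|/\sigma_m))$; if $k$ is the largest index for which the ordered p-values satisfy $p_{(k)}\le k\alpha/m$, it rejects exactly the hypotheses with p-value at most $p_{(k)}$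 (and none if there is no such $k$). **Theorem.** Assume, as $m\to\infty$, that $p_m\to0$, $u_m\to\infty$, $v_m\to\infty$ and $\log v_m/u_m\to C$ for some $C\in(0,\infty)$. Let $\alpha_m\in(0,1)$ with $\alpha_m\to\alpha_\infty<1$, and let $mp_m\to s\in(0,\infty]$. Define $s_m$ by $\log(f_m\delta_m\sqrt{u_m})=(1+s_m)\log(f_m/r_{\alpha_m})$ and assume that $$\log\frac{\delta_m}{p_m}=o(m),\qquad s_m\to0,\qquad 2s_m\log\frac{f_m}{r_{\alpha_m}}-\log\log\frac{f_m}{r_{\alpha_m}}\to-\infty .$$ Then: 1. the BH procedure at level $\alpha_m$ based on $Z$ is ABOS; 2. if moreover $p_mu_m^2=o(m)$, the BH procedure at level $\alpha_m$ based on the observable deviations $U_i=X_i-\bar X$ in the equicorrelated model is ABOS. -/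

import Mathlib

open MeasureTheory ProbabilityTheory Filter Topology Asymptotics

namespace EquicorrBH

noncomputable section

/-- The parameters of the two-groups model for a fixed number of coordinates: losses `δ₀` (false
rejection) and `δA` (false acceptance), proportion `p` of alternatives, noise standard deviation
`σε`, standard deviation `σ₀` of the null effects, and standard deviation `τ` of the additional
effect under the alternative. -/
structure Params where
  δ₀ : ℝ
  δA : ℝ
  p : ℝ
  σε : ℝ
  σ₀ : ℝ
  τ : ℝ
  δ₀_pos : 0 < δ₀
  δA_pos : 0 < δA
  p_pos : 0 < p
  p_lt_one : p < 1
  σε_pos : 0 < σε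
  σ₀_nonneg : 0 ≤ σ₀
  τ_pos : 0 < τ

namespace Params

/-- `σ² = σε² (1 - ρ) + σ₀²`. -/
def sigmaSq (P : Params) (ρ : ℝ) : ℝ := P.σε ^ 2 * (1 - ρ) + P.σ₀ ^ 2

/-- `u = (τ / σ)²`. -/
def u (P : Params) (ρ : ℝ) : ℝ := P.τ ^ 2 / P.sigmaSq ρ

/-- `δ = δ₀ / δA`. -/
def δ (P : Params) : ℝ := P.δ₀ / P.δA

/-- `f = (1 - p) / p`. -/
def f (P : Params) : ℝ := (1 - P.p) / P.p

/-- `v = u ((1 - p) δ₀ / (p δA))²`. -/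
def v (P : Params) (ρ : ℝ) : ℝ := P.u ρ * (((1 - P.p) * P.δ₀) / (P.p * P.δA)) ^ 2

/-- Joint law of one pair `(θᵢ, μᵢ)`: `θᵢ` is Bernoulli(`p`) (`true` is the alternative), and
given `θᵢ` the effect `μᵢ` is `N(0, σ₀²)` or `N(0, σ₀² + τ²)`. -/
def priorLaw (P : Params) : Measure (Bool × ℝ) :=
  ENNReal.ofReal (1 - P.p) •
      (Measure.dirac false).prod (gaussianReal 0 (Real.toNNReal (P.σ₀ ^ 2)))
    + ENNReal.ofReal P.p •
      (Measure.dirac true).prod (gaussianReal 0 (Real.toNNReal (P.σ₀ ^ 2 + P.τ ^ 2)))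

/-- Joint law of `(θ, μ + ε)`, where the pairs `(θᵢ, μᵢ)` are i.i.d. with law `priorLaw` and the
noise vector `ε` is independent of them with the given law. -/
def dataLaw (P : Params) (m : ℕ) (noise : Measure (Fin m → ℝ)) :
    Measure ((Fin m → Bool) × (Fin m → ℝ)) :=
  ((Measure.pi fun _ : Fin m => P.priorLaw).prod noise).map
    fun ω => (fun i => (ω.1 i).1, fun i => (ω.1 i).2 + ω.2 i)

/-- The equicorrelated covariance matrix: `σε²` on the diagonal and `σε² ρ` off it. -/
def noiseCov (P : Params) (ρ : ℝ) (m : ℕ) : Matrix (Fin m) (Fin m) ℝ :=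
  Matrix.of fun i j => if i = j then P.σε ^ 2 else P.σε ^ 2 * ρ

/-- Joint law of `(θ, X)` in the equicorrelated model: given `(θ, μ)`, the observed vector `X` is
multivariate normal with mean `μ` and covariance `noiseCov`. -/
def observedLaw (P : Params) (ρ : ℝ) (m : ℕ) : Measure ((Fin m → Bool) × (Fin m → ℝ)) :=
  P.dataLaw m ((multivariateGaussian 0 (P.noiseCov ρ m)).map fun x i => x i)

/-- Joint law of `(θ, Z)` in the reduced model: given `(θ, μ)`, the `Zᵢ` are independent with
law `N(μᵢ, σε² (1 - ρ))`. -/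
def reducedLaw (P : Params) (ρ : ℝ) (m : ℕ) : Measure ((Fin m → Bool) × (Fin m → ℝ)) :=
  P.dataLaw m
    (Measure.pi fun _ : Fin m => gaussianReal 0 (Real.toNNReal (P.σε ^ 2 * (1 - ρ))))

/-- Expected total loss of the multiple testing rule `rule`, which maps the data vector to the set
of rejected coordinates, under the joint law `L` of the indicators and the data. -/
def risk (P : Params) {m : ℕ} (L : Measure ((Fin m → Bool) × (Fin m → ℝ)))
    (rule : (Fin m → ℝ) → Set (Fin m)) : ℝ :=
  ∑ i : Fin m, (P.δ₀ * L.real {ω | ω.1 i = false ∧ i ∈ rule ω.2}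
    + P.δA * L.real {ω | ω.1 i = true ∧ i ∉ rule ω.2})

/-- The Bayes rule for `Z`: reject when `φ_A(Zᵢ) / φ₀(Zᵢ) ≥ (1 - p) δ₀ / (p δA)`, with `φ₀`,
`φ_A` the densities `N(0, σ²)`, `N(0, σ² + τ²)` of `Zᵢ` under the null and the alternative. -/
def bayesRule (P : Params) (ρ : ℝ) (m : ℕ) (z : Fin m → ℝ) : Set (Fin m) :=
  {i | ((1 - P.p) * P.δ₀) / (P.p * P.δA) ≤
    gaussianPDFReal 0 (Real.toNNReal (P.sigmaSq ρ + P.τ ^ 2)) (z i) /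
      gaussianPDFReal 0 (Real.toNNReal (P.sigmaSq ρ)) (z i)}

/-- The optimal risk: the risk of the Bayes rule. -/
def optRisk (P : Params) (ρ : ℝ) (m : ℕ) : ℝ :=
  P.risk (P.reducedLaw ρ m) (P.bayesRule ρ m)

end Params

/-- The Benjamini–Hochberg procedure at level `α` for the p-values `q`: with ordered p-values
`q₍₁₎ ≤ ⋯ ≤ q₍ₘ₎` and `k` the largest index with `q₍ₖ₎ ≤ k α / m`, reject every hypothesis whose
p-value is at most `q₍ₖ₎`; reject nothing if there is no such index. Indices are shifted by one. -/
def benjaminiHochberg {m : ℕ} (α : ℝ) (q : Fin m → ℝ) : Set (Fin m) :=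
  {i | ∃ k : Fin m,
    IsGreatest {j : Fin m | q (Tuple.sort q j) ≤ ((j : ℕ) + 1 : ℝ) * α / m} k ∧
      q i ≤ q (Tuple.sort q k)}

/-- The two-sided normal p-value `2 (1 - Φ(|t|))`. -/
def pValue (t : ℝ) : ℝ := 2 * (1 - cdf (gaussianReal 0 1) |t|)

/-- Deviations from the arithmetic mean, `xᵢ - x̄`. -/
def center {m : ℕ} (x : Fin m → ℝ) (i : Fin m) : ℝ := x i - (∑ j, x j) / m

namespace Params

/-- Benjamini–Hochberg at level `α` with p-values `2 (1 - Φ(|yᵢ| / σ))`. -/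
def bhRule (P : Params) (ρ α : ℝ) {m : ℕ} (y : Fin m → ℝ) : Set (Fin m) :=
  benjaminiHochberg α fun i => pValue (y i / √(P.sigmaSq ρ))

end Params

/-- A sequence of rules, with data laws `L m`, is asymptotically Bayes optimal under sparsity when
the ratio of its risk to the optimal risk tends to one. -/
def IsABOS (P : ℕ → Params) (ρ : ℝ)
    (L : ∀ m : ℕ, Measure ((Fin m → Bool) × (Fin m → ℝ)))
    (rule : ∀ m : ℕ, (Fin m → ℝ) → Set (Fin m)) : Prop :=
  Tendsto (fun m => (P m).risk (L m) (rule m) / (P m).optRisk ρ m) atTop (𝓝 1)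

/-- The asymptotic framework: `p → 0`, `u → ∞`, `v → ∞`, `log v / u → C ∈ (0, ∞)`. -/
structure AsymptoticFramework (P : ℕ → Params) (ρ : ℝ) : Prop where
  p_tendsto : Tendsto (fun m => (P m).p) atTop (𝓝 0)
  u_tendsto : Tendsto (fun m => (P m).u ρ) atTop atTop
  v_tendsto : Tendsto (fun m => (P m).v ρ) atTop atTop
  ratio_tendsto : ∃ C : ℝ, 0 < C ∧
    Tendsto (fun m => Real.log ((P m).v ρ) / (P m).u ρ) atTop (𝓝 C)

/-- `r_α = α / (1 - α)`. -/
def odds (α : ℝ) : ℝ := α / (1 - α)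

/-- The number `s` with `log (f δ √u) / log (f / r_α) = 1 + s`. -/
def sSeq (P : Params) (ρ α : ℝ) : ℝ :=
  Real.log (P.f * P.δ * √(P.u ρ)) / Real.log (P.f / odds α) - 1

end

end EquicorrBH

open EquicorrBH

namespace EquicorrBH

/-! Write β for `pValue √C`. Everything reduces to the scale m p δA (1 - β), where 1 - β is the
limiting type II error of the Bayes rule. On the scale of the alternative that rule accepts below
`√(log v / u)`, so the optimal risk is at least m p δA (1 - β + o(1)) (`le_real_compl_bayesRegion`,
`le_optRisk`). No measurable rule based on Z does better (`optRisk_le_risk`). Since centring removes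
the common noise component, a rule based on the observed deviations has the same risk as that rule
applied to Z - Z̄ (`risk_observed_center`). Optimality therefore follows from two upper bounds for
BH: at most m p (1 - β + ε) expected false acceptances, and o(m p) for δ times the expected number
of false rejections (`isABOS_of_falseRej`).

False acceptances (`falseAcc_le`): a p-value at most η p α is rejected as soon as η m p others are
as small, and even alone if η m p ≤ 1. The corresponding critical value is about √(2 log(1/(pα))),
which tends to √C on the scale of the alternative, so a positive fraction of the alternatives
exceeds it. Since u = o(m), the mean is rarely larger than one, and centring does no harm.

False rejections from Z: a leave-one-out recursion for independent p-values bounds their expected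
number by r_α (m p + 1/(1 - α)) (`sum_real_mem_bh_le`, `falseRej_id_le`). The last hypothesis on s_m
says precisely that δ r_α → 0 in this regime, and m p is bounded away from zero.

False rejections after centring: the p-values are dependent, and two ranges of α are treated
separately. If α > p⁴, then u = O(log m); the mean is below m^(-1/4) outside an event of
superpolynomially small probability, and there BH for the deviations at level α rejects no more than
BH for Z at level (1 + ε)α (`falseRej_center_le_of_close`). If α ≤ p⁴, first and second moments
suffice (`falseRej_center_le_of_small_level`). With m₁ alternatives, compare the number of
rejections with k = m₁ + ⌈mp⌉. If it is at most k, falsely rejected nulls have p-values below kα/m;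
centring inflates their variance by at most m₁u/m², which is harmless on average because p u² =
o(m). If it is larger, there are more than m p false rejections, hence many pairs of null p-values
below α. Such a pair has probability of order α^(3/2) ≤ α p². -/

/-! ### Tail estimates for the two-sided normal p-value. -/

lemma real_Iio_neg_gaussian (a : ℝ) :
    (gaussianReal 0 1).real (Set.Iio (-a)) = (gaussianReal 0 1).real (Set.Ioi a) := by
  have h : (gaussianReal 0 1).map (fun x => -x) = gaussianReal 0 1 := by
    simpa using gaussianReal_map_neg (μ := 0) (v := 1)
  have h2 : (gaussianReal 0 1) (Set.Ioi a) = (gaussianReal 0 1) (Set.Iio (-a)) := by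
    conv_lhs => rw [← h]
    rw [Measure.map_apply measurable_neg measurableSet_Ioi]
    congr 1
    ext x
    simp
  simp [measureReal_def, h2]

lemma pValue_eq_tail (t : ℝ) : pValue t = 2 * (gaussianReal 0 1).real (Set.Ioi |t|) := by
  rw [pValue, cdf_eq_real, ← Set.compl_Iic, probReal_compl_eq_one_sub measurableSet_Iic]

lemma pValue_eq_real (t : ℝ) : pValue t = (gaussianReal 0 1).real {x | |t| ≤ |x|} := by
  have : NullSingletonClass (gaussianReal 0 1) := nullSingletonClass_gaussianReal one_ne_zero
  have h1 : {x : ℝ | |t| ≤ |x|} = (Set.Ioi |t| ∪ Set.Iio (-|t|)) ∪ {|t|, -|t|} := by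
    ext x
    simp only [Set.mem_ofPred_eq, Set.mem_union, Set.mem_Ioi, Set.mem_Iio, Set.mem_insert_iff,
      Set.mem_singleton_iff, le_abs']
    constructor
    · rintro (h | h)
      · rcases h.lt_or_eq with h | h <;> tauto
      · rcases h.lt_or_eq with h | h
        · tauto
        · exact Or.inr (Or.inl h.symm)
    · rintro ((h | h) | (h | h))
      · exact Or.inr h.le
      · exact Or.inl h.le
      · exact Or.inr h.ge
      · exact Or.inl h.le
  have h2 : (gaussianReal 0 1).real {x : ℝ | |t| ≤ |x|}
      = (gaussianReal 0 1).real (Set.Ioi |t| ∪ Set.Iio (-|t|)) := by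
    rw [h1]
    apply measureReal_congr
    apply union_ae_eq_left_of_ae_eq_empty
    rw [ae_eq_empty]
    exact (Set.Countable.measure_zero (by simp) _)
  rw [h2, measureReal_union ?_ measurableSet_Iio, real_Iio_neg_gaussian, pValue_eq_tail, two_mul]
  rw [Set.disjoint_left]
  intro x hx hx'
  simp only [Set.mem_Ioi, Set.mem_Iio] at hx hx'
  linarith [abs_nonneg t]

lemma pValue_abs (t : ℝ) : pValue |t| = pValue t := by simp [pValue]

lemma pValue_nonneg (t : ℝ) : 0 ≤ pValue t := by rw [pValue_eq_real]; positivity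

lemma pValue_le_one (t : ℝ) : pValue t ≤ 1 := by rw [pValue_eq_real]; exact measureReal_le_one

lemma pValue_zero : pValue 0 = 1 := by simp [pValue_eq_real]

lemma pValue_anti {a b : ℝ} (h : |a| ≤ |b|) : pValue b ≤ pValue a := by
  rw [pValue_eq_real, pValue_eq_real]
  exact measureReal_mono fun x hx => le_trans h hx

/-- The standard normal density. -/
noncomputable abbrev stdPDF (x : ℝ) : ℝ := gaussianPDFReal 0 1 x

lemma stdPDF_eq (x : ℝ) : stdPDF x = (√(2 * Real.pi))⁻¹ * Real.exp (-x ^ 2 / 2) := by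
  simp [stdPDF, gaussianPDFReal]

lemma stdPDF_pos (x : ℝ) : 0 < stdPDF x := gaussianPDFReal_pos _ _ _ one_ne_zero

lemma stdPDF_le {a b : ℝ} (h : |a| ≤ |b|) : stdPDF b ≤ stdPDF a := by
  rw [stdPDF_eq, stdPDF_eq]
  have := sq_le_sq.mpr h
  gcongr

lemma stdPDF_le_one (x : ℝ) : stdPDF x ≤ 1 := by
  rw [stdPDF_eq]
  have h1 : (√(2 * Real.pi))⁻¹ ≤ 1 := by
    apply inv_le_one_of_one_le₀
    rw [Real.one_le_sqrt]
    linarith [Real.pi_gt_three]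
  have h2 : Real.exp (-x ^ 2 / 2) ≤ 1 := Real.exp_le_one_iff.mpr (by nlinarith [sq_nonneg x])
  exact mul_le_one₀ h1 (Real.exp_nonneg _) h2

lemma continuous_stdPDF : Continuous stdPDF := by
  have : stdPDF = fun x => (√(2 * Real.pi))⁻¹ * Real.exp (-x ^ 2 / 2) := funext stdPDF_eq
  rw [this]; fun_prop

lemma integrable_stdPDF : Integrable stdPDF := integrable_gaussianPDFReal 0 1

lemma gaussian_real_eq_integral (s : Set ℝ) :
    (gaussianReal 0 1).real s = ∫ x in s, stdPDF x := by
  rw [measureReal_def, gaussianReal_apply_eq_integral 0 one_ne_zero, ENNReal.toReal_ofReal]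
  exact integral_nonneg fun x => gaussianPDFReal_nonneg _ _ _

lemma pValue_eq_integral (t : ℝ) : pValue t = 2 * ∫ x in Set.Ioi |t|, stdPDF x := by
  rw [pValue_eq_tail, gaussian_real_eq_integral]

lemma pValue_sub {a b : ℝ} (ha : 0 ≤ a) (hab : a ≤ b) :
    pValue a - pValue b = 2 * ∫ x in a..b, stdPDF x := by
  rw [pValue_eq_integral, pValue_eq_integral, abs_of_nonneg ha, abs_of_nonneg (ha.trans hab),
    intervalIntegral.integral_of_le hab, ← Set.Ioc_union_Ioi_eq_Ioi hab,
    setIntegral_union _ measurableSet_Ioi integrable_stdPDF.integrableOn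
      integrable_stdPDF.integrableOn]
  · ring
  · exact Set.Ioc_disjoint_Ioi le_rfl

lemma pValue_sub_le {a b : ℝ} (ha : 0 ≤ a) (hab : a ≤ b) :
    pValue a - pValue b ≤ 2 * ((b - a) * stdPDF a) := by
  rw [pValue_sub ha hab]
  have : ∫ x in a..b, stdPDF x ≤ ∫ x in a..b, stdPDF a := by
    apply intervalIntegral.integral_mono_on hab
      (continuous_stdPDF.intervalIntegrable _ _) (by simp)
    intro x hx
    apply stdPDF_le
    rw [abs_of_nonneg ha, abs_of_nonneg (ha.trans hx.1)]
    exact hx.1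
  simp at this ⊢
  linarith

lemma le_pValue_sub {a b : ℝ} (ha : 0 ≤ a) (hab : a ≤ b) :
    2 * ((b - a) * stdPDF b) ≤ pValue a - pValue b := by
  rw [pValue_sub ha hab]
  have : ∫ x in a..b, stdPDF b ≤ ∫ x in a..b, stdPDF x := by
    apply intervalIntegral.integral_mono_on hab (by simp)
      (continuous_stdPDF.intervalIntegrable _ _)
    intro x hx
    apply stdPDF_le
    rw [abs_of_nonneg (ha.trans hab), abs_of_nonneg (ha.trans hx.1)]
    exact hx.2
  simp at this ⊢
  linarith

/-- On an interval of length 1/(1 + c) starting at c the density loses at most a factor e^(-3/2), so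
the mass of that interval already gives a lower bound of the order of the Mills ratio, valid down to
c = 0. -/
lemma pValue_lower {c : ℝ} (hc : 0 ≤ c) :
    2 * Real.exp (-(3 / 2)) * stdPDF c / (1 + c) ≤ pValue c := by
  have h0 : (0:ℝ) < 1 + c := by linarith
  have h := le_pValue_sub hc (show c ≤ c + 1 / (1 + c) by
    have : 0 < 1 / (1 + c) := by positivity
    linarith)
  have h1 : Real.exp (-(3 / 2)) * stdPDF c ≤ stdPDF (c + 1 / (1 + c)) := by
    rw [stdPDF_eq, stdPDF_eq, mul_left_comm, ← Real.exp_add]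
    gcongr
    have e1 : c * (1 / (1 + c)) ≤ 1 := by rw [mul_one_div, div_le_one h0]; linarith
    have e2 : 1 / (1 + c) ≤ 1 := by rw [div_le_one h0]; linarith
    have e3 : 0 < 1 / (1 + c) := by positivity
    nlinarith
  have h2 : 2 * Real.exp (-(3 / 2)) * stdPDF c / (1 + c)
      = 2 * (1 / (1 + c) * (Real.exp (-(3 / 2)) * stdPDF c)) := by
    field_simp
  rw [h2]
  have h3 : 1 / (1 + c) * (Real.exp (-(3 / 2)) * stdPDF c)
      ≤ 1 / (1 + c) * stdPDF (c + 1 / (1 + c)) := by gcongr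
  have h4 := pValue_nonneg (c + 1 / (1 + c))
  have h5 : c + 1 / (1 + c) - c = 1 / (1 + c) := by ring
  rw [h5] at h
  linarith

lemma pValue_pos (t : ℝ) : 0 < pValue t := by
  rw [← pValue_abs]
  refine lt_of_lt_of_le ?_ (pValue_lower (abs_nonneg t))
  have := stdPDF_pos |t|
  positivity

lemma pValue_mills {c : ℝ} (hc : 0 < c) : pValue c ≤ 2 * stdPDF c / c := by
  have hderiv : ∀ x : ℝ, HasDerivAt (fun x => -stdPDF x) (x * stdPDF x) x := by
    intro x
    have : (fun x => -stdPDF x) = fun x => -((√(2 * Real.pi))⁻¹ * Real.exp (-x ^ 2 / 2)) := by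
      funext x; rw [stdPDF_eq]
    rw [this, stdPDF_eq]
    have h1 : HasDerivAt (fun x : ℝ => -x ^ 2 / 2) (-x) x := by
      have := ((hasDerivAt_pow 2 x).neg).div_const 2
      convert! this using 1
      norm_num; ring
    have := ((h1.exp).const_mul ((√(2 * Real.pi))⁻¹)).neg
    convert! this using 1
    ring
  have hlim : Tendsto (fun x => -stdPDF x) atTop (𝓝 0) := by
    have : (fun x => -stdPDF x) = fun x => -((√(2 * Real.pi))⁻¹ * Real.exp (-x ^ 2 / 2)) := by
      funext x; rw [stdPDF_eq]
    rw [this]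
    have h1 : Tendsto (fun x : ℝ => -x ^ 2 / 2) atTop atBot := by
      have := (tendsto_pow_atTop (α := ℝ) two_ne_zero).atTop_div_const (show (0:ℝ) < 2 by norm_num)
      have := tendsto_neg_atTop_atBot.comp this
      refine this.congr fun x => ?_
      simp [neg_div]
    have := ((Real.tendsto_exp_atBot.comp h1).const_mul ((√(2 * Real.pi))⁻¹)).neg
    simpa using this
  have hinteg : IntegrableOn (fun x => x * stdPDF x) (Set.Ioi c) :=
    integrableOn_Ioi_deriv_of_nonneg' (fun x _ => hderiv x)
      (fun x hx => mul_nonneg (hc.trans hx).le (stdPDF_pos x).le) hlim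
  have hval : ∫ x in Set.Ioi c, x * stdPDF x = stdPDF c := by
    rw [integral_Ioi_of_hasDerivAt_of_tendsto' (fun x _ => hderiv x) hinteg hlim]; ring
  have hle : ∫ x in Set.Ioi c, stdPDF x ≤ ∫ x in Set.Ioi c, c⁻¹ * (x * stdPDF x) := by
    apply setIntegral_mono_on integrable_stdPDF.integrableOn (hinteg.const_mul _) measurableSet_Ioi
    intro x hx
    have h1 : 1 ≤ c⁻¹ * x := by
      rw [inv_mul_eq_div, one_le_div hc]; exact le_of_lt hx
    have := stdPDF_pos x
    nlinarith
  rw [integral_const_mul, hval] at hle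
  rw [pValue_eq_integral, abs_of_pos hc, mul_div_assoc, div_eq_inv_mul]
  linarith

lemma pValue_chernoff (t : ℝ) : pValue t ≤ 2 * Real.exp (-t ^ 2 / 2) := by
  -- For |t| ≤ 1 the right side is at least 2 e^(-1/2) ≥ 1; otherwise the division by |t| in the
  -- Mills bound only helps.
  rcases le_or_gt |t| 1 with h | h
  · have h1 : t ^ 2 ≤ 1 := by rwa [sq_le_one_iff_abs_le_one]
    have h2 : Real.exp (-(1/2)) ≤ Real.exp (-t ^ 2 / 2) := by gcongr; linarith
    have h3 : (1:ℝ) / 2 ≤ Real.exp (-(1/2)) := by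
      have := Real.add_one_le_exp (-(1/2) : ℝ)
      linarith
    linarith [pValue_le_one t]
  · have h0 : 0 < |t| := by linarith
    have h1 := pValue_mills h0
    rw [pValue_abs] at h1
    have h2 : stdPDF |t| ≤ Real.exp (-t ^ 2 / 2) := by
      rw [stdPDF_eq, sq_abs]
      have h1 : (√(2 * Real.pi))⁻¹ ≤ 1 := by
        apply inv_le_one_of_one_le₀
        rw [Real.one_le_sqrt]
        linarith [Real.pi_gt_three]
      exact mul_le_of_le_one_left (Real.exp_nonneg _) h1
    have h3 : 2 * stdPDF |t| / |t| ≤ 2 * stdPDF |t| :=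
      div_le_self (by have := stdPDF_pos |t|; positivity) h.le
    linarith

lemma continuous_pValue : Continuous pValue := by
  have h : ∀ a b : ℝ, |pValue a - pValue b| ≤ 2 * |a - b| := by
    have key : ∀ a b : ℝ, |a| ≤ |b| → |pValue a - pValue b| ≤ 2 * |a - b| := by
      intro a b hab
      have h1 := pValue_sub_le (abs_nonneg a) hab
      rw [pValue_abs, pValue_abs] at h1
      have h2 := pValue_anti hab
      rw [abs_of_nonneg (by linarith)]
      have h3 : |b| - |a| ≤ |a - b| := by rw [abs_sub_comm]; exact abs_sub_abs_le_abs_sub b a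
      have h4 : (|b| - |a|) * stdPDF |a| ≤ |b| - |a| :=
        mul_le_of_le_one_right (by linarith) (stdPDF_le_one _)
      linarith
    intro a b
    rcases le_total |a| |b| with hab | hab
    · exact key a b hab
    · rw [abs_sub_comm, abs_sub_comm a]; exact key b a hab
  have : LipschitzWith 2 pValue := by
    apply LipschitzWith.of_dist_le_mul
    intro a b
    simpa [Real.dist_eq] using h a b
  exact this.continuous

lemma measurable_pValue : Measurable pValue := continuous_pValue.measurable

lemma exists_pValue_eq {t : ℝ} (h0 : 0 < t) (h1 : t ≤ 1) : ∃ c, 0 ≤ c ∧ pValue c = t := by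
  -- At this point the Chernoff bound equals t exactly, so the intermediate value theorem applies on
  -- [0, B].
  set B := √(2 * Real.log (2 / t)) with hB
  have hlog : 0 ≤ Real.log (2 / t) := Real.log_nonneg (by rw [le_div_iff₀ h0]; linarith)
  have hBt : pValue B ≤ t := by
    refine (pValue_chernoff B).trans ?_
    rw [hB, Real.sq_sqrt (by positivity)]
    rw [show -(2 * Real.log (2 / t)) / 2 = -Real.log (2 / t) by ring, Real.exp_neg,
      Real.exp_log (by positivity)]
    field_simp; rfl
  obtain ⟨c, hc, hct⟩ := intermediate_value_Icc' (Real.sqrt_nonneg (2 * Real.log (2 / t)))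
    continuous_pValue.continuousOn ⟨hBt, by rw [pValue_zero]; exact h1⟩
  exact ⟨c, hc.1, hct⟩

lemma pValue_strictAnti {a b : ℝ} (h : |a| < |b|) : pValue b < pValue a := by
  have h1 := le_pValue_sub (abs_nonneg a) h.le
  rw [pValue_abs, pValue_abs] at h1
  have : 0 < (|b| - |a|) * stdPDF |b| := mul_pos (by linarith) (stdPDF_pos _)
  linarith

lemma pValue_le_iff {a b : ℝ} : pValue b ≤ pValue a ↔ |a| ≤ |b| := by
  refine ⟨fun h => ?_, pValue_anti⟩
  by_contra! h'
  exact absurd h (not_le.mpr (pValue_strictAnti h'))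

/-- Under a null hypothesis the p-value is uniformly distributed. -/
lemma gaussian_pValue_le {t : ℝ} (ht : 0 ≤ t) :
    (gaussianReal 0 1).real {x | pValue x ≤ t} ≤ t := by
  rcases le_or_gt 1 t with h1 | h1
  · exact measureReal_le_one.trans h1
  rcases ht.eq_or_lt with rfl | h0
  · have : {x : ℝ | pValue x ≤ 0} = ∅ := by
      ext x; simpa using pValue_pos x
    simp [this]
  · obtain ⟨c, hc, rfl⟩ := exists_pValue_eq h0 h1.le
    simp_rw [pValue_le_iff]
    rw [← pValue_eq_real]

/-! ### Stability of p-values under shifts and variance inflation. -/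

/-- Perturbing the statistic by at most `η` changes the p-value by a factor close to one. -/
lemma pValue_ratio {a c η : ℝ} (ha : 0 ≤ a) (hac : a ≤ c) (hη : c - a ≤ η) :
    pValue a ≤ (1 + η * (1 + c) * Real.exp (3 / 2 + c * η)) * pValue c := by
  have hc : 0 ≤ c := ha.trans hac
  have h1 := pValue_sub_le ha hac
  -- The exponents differ by (c² - a²)/2 ≤ c (c - a) ≤ c η.
  have h2 : stdPDF a ≤ stdPDF c * Real.exp (c * η) := by
    rw [stdPDF_eq, stdPDF_eq, mul_assoc, ← Real.exp_add]
    gcongr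
    nlinarith
  have h3 := pValue_lower hc
  have h0 : (0:ℝ) < 1 + c := by linarith
  rw [div_le_iff₀ h0] at h3
  have h4 : 2 * stdPDF c ≤ pValue c * (1 + c) * Real.exp (3 / 2) := by
    have : 2 * stdPDF c = 2 * Real.exp (-(3 / 2)) * stdPDF c * Real.exp (3 / 2) := by
      rw [mul_right_comm _ (stdPDF c), mul_assoc 2, ← Real.exp_add]; norm_num
    rw [this]
    gcongr
  have hη0 : 0 ≤ η := by linarith
  have h5 : (c - a) * stdPDF a ≤ η * (stdPDF c * Real.exp (c * η)) :=
    mul_le_mul hη h2 (stdPDF_pos a).le hη0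
  have h6 : 2 * (η * (stdPDF c * Real.exp (c * η)))
      ≤ η * (1 + c) * Real.exp (3 / 2 + c * η) * pValue c := by
    rw [Real.exp_add]
    calc 2 * (η * (stdPDF c * Real.exp (c * η))) = η * Real.exp (c * η) * (2 * stdPDF c) := by ring
      _ ≤ η * Real.exp (c * η) * (pValue c * (1 + c) * Real.exp (3 / 2)) := by gcongr
      _ = _ := by ring
  linarith

/-- If `|y - z| ≤ η` and `y` has p-value at most `t`, then `z` has p-value at most `(1 + ε) t`,
provided that `t` is not too small relative to `η`. -/
lemma pValue_perturb {y z η ε t B : ℝ} (hη : 0 ≤ η) (hyz : |y - z| ≤ η) (hB : 0 ≤ B)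
    (hBt : (1 + ε) * pValue B ≤ t) (hε : 0 ≤ ε)
    (hε' : η * (1 + B) * Real.exp (3 / 2 + B * η) ≤ ε) (hy : pValue y ≤ t) :
    pValue z ≤ (1 + ε) * t := by
  have ht : 0 ≤ t := (pValue_nonneg y).trans hy
  have hz : |y| - η ≤ |z| := by
    have := abs_sub_abs_le_abs_sub y z; linarith
  -- Applied with c = |y| when |y| ≤ B, and with c = B beyond: the relative error cannot be
  -- controlled for arbitrarily large |y|, but there the p-value at B is already far enough below t.
  have key : ∀ c, 0 ≤ c → c ≤ B → c ≤ |y| → pValue z ≤ (1 + ε) * pValue c := by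
    intro c hc hcB hcy
    have h1 : pValue z ≤ pValue (max (c - η) 0) := by
      apply pValue_anti
      rw [abs_of_nonneg (le_max_right _ _)]
      exact max_le (by linarith) (abs_nonneg z)
    have h2 := pValue_ratio (η := η) (le_max_right (c - η) 0) (max_le (by linarith) hc)
      (by have := le_max_left (c - η) 0; linarith)
    refine h1.trans (h2.trans ?_)
    have h3 : η * (1 + c) * Real.exp (3 / 2 + c * η)
        ≤ η * (1 + B) * Real.exp (3 / 2 + B * η) := by gcongr
    have := pValue_nonneg c
    gcongr
    linarith
  rcases le_total |y| B with h | h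
  · refine (key |y| (abs_nonneg y) h le_rfl).trans ?_
    rw [pValue_abs]; gcongr
  · refine (key B hB le_rfl h).trans (hBt.trans ?_)
    nlinarith

/-- Variance inflation by `w` changes the probability of a small p-value by a bounded factor as
long as `w log (1 / t)` is bounded. -/
lemma exists_inflated_pValue_bound : ∃ A : ℝ, 1 ≤ A ∧ ∀ w t L : ℝ, 0 ≤ w → 0 < t →
    0 ≤ L → Real.log (2 / t) ≤ L → ∀ c, pValue c ≤ t →
      pValue (c / √(1 + w)) ≤ A * Real.exp (w * (1 + L)) * t := by
  -- The second constant makes the bound trivial for t ≥ `pValue 1`; the first comes from dividing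
  -- the Mills bound by `pValue_lower` at critical values above one.
  refine ⟨max (2 * Real.exp (3 / 2)) (1 / pValue 1), ?_, ?_⟩
  · refine le_max_of_le_left ?_
    have := Real.add_one_le_exp (3 / 2 : ℝ)
    linarith
  intro w t L hw ht hL hLt c hct
  set A := max (2 * Real.exp (3 / 2)) (1 / pValue 1) with hA
  have hp1 := pValue_pos 1
  have hA0 : 0 ≤ A := le_trans (by positivity) (le_max_left _ _)
  have hexp : 1 ≤ Real.exp (w * (1 + L)) := Real.one_le_exp (by positivity)
  rcases le_or_gt (pValue 1) t with h1 | h1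
  · calc pValue (c / √(1 + w)) ≤ 1 := pValue_le_one _
      _ ≤ 1 / pValue 1 * t := by rw [div_mul_eq_mul_div, one_mul, one_le_div hp1]; exact h1
      _ ≤ A * t := by gcongr; exact le_max_right _ _
      _ = A * 1 * t := by ring
      _ ≤ _ := by gcongr
  · obtain ⟨c', hc', rfl⟩ := exists_pValue_eq ht (h1.le.trans (pValue_le_one 1))
    have hcc : c' ≤ |c| := by
      have := pValue_le_iff.mp hct
      rwa [abs_of_nonneg hc'] at this
    have hc1 : 1 < c' := by
      by_contra! h
      have := pValue_anti (a := c') (b := 1) (by rw [abs_of_nonneg hc']; simpa using h)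
      linarith
    have hw1 : (0:ℝ) < 1 + w := by linarith
    have hs : 0 < √(1 + w) := Real.sqrt_pos.mpr hw1
    have hs2 : √(1 + w) ≤ Real.exp w := by
      have h1 := Real.add_one_le_exp w
      have h2 : √(1 + w) ≤ 1 + w := by
        rw [Real.sqrt_le_left hw1.le]; nlinarith
      linarith
    have e1 : pValue (c / √(1 + w)) ≤ pValue (c' / √(1 + w)) := by
      apply pValue_anti
      rw [abs_div, abs_div, abs_of_nonneg hc']
      gcongr
    have e2 := pValue_mills (c := c' / √(1 + w)) (by positivity)
    have hsq : c' ^ 2 ≤ 2 * L := by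
      have h2 := pValue_chernoff c'
      have h3 : Real.exp (c' ^ 2 / 2) ≤ 2 / pValue c' := by
        rw [le_div_iff₀ ht]
        have : Real.exp (c' ^ 2 / 2) * Real.exp (-c' ^ 2 / 2) = 1 := by
          rw [← Real.exp_add]; ring_nf; simp
        calc Real.exp (c' ^ 2 / 2) * pValue c'
            ≤ Real.exp (c' ^ 2 / 2) * (2 * Real.exp (-c' ^ 2 / 2)) := by gcongr
          _ = 2 := by linear_combination 2 * this
      have := Real.log_le_log (Real.exp_pos _) h3
      rw [Real.log_exp] at this
      linarith
    -- Since c'²/(1 + w) ≥ c'² - w c', with the last factor squared as well, the exponent changes by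
    -- at most w c'²/2 ≤ w L.
    have e3 : stdPDF (c' / √(1 + w)) ≤ stdPDF c' * Real.exp (w * L) := by
      rw [stdPDF_eq, stdPDF_eq, mul_assoc, ← Real.exp_add]
      gcongr
      rw [div_pow, Real.sq_sqrt hw1.le]
      have : c' ^ 2 / (1 + w) ≥ c' ^ 2 - c' ^ 2 * w := by
        rw [ge_iff_le, le_div_iff₀ hw1]
        nlinarith [mul_nonneg (sq_nonneg c') (sq_nonneg w)]
      nlinarith
    have e4 := pValue_lower hc'
    rw [div_le_iff₀ (by linarith)] at e4
    have e5 : 2 * stdPDF c' ≤ pValue c' * (1 + c') * Real.exp (3 / 2) := by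
      have : 2 * stdPDF c' = 2 * Real.exp (-(3 / 2)) * stdPDF c' * Real.exp (3 / 2) := by
        rw [mul_right_comm _ (stdPDF c'), mul_assoc 2, ← Real.exp_add]; norm_num
      rw [this]
      gcongr
    have hpdf : 0 ≤ 2 * (stdPDF c' * Real.exp (w * L)) := by
      have := stdPDF_pos c'
      positivity
    calc pValue (c / √(1 + w)) ≤ 2 * stdPDF (c' / √(1 + w)) / (c' / √(1 + w)) := e1.trans e2
      _ = 2 * stdPDF (c' / √(1 + w)) * √(1 + w) / c' := by field_simp
      _ ≤ 2 * (stdPDF c' * Real.exp (w * L)) * Real.exp w / c' := by gcongr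
      _ = 2 * stdPDF c' * Real.exp (w * (1 + L)) / c' := by
          rw [mul_add, mul_one, Real.exp_add]; ring
      _ ≤ pValue c' * (1 + c') * Real.exp (3 / 2) * Real.exp (w * (1 + L)) / c' := by gcongr
      _ ≤ pValue c' * (2 * c') * Real.exp (3 / 2) * Real.exp (w * (1 + L)) / c' := by
          gcongr
          linarith
      _ = (2 * Real.exp (3 / 2)) * Real.exp (w * (1 + L)) * pValue c' := by
          field_simp
      _ ≤ _ := by gcongr; exact le_max_left _ _

/-- A crude Gaussian lower bound for the p-value. -/
lemma exists_pValue_gaussian_lower : ∃ a : ℝ, 0 < a ∧ ∀ y : ℝ,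
    a * Real.exp (-(3 / 5) * y ^ 2) ≤ pValue y := by
  -- The excess of 3/5 over 1/2 absorbs the denominator 1 + |y| ≤ e^|y|: the maximum of |y| - y²/10
  -- is 5/2, attained at |y| = 5.
  refine ⟨2 * Real.exp (-(3 / 2)) * (√(2 * Real.pi))⁻¹ * Real.exp (-(5 / 2)), by positivity, ?_⟩
  intro y
  have h := pValue_lower (abs_nonneg y)
  rw [pValue_abs] at h
  refine le_trans ?_ h
  rw [stdPDF_eq, le_div_iff₀ (by positivity), sq_abs]
  have h1 : 1 + |y| ≤ Real.exp |y| := by linarith [Real.add_one_le_exp |y|]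
  have h2 : Real.exp (-(5 / 2)) * Real.exp (-(3 / 5) * y ^ 2) * (1 + |y|)
      ≤ Real.exp (-y ^ 2 / 2) := by
    calc _ ≤ Real.exp (-(5 / 2)) * Real.exp (-(3 / 5) * y ^ 2) * Real.exp |y| := by gcongr
      _ = Real.exp (-(5 / 2) + -(3 / 5) * y ^ 2 + |y|) := by rw [Real.exp_add, Real.exp_add]
      _ ≤ _ := by
        gcongr
        have := sq_abs y
        nlinarith [sq_nonneg (|y| - 5)]
  calc _ = 2 * Real.exp (-(3 / 2)) * (√(2 * Real.pi))⁻¹ *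
        (Real.exp (-(5 / 2)) * Real.exp (-(3 / 5) * y ^ 2) * (1 + |y|)) := by ring
    _ ≤ 2 * Real.exp (-(3 / 2)) * (√(2 * Real.pi))⁻¹ * Real.exp (-y ^ 2 / 2) := by gcongr
    _ = _ := by ring

/-! ### Combinatorics of the Benjamini–Hochberg rejection set. -/

lemma card_filter_comp_sort {m : ℕ} (q : Fin m → ℝ) (a : ℝ) :
    (Finset.univ.filter fun j => q (Tuple.sort q j) ≤ a).card
      = (Finset.univ.filter fun j => q j ≤ a).card := by
  refine Finset.card_bij (fun j _ => Tuple.sort q j) ?_ ?_ ?_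
  · intro j hj; simpa using hj
  · intro a _ b _ h; exact (Tuple.sort q).injective h
  · intro b hb
    exact ⟨(Tuple.sort q).symm b, by simpa using hb, by simp⟩

/-- The Benjamini–Hochberg rejection set without reference to order statistics. -/
lemma mem_benjaminiHochberg_iff {m : ℕ} {α : ℝ} (hα : 0 ≤ α) (q : Fin m → ℝ) (i : Fin m) :
    i ∈ benjaminiHochberg α q ↔ ∃ k : ℕ, q i ≤ k * α / m ∧
      k ≤ (Finset.univ.filter fun j => q j ≤ k * α / m).card := by
  have hsort : ∀ (j : Fin m) (a : ℝ), q (Tuple.sort q j) ≤ a ↔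
      (j : ℕ) < (Finset.univ.filter fun l => q l ≤ a).card := by
    intro j a
    rw [← card_filter_comp_sort q a]
    exact (Tuple.lt_card_le_iff_apply_le_of_monotone (Tuple.monotone_sort q)).symm
  constructor
  · rintro ⟨k, ⟨hk, -⟩, hi⟩
    -- Indices in the definition start at zero, counts start at one.
    refine ⟨(k : ℕ) + 1, ?_, ?_⟩
    · push_cast
      exact hi.trans hk
    · push_cast
      exact (hsort k _).mp hk
  · rintro ⟨k, hik, hk⟩
    -- the largest admissible index exists
    set S : Set (Fin m) := {j : Fin m | q (Tuple.sort q j) ≤ ((j : ℕ) + 1 : ℝ) * α / m} with hS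
    have hmono : ∀ {a b : ℕ}, a ≤ b → (a : ℝ) * α / m ≤ b * α / m := by
      intro a b hab
      have : (a : ℝ) ≤ b := by exact_mod_cast hab
      gcongr
    set n := (Finset.univ.filter fun j => q j ≤ k * α / m).card with hn
    have hn0 : 0 < n := Finset.card_pos.mpr ⟨i, by simpa using hik⟩
    have hnm : n ≤ m := by
      have := Finset.card_le_univ (Finset.univ.filter fun j => q j ≤ k * α / m)
      simpa using this
    -- Exactly n p-values lie below kα/m, so the n-th smallest does; as k ≤ n it also lies below
    -- nα/m, and its zero-based index is n - 1.
    have hmem : (⟨n - 1, by omega⟩ : Fin m) ∈ S := by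
      have h1 : q (Tuple.sort q ⟨n - 1, by omega⟩) ≤ k * α / m := by
        rw [hsort]; simp only; omega
      have h2 := hmono hk
      have h3 : (((n - 1 : ℕ) : ℝ) + 1) = n := by
        have : n - 1 + 1 = n := by omega
        exact_mod_cast this
      change q _ ≤ (((n - 1 : ℕ) : ℝ) + 1) * α / m
      rw [h3]
      exact h1.trans h2
    obtain ⟨K, hK⟩ : ∃ K, IsGreatest S K := by
      have hfin : S.Finite := Set.toFinite S
      obtain ⟨K, hK, hmax⟩ := hfin.exists_maximal ⟨_, hmem⟩
      refine ⟨K, hK, fun j hj => ?_⟩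
      rcases le_total j K with h | h
      · exact h
      · exact hmax hj h
    refine ⟨K, hK, ?_⟩
    by_contra! hlt
    have hKn : n - 1 ≤ (K : ℕ) := hK.2 hmem
    -- the coordinate `i` has a p-value at most `(K + 1) α / m`, so a larger index is admissible
    have hiK : q i ≤ ((K + 1 : ℕ) : ℝ) * α / m :=
      hik.trans (hmono (by omega))
    set N := (Finset.univ.filter fun j => q j ≤ ((K + 1 : ℕ) : ℝ) * α / m).card with hN
    have hNm : N ≤ m := by
      have := Finset.card_le_univ (Finset.univ.filter fun j => q j ≤ ((K + 1 : ℕ) : ℝ) * α / m)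
      simpa only [Fintype.card_fin] using this
    have hKN : (K : ℕ) + 1 < N := by
      set l := (Tuple.sort q).symm i with hl
      have hli : Tuple.sort q l = i := by simp [hl]
      have hKl : K < l := by
        by_contra! h
        have := Tuple.monotone_sort q h
        simp only [Function.comp, hli] at this
        linarith
      have := (hsort l (((K + 1 : ℕ) : ℝ) * α / m)).mp (by rw [hli]; exact hiK)
      have h2 : (K : ℕ) < l := hKl
      omega
    have hmem2 : (⟨N - 1, by omega⟩ : Fin m) ∈ S := by
      have h1 : q (Tuple.sort q ⟨N - 1, by omega⟩) ≤ ((K + 1 : ℕ) : ℝ) * α / m := by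
        rw [hsort]; simp only; omega
      have h2 := hmono hKN.le
      have h3 : (((N - 1 : ℕ) : ℝ) + 1) = N := by
        have : N - 1 + 1 = N := by omega
        exact_mod_cast this
      change q _ ≤ (((N - 1 : ℕ) : ℝ) + 1) * α / m
      rw [h3]
      exact h1.trans h2
    have : N - 1 ≤ (K : ℕ) := hK.2 hmem2
    omega

/-- Two families of p-values need to be compared only at the m thresholds of the procedure.
Positivity excludes k = 0, so the smallest relevant threshold is α/m; this is what permits a
comparison that fails for extremely small p-values. -/
lemma benjaminiHochberg_subset {m : ℕ} {α α' : ℝ} (hα : 0 ≤ α) (hα' : 0 ≤ α') {q q' : Fin m → ℝ}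
    (h : ∀ k : ℕ, 1 ≤ k → k ≤ m → ∀ j, q j ≤ k * α / m → q' j ≤ k * α' / m) (hq : ∀ j, 0 < q j) :
    benjaminiHochberg α q ⊆ benjaminiHochberg α' q' := by
  intro i hi
  rw [mem_benjaminiHochberg_iff hα] at hi
  rw [mem_benjaminiHochberg_iff hα']
  obtain ⟨k, h1, h2⟩ := hi
  have hkm : k ≤ m := by
    have := Finset.card_le_univ (Finset.univ.filter fun j => q j ≤ k * α / m)
    simp only [Fintype.card_fin] at this
    exact h2.trans this
  have hk1 : 1 ≤ k := by
    by_contra! h0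
    have : k = 0 := by omega
    subst this
    simp at h1
    linarith [hq i]
  refine ⟨k, h k hk1 hkm i h1, h2.trans (Finset.card_le_card ?_)⟩
  intro j hj
  simp only [Finset.mem_filter, Finset.mem_univ, true_and] at hj ⊢
  exact h k hk1 hkm j hj

lemma benjaminiHochberg_anti {m : ℕ} {α : ℝ} (hα : 0 ≤ α) {q q' : Fin m → ℝ} (h : ∀ j, q' j ≤ q j) :
    benjaminiHochberg α q ⊆ benjaminiHochberg α q' := by
  intro i hi
  rw [mem_benjaminiHochberg_iff hα] at hi ⊢
  obtain ⟨k, h1, h2⟩ := hi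
  refine ⟨k, (h i).trans h1, h2.trans (Finset.card_le_card ?_)⟩
  intro j hj
  simp only [Finset.mem_filter, Finset.mem_univ, true_and] at hj ⊢
  exact (h j).trans hj

open Classical in
/-- The set of rejections as a finset. -/
noncomputable def bhFinset {m : ℕ} (α : ℝ) (q : Fin m → ℝ) : Finset (Fin m) :=
  Finset.univ.filter fun i => i ∈ benjaminiHochberg α q

@[simp] lemma mem_bhFinset {m : ℕ} {α : ℝ} {q : Fin m → ℝ} {i : Fin m} :
    i ∈ bhFinset α q ↔ i ∈ benjaminiHochberg α q := by simp [bhFinset]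

/-- A witness k for one rejection also witnesses the rejection of every p-value below kα/m, so k
never exceeds the total number of rejections. -/
lemma le_of_mem_benjaminiHochberg {m : ℕ} {α : ℝ} (hα : 0 ≤ α) {q : Fin m → ℝ} {i : Fin m}
    (hi : i ∈ benjaminiHochberg α q) : q i ≤ (bhFinset α q).card * α / m := by
  have hi' := hi
  rw [mem_benjaminiHochberg_iff hα] at hi'
  obtain ⟨k, h1, h2⟩ := hi'
  have : k ≤ (bhFinset α q).card := by
    refine h2.trans (Finset.card_le_card fun j hj => ?_)
    rw [mem_bhFinset, mem_benjaminiHochberg_iff hα]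
    exact ⟨k, by simpa using hj, h2⟩
  have : (k : ℝ) ≤ (bhFinset α q).card := by exact_mod_cast this
  refine h1.trans ?_
  gcongr

lemma measurableSet_mem_benjaminiHochberg {Ω : Type*} [MeasurableSpace Ω] {m : ℕ} {α : ℝ}
    (hα : 0 ≤ α) {q : Ω → Fin m → ℝ} (hq : ∀ i, Measurable fun ω => q ω i) (i : Fin m) :
    MeasurableSet {ω | i ∈ benjaminiHochberg α (q ω)} := by
  simp_rw [mem_benjaminiHochberg_iff hα]
  have : {ω | ∃ k : ℕ, q ω i ≤ k * α / m ∧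
      k ≤ (Finset.univ.filter fun j => q ω j ≤ k * α / m).card}
      = ⋃ k : ℕ, {ω | q ω i ≤ k * α / m} ∩
        {ω | k ≤ (Finset.univ.filter fun j => q ω j ≤ k * α / m).card} := by
    ext ω; simp
  rw [this]
  refine MeasurableSet.iUnion fun k => MeasurableSet.inter
    (measurableSet_le (hq i) measurable_const) ?_
  have hcard : Measurable fun ω => (Finset.univ.filter fun j => q ω j ≤ k * α / m).card := by
    simp_rw [Finset.card_filter]
    refine Finset.measurable_fun_sum _ fun j _ => ?_
    exact Measurable.ite (measurableSet_le (hq j) measurable_const) measurable_const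
      measurable_const
  exact measurableSet_le measurable_const hcard

/-! ### Resampling a coordinate of a product measure. -/

section Product

variable {X Y : Type*} [MeasurableSpace X] [MeasurableSpace Y]

lemma integrable_real_prodMk {μ : Measure X} {ν : Measure Y} [IsProbabilityMeasure μ]
    [IsProbabilityMeasure ν] {s : Set (X × Y)} (hs : MeasurableSet s) :
    Integrable (fun x => ν.real (Prod.mk x ⁻¹' s)) μ :=
  Measure.integrable_measure_prodMk_left hs (measure_ne_top _ _)

lemma real_prod_eq_integral {μ : Measure X} {ν : Measure Y} [IsProbabilityMeasure μ]
    [IsProbabilityMeasure ν] {s : Set (X × Y)} (hs : MeasurableSet s) :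
    (μ.prod ν).real s = ∫ x, ν.real (Prod.mk x ⁻¹' s) ∂μ := by
  rw [measureReal_def, Measure.prod_apply hs, ← integral_toReal
    (measurable_measure_prodMk_left hs).aemeasurable (ae_of_all _ fun x => measure_lt_top _ _)]
  rfl

lemma real_prod_le {μ : Measure X} {ν : Measure Y} [IsProbabilityMeasure μ]
    [IsProbabilityMeasure ν] {s : Set (X × Y)} (hs : MeasurableSet s) {g : X → ℝ}
    (hg : Integrable g μ) (h : ∀ x, ν.real (Prod.mk x ⁻¹' s) ≤ g x) :
    (μ.prod ν).real s ≤ ∫ x, g x ∂μ := by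
  rw [real_prod_eq_integral hs]
  exact integral_mono (integrable_real_prodMk hs) hg h

variable {ι : Type*} [Fintype ι] [DecidableEq ι]

/-- Resampling one coordinate of a product measure does not change it. -/
lemma measurePreserving_update (μ : ι → Measure X) [∀ i, IsProbabilityMeasure (μ i)] (i : ι) :
    MeasurePreserving (fun p : (ι → X) × X => Function.update p.1 i p.2)
      ((Measure.pi μ).prod (μ i)) (Measure.pi μ) := by
  have hm : Measurable (fun p : (ι → X) × X => Function.update p.1 i p.2) := by
    rw [measurable_pi_iff]
    intro j
    by_cases h : j = i
    · subst h; simpa using measurable_snd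
    · simp only [Function.update_of_ne h]
      fun_prop
  refine ⟨hm, (Measure.pi_eq fun s hs => ?_).symm⟩
  rw [Measure.map_apply hm (MeasurableSet.univ_pi hs)]
  have : (fun p : (ι → X) × X => Function.update p.1 i p.2) ⁻¹' (Set.univ.pi s)
      = (Set.univ.pi (Function.update s i Set.univ)) ×ˢ s i := by
    ext ⟨x, y⟩
    simp only [Set.mem_preimage, Set.mem_pi, Set.mem_univ, true_implies, Set.mem_prod]
    constructor
    · intro h
      refine ⟨fun j => ?_, by simpa using h i⟩
      by_cases hj : j = i
      · subst hj; simp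
      · simpa [Function.update_of_ne hj] using h j
    · rintro ⟨h1, h2⟩ j
      by_cases hj : j = i
      · subst hj; simpa using h2
      · simpa [Function.update_of_ne hj] using h1 j
  rw [this, Measure.prod_prod, Measure.pi_pi, ← Finset.prod_erase_mul _ _ (Finset.mem_univ i),
    ← Finset.prod_erase_mul _ _ (Finset.mem_univ i)]
  simp only [Function.update_self, measure_univ, mul_one]
  congr 1
  refine Finset.prod_congr rfl fun j hj => ?_
  rw [Function.update_of_ne (Finset.ne_of_mem_erase hj)]

/-- Conditioning on all coordinates other than i, without splitting the index set: the value of x at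
i is discarded by the update. -/
lemma real_pi_eq_integral_update (μ : ι → Measure X) [∀ i, IsProbabilityMeasure (μ i)] (i : ι)
    {s : Set (ι → X)} (hs : MeasurableSet s) :
    (Measure.pi μ).real s
      = ∫ x, (μ i).real {y | Function.update x i y ∈ s} ∂(Measure.pi μ) := by
  have h := measurePreserving_update μ i
  conv_lhs => rw [← h.map_eq, map_measureReal_apply h.measurable hs]
  rw [real_prod_eq_integral (h.measurable hs)]
  rfl

end Product

/-! ### Leave-one-out control of false rejections for independent p-values. -/

lemma card_eq_sum_indicator {ι : Type*} [Fintype ι] (s : Finset ι) :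
    (s.card : ℝ) = ∑ j, (s : Set ι).indicator (fun _ => (1 : ℝ)) j := by
  classical
  simp [Set.indicator_apply]

section LeaveOneOut

variable {m : ℕ} {X : Type*} [MeasurableSpace X]

lemma card_bhFinset_eq (α : ℝ) (q : Fin m → ℝ) :
    ((bhFinset α q).card : ℝ)
      = ∑ j, {j | j ∈ benjaminiHochberg α q}.indicator (fun _ => (1 : ℝ)) j := by
  rw [card_eq_sum_indicator]
  congr! 2
  ext j; simp

lemma integral_card_bhFinset {Ω : Type*} [MeasurableSpace Ω] (μ : Measure Ω)
    [IsProbabilityMeasure μ] {α : ℝ} (hα : 0 ≤ α) {q : Ω → Fin m → ℝ}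
    (hq : ∀ i, Measurable fun ω => q ω i) :
    Integrable (fun ω => ((bhFinset α (q ω)).card : ℝ)) μ ∧
    ∫ ω, ((bhFinset α (q ω)).card : ℝ) ∂μ
      = ∑ j, μ.real {ω | j ∈ benjaminiHochberg α (q ω)} := by
  have h : (fun ω => ((bhFinset α (q ω)).card : ℝ)) = fun ω => ∑ j,
      {ω | j ∈ benjaminiHochberg α (q ω)}.indicator (fun _ => (1 : ℝ)) ω := by
    funext ω
    rw [card_bhFinset_eq]
    refine Finset.sum_congr rfl fun j _ => ?_
    classical
    simp only [Set.indicator_apply, Set.mem_ofPred_eq]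
  have hi : ∀ j, Integrable
      ({ω | j ∈ benjaminiHochberg α (q ω)}.indicator (fun _ => (1 : ℝ))) μ := fun j =>
    (integrable_const 1).indicator (measurableSet_mem_benjaminiHochberg hα hq j)
  refine ⟨by rw [h]; exact integrable_finsetSum _ fun j _ => hi j, ?_⟩
  rw [h, integral_finsetSum _ fun j _ => hi j]
  refine Finset.sum_congr rfl fun j _ => ?_
  rw [integral_indicator_const _ (measurableSet_mem_benjaminiHochberg hα hq j)]
  simp

/-- The probability of rejecting a true null is controlled by the expected number of rejections
after its p-value has been replaced by zero. -/
lemma real_mem_bh_le (μ : Fin m → Measure X) [∀ i, IsProbabilityMeasure (μ i)] {α : ℝ}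
    (hα : 0 ≤ α) (q : Fin m → X → ℝ) (hq : ∀ i, Measurable (q i)) (hq0 : ∀ i x, 0 ≤ q i x)
    (i : Fin m) (hi : ∀ t, 0 ≤ t → (μ i).real {x | q i x ≤ t} ≤ t) :
    (Measure.pi μ).real {x | i ∈ benjaminiHochberg α fun j => q j (x j)} ≤
      α / m * ∑ j, (Measure.pi μ).real
        {x | j ∈ benjaminiHochberg α fun j => Function.update q i (fun _ => 0) j (x j)} := by
  set q' := Function.update q i (fun _ => 0) with hq'
  have hqm : ∀ j, Measurable fun x : Fin m → X => q j (x j) :=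
    fun j => (hq j).comp (measurable_pi_apply j)
  have hqm' : ∀ j, Measurable fun x : Fin m → X => q' j (x j) := by
    intro j
    by_cases h : j = i
    · subst h; simp [hq']
    · simpa [hq', Function.update_of_ne h] using hqm j
  have hle : ∀ (x : Fin m → X) j, q' j (x j) ≤ q j (x j) := by
    intro x j
    by_cases h : j = i
    · subst h; simpa [hq'] using hq0 j (x j)
    · simp [hq', Function.update_of_ne h]
  obtain ⟨hinteg, hval⟩ := integral_card_bhFinset (Measure.pi μ) hα hqm'
  rw [← hval, ← integral_const_mul,
    real_pi_eq_integral_update μ i (measurableSet_mem_benjaminiHochberg hα hqm i)]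
  refine integral_mono_of_nonneg (ae_of_all _ fun x => measureReal_nonneg) (hinteg.const_mul _)
    (ae_of_all _ fun x => ?_)
  -- Once the p-value of i is zero, the number of rejections no longer depends on coordinate i and
  -- can only have grown. Given the other coordinates, rejection of i thus forces its p-value below
  -- the constant αR/m.
  set R := ((bhFinset α fun j => q' j (x j)).card : ℝ) with hR
  have hupd : ∀ y, (fun j => q' j (Function.update x i y j)) = fun j => q' j (x j) := by
    intro y
    funext j
    by_cases h : j = i
    · subst h; simp [hq']
    · simp [Function.update_of_ne h]
  refine le_trans (measureReal_mono fun y hy => ?_) (hi (α / m * R) (by positivity))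
  have hy' : i ∈ benjaminiHochberg α fun j => q j (Function.update x i y j) := hy
  have h1 := le_of_mem_benjaminiHochberg hα hy'
  have h2 : (bhFinset α fun j => q j (Function.update x i y j)).card
      ≤ (bhFinset α fun j => q' j (x j)).card := by
    rw [← hupd y]
    refine Finset.card_le_card fun j hj => ?_
    rw [mem_bhFinset] at hj ⊢
    exact benjaminiHochberg_anti hα (hle _) hj
  simp only [Function.update_self] at h1
  have h3 : ((bhFinset α fun j => q j (Function.update x i y j)).card : ℝ) ≤ R := by
    rw [hR]; exact_mod_cast h2
  change q i y ≤ α / m * R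
  refine h1.trans ?_
  rw [mul_div_assoc, mul_comm]
  gcongr

/-- Expected number of false rejections of the Benjamini–Hochberg procedure with independent
p-values: at most `r_α (m₁ + 1 / (1 - α))`, where `m₁` is the number of false nulls. -/
lemma sum_real_mem_bh_le (μ : Fin m → Measure X) [∀ i, IsProbabilityMeasure (μ i)] {α : ℝ}
    (hα : α ∈ Set.Ioo (0 : ℝ) 1) (S : Finset (Fin m)) (q : Fin m → X → ℝ)
    (hq : ∀ i, Measurable (q i)) (hq0 : ∀ i x, 0 ≤ q i x)
    (hS : ∀ i ∈ S, ∀ t, 0 ≤ t → (μ i).real {x | q i x ≤ t} ≤ t) :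
    ∑ i ∈ S, (Measure.pi μ).real {x | i ∈ benjaminiHochberg α fun j => q j (x j)}
      ≤ odds α * (m - S.card) + odds α / (1 - α) := by
  have h1α : 0 < 1 - α := by linarith [hα.2]
  have hodds : 0 < odds α := div_pos hα.1 h1α
  -- Zeroing the p-value of i turns i into one more false null, so the induction hypothesis applies
  -- to S without i and to modified p-values, whence the generalisation over q.
  induction S using Finset.strongInduction generalizing q with
  | H S ih =>
  have hcard : (S.card : ℝ) ≤ m := by
    have := Finset.card_le_univ S
    simp only [Fintype.card_fin] at this
    exact_mod_cast this
  have hterm : ∀ i ∈ S, (Measure.pi μ).real {x | i ∈ benjaminiHochberg α fun j => q j (x j)}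
      ≤ α / m * ((m - S.card + 1) + (odds α * (m - S.card + 1) + odds α / (1 - α))) := by
    intro i hi
    refine (real_mem_bh_le μ hα.1.le q hq hq0 i (hS i hi)).trans ?_
    refine mul_le_mul_of_nonneg_left ?_ (div_nonneg hα.1.le (Nat.cast_nonneg m))
    rw [← Finset.sum_compl_add_sum (S.erase i)]
    have hc : ((S.erase i).card : ℝ) = S.card - 1 := by
      rw [Finset.card_erase_of_mem hi, Nat.cast_sub (Finset.card_pos.mpr ⟨i, hi⟩)]; simp
    gcongr ?_ + ?_
    · refine (Finset.sum_le_sum fun j _ => measureReal_le_one).trans ?_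
      rw [Finset.sum_const, Finset.card_compl, nsmul_eq_mul, mul_one,
        Nat.cast_sub (Finset.card_le_univ _), hc]
      simp
    · refine (ih (S.erase i) (Finset.erase_ssubset hi) _ ?_ ?_ ?_).trans ?_
      · intro j
        by_cases h : j = i
        · subst h; simp
        · simpa [Function.update_of_ne h] using hq j
      · intro j x
        by_cases h : j = i
        · subst h; simp
        · simpa [Function.update_of_ne h] using hq0 j x
      · intro j hj t ht
        rw [Function.update_of_ne (Finset.ne_of_mem_erase hj)]
        exact hS j (Finset.mem_of_mem_erase hj) t ht
      · rw [hc]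
        apply le_of_eq; ring
  refine (Finset.sum_le_sum hterm).trans ?_
  rw [Finset.sum_const, nsmul_eq_mul]
  set n := (m : ℝ) - S.card with hn
  have hn0 : 0 ≤ n := by linarith
  set Q := (n + 1) + (odds α * (n + 1) + odds α / (1 - α)) with hQ
  have hQ0 : 0 ≤ Q := by positivity
  have hstep : (S.card : ℝ) * (α / m * Q) ≤ α * Q := by
    rcases (Nat.cast_nonneg m : (0 : ℝ) ≤ m).eq_or_lt with h0 | h0
    · rw [← h0]; simp; exact mul_nonneg hα.1.le hQ0
    · have : (S.card : ℝ) / m ≤ 1 := by rw [div_le_one h0]; exact hcard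
      calc (S.card : ℝ) * (α / m * Q) = (S.card : ℝ) / m * (α * Q) := by ring
        _ ≤ 1 * (α * Q) := by
            gcongr
            exact mul_nonneg hα.1.le hQ0
        _ = _ := one_mul _
  -- The claimed bound is the exact fixed point of the recursion, because α (1 + r_α) = r_α.
  refine hstep.trans (le_of_eq ?_)
  rw [hQ, odds]
  field_simp
  ring

end LeaveOneOut

/-! ### Representations of the two-groups model. -/

/-- The Bernoulli(`p`) law on `Bool`. -/
noncomputable def bern (p : ℝ) : Measure Bool :=
  ENNReal.ofReal (1 - p) • Measure.dirac false + ENNReal.ofReal p • Measure.dirac true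

lemma isProbabilityMeasure_mix {X : Type*} [MeasurableSpace X] {p : ℝ} (h0 : 0 ≤ p) (h1 : p ≤ 1)
    (μ ν : Measure X) [IsProbabilityMeasure μ] [IsProbabilityMeasure ν] :
    IsProbabilityMeasure (ENNReal.ofReal (1 - p) • μ + ENNReal.ofReal p • ν) := by
  constructor
  simp only [Measure.coe_add, Measure.coe_smul, Pi.add_apply, Pi.smul_apply, measure_univ,
    smul_eq_mul, mul_one]
  rw [← ENNReal.ofReal_add (by linarith) h0]
  simp

lemma real_mix {X : Type*} [MeasurableSpace X] {p : ℝ} (h0 : 0 ≤ p) (h1 : p ≤ 1)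
    (μ ν : Measure X) [IsProbabilityMeasure μ] [IsProbabilityMeasure ν] (s : Set X) :
    (ENNReal.ofReal (1 - p) • μ + ENNReal.ofReal p • ν).real s
      = (1 - p) * μ.real s + p * ν.real s := by
  have h : ∀ (c : ℝ) (κ : Measure X) [IsProbabilityMeasure κ], (ENNReal.ofReal c • κ) s ≠ ⊤ :=
    fun c κ _ => by simpa using ENNReal.mul_ne_top ENNReal.ofReal_ne_top (measure_ne_top κ s)
  rw [measureReal_add_apply (h _ _) (h _ _), measureReal_ennreal_smul_apply,
    measureReal_ennreal_smul_apply, ENNReal.toReal_ofReal (by linarith), ENNReal.toReal_ofReal h0]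

instance (P : Params) : IsProbabilityMeasure (bern P.p) :=
  isProbabilityMeasure_mix P.p_pos.le P.p_lt_one.le _ _

instance (P : Params) : IsProbabilityMeasure P.priorLaw :=
  isProbabilityMeasure_mix P.p_pos.le P.p_lt_one.le _ _

namespace Params

/-- Marginal law of one pair `(θᵢ, Zᵢ)` of the reduced model. -/
noncomputable def pairLaw (P : Params) (ρ : ℝ) : Measure (Bool × ℝ) :=
  ENNReal.ofReal (1 - P.p) •
      (Measure.dirac false).prod (gaussianReal 0 (Real.toNNReal (P.sigmaSq ρ)))
    + ENNReal.ofReal P.p •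
      (Measure.dirac true).prod (gaussianReal 0 (Real.toNNReal (P.sigmaSq ρ + P.τ ^ 2)))

instance (P : Params) (ρ : ℝ) : IsProbabilityMeasure (P.pairLaw ρ) :=
  isProbabilityMeasure_mix P.p_pos.le P.p_lt_one.le _ _

end Params

lemma map_add_dirac_prod (b : Bool) (v w : NNReal) :
    (((Measure.dirac b).prod (gaussianReal 0 v)).prod (gaussianReal 0 w)).map
        (fun x => (x.1.1, x.1.2 + x.2))
      = (Measure.dirac b).prod (gaussianReal 0 (v + w)) := by
  have h := gaussianReal_conv_gaussianReal (m₁ := 0) (m₂ := 0) (v₁ := v) (v₂ := w)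
  rw [add_zero] at h
  rw [Measure.dirac_prod, Measure.dirac_prod, ← h, Measure.conv]
  conv_lhs => rw [← Measure.map_id (μ := gaussianReal 0 w)]
  rw [Measure.map_prod_map _ _ measurable_prodMk_left measurable_id,
    Measure.map_map (by fun_prop) (by fun_prop), Measure.map_map (by fun_prop) (by fun_prop)]
  rfl

lemma map_priorLaw_prod_noise (P : Params) {ρ : ℝ} (hρ : ρ ≤ 1) :
    (P.priorLaw.prod (gaussianReal 0 (Real.toNNReal (P.σε ^ 2 * (1 - ρ))))).map
      (fun x => (x.1.1, x.1.2 + x.2)) = P.pairLaw ρ := by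
  have h1 : 0 ≤ P.σε ^ 2 * (1 - ρ) := mul_nonneg (sq_nonneg _) (by linarith)
  rw [Params.priorLaw, Measure.add_prod, Measure.prod_smul_left, Measure.prod_smul_left,
    Measure.map_add _ _ (by fun_prop), Measure.map_smul, Measure.map_smul,
    map_add_dirac_prod, map_add_dirac_prod, ← Real.toNNReal_add (sq_nonneg _) h1,
    ← Real.toNNReal_add (by positivity) h1, Params.pairLaw, Params.sigmaSq, add_comm (P.σ₀ ^ 2),
    add_comm (P.σ₀ ^ 2 + P.τ ^ 2), ← add_assoc]

lemma reducedLaw_eq_map_pairLaw (P : Params) {ρ : ℝ} (hρ : ρ ≤ 1) (m : ℕ) :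
    P.reducedLaw ρ m = (Measure.pi fun _ : Fin m => P.pairLaw ρ).map
      (fun ω => (fun i => (ω i).1, fun i => (ω i).2)) := by
  rw [Params.reducedLaw, Params.dataLaw,
    ← (measurePreserving_arrowProdEquivProdArrow (Bool × ℝ) ℝ (Fin m) (fun _ => P.priorLaw)
      (fun _ => gaussianReal 0 (Real.toNNReal (P.σε ^ 2 * (1 - ρ))))).map_eq,
    Measure.map_map (by fun_prop) (MeasurableEquiv.measurable _)]
  simp_rw [← map_priorLaw_prod_noise P hρ]
  rw [← Measure.pi_map_pi (fun i => by fun_prop), Measure.map_map (by fun_prop) (by fun_prop)]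
  rfl

/-- Standard deviation of the normalised statistic under the null (`false`) and the alternative
(`true`). -/
noncomputable def scale (u : ℝ) (b : Bool) : ℝ := if b then √(1 + u) else 1

/-- The identity σ²(1 + u) = σ² + τ² lets the Gaussian randomness be separated from the indicator,
which then enters only as a multiplier. -/
lemma map_scale_pair (P : Params) {ρ : ℝ} (hσ : 0 < P.sigmaSq ρ) :
    ((bern P.p).prod (gaussianReal 0 1)).map
      (fun x => (x.1, √(P.sigmaSq ρ) * (scale (P.u ρ) x.1 * x.2))) = P.pairLaw ρ := by
  have hmeas : Measurable fun x : Bool × ℝ =>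
      (x.1, √(P.sigmaSq ρ) * (scale (P.u ρ) x.1 * x.2)) := by
    have : Measurable (scale (P.u ρ)) := measurable_of_countable _
    fun_prop
  have key : ∀ b : Bool, ∀ v : ℝ, (√(P.sigmaSq ρ) * scale (P.u ρ) b) ^ 2 = v →
      ((Measure.dirac b).prod (gaussianReal 0 1)).map
        (fun x => (x.1, √(P.sigmaSq ρ) * (scale (P.u ρ) x.1 * x.2)))
      = (Measure.dirac b).prod (gaussianReal 0 v.toNNReal) := by
    intro b v hv
    have h := gaussianReal_map_const_mul (μ := 0) (v := 1) (√(P.sigmaSq ρ) * scale (P.u ρ) b)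
    have h2 : NNReal.mk ((√(P.sigmaSq ρ) * scale (P.u ρ) b) ^ 2) (sq_nonneg _) * 1
        = v.toNNReal := by
      ext; rw [← hv]; simp [sq_nonneg]
    rw [h2, mul_zero] at h
    rw [Measure.dirac_prod, Measure.dirac_prod, ← h, Measure.map_map hmeas (by fun_prop),
      Measure.map_map (by fun_prop) (by fun_prop)]
    congr 1
    funext x
    simp [mul_assoc]
  rw [bern, Measure.add_prod, Measure.prod_smul_left, Measure.prod_smul_left,
    Measure.map_add _ _ hmeas, Measure.map_smul, Measure.map_smul,
    key false (P.sigmaSq ρ) ?_, key true (P.sigmaSq ρ + P.τ ^ 2) ?_]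
  · rfl
  · have hu : 0 ≤ P.u ρ := div_nonneg (sq_nonneg _) hσ.le
    rw [mul_pow, Real.sq_sqrt hσ.le]
    simp only [scale, if_true]
    rw [Real.sq_sqrt (by linarith), Params.u]
    field_simp
  · simp [scale, Real.sq_sqrt hσ.le]

/-- The indicators and independent standard normal variables driving the reduced model. -/
noncomputable abbrev baseLaw (p : ℝ) (m : ℕ) : Measure ((Fin m → Bool) × (Fin m → ℝ)) :=
  (Measure.pi fun _ : Fin m => bern p).prod (Measure.pi fun _ : Fin m => gaussianReal 0 1)

/-- The normalised statistics `Zᵢ / σ`. -/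
noncomputable def zvec {m : ℕ} (u : ℝ) (ω : (Fin m → Bool) × (Fin m → ℝ)) (i : Fin m) : ℝ :=
  scale u (ω.1 i) * ω.2 i

lemma measurable_scale (u : ℝ) : Measurable (scale u) := measurable_of_countable _

lemma measurable_zvec {m : ℕ} (u : ℝ) : Measurable (zvec (m := m) u) := by
  have := measurable_scale u
  unfold zvec
  fun_prop

lemma reducedLaw_eq_map_base (P : Params) {ρ : ℝ} (hρ : ρ ≤ 1) (hσ : 0 < P.sigmaSq ρ) (m : ℕ) :
    P.reducedLaw ρ m = (baseLaw P.p m).map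
      (fun ω => (ω.1, fun i => √(P.sigmaSq ρ) * zvec (P.u ρ) ω i)) := by
  have h0 := measurable_scale (P.u ρ)
  have h1 := measurable_zvec (m := m) (P.u ρ)
  have hA : Measurable fun ω : Fin m → Bool × ℝ => (fun i => (ω i).1, fun i => (ω i).2) := by
    fun_prop
  have hB : Measurable fun (x : Fin m → Bool × ℝ) (i : Fin m) =>
      ((x i).1, √(P.sigmaSq ρ) * (scale (P.u ρ) (x i).1 * (x i).2)) := by
    fun_prop
  rw [reducedLaw_eq_map_pairLaw P hρ, baseLaw,
    ← (measurePreserving_arrowProdEquivProdArrow Bool ℝ (Fin m) (fun _ => bern P.p)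
      (fun _ => gaussianReal 0 1)).map_eq,
    Measure.map_map (by fun_prop) (MeasurableEquiv.measurable _)]
  simp_rw [← map_scale_pair P hσ]
  rw [← Measure.pi_map_pi (fun i => by fun_prop), Measure.map_map hA hB]
  rfl

/-! ### Gaussian linear combinations. -/

/-- Linear combinations of independent standard normal variables are normal. -/
lemma map_linear_pi_gaussian {m : ℕ} (a : Fin m → ℝ) :
    (Measure.pi fun _ : Fin m => gaussianReal 0 1).map (fun g => ∑ j, a j * g j)
      = gaussianReal 0 (Real.toNNReal (∑ j, a j ^ 2)) := by
  have hmeas : Measurable fun g : Fin m → ℝ => ∑ j, a j * g j := by fun_prop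
  have : IsProbabilityMeasure
      ((Measure.pi fun _ : Fin m => gaussianReal 0 1).map (fun g => ∑ j, a j * g j)) :=
    Measure.isProbabilityMeasure_map hmeas.aemeasurable
  apply Measure.ext_of_charFun
  ext t
  have h := charFun_pi (μ := fun _ : Fin m => gaussianReal 0 1)
    (WithLp.toLp 2 fun j => t * a j)
  rw [charFun_apply, integral_map (by fun_prop) (by fun_prop)] at h
  rw [charFun_apply, integral_map hmeas.aemeasurable (by fun_prop), charFun_gaussianReal]
  have e : ∀ g : Fin m → ℝ, inner ℝ (∑ j, a j * g j) t
      = inner ℝ (WithLp.toLp 2 g) (WithLp.toLp 2 fun j => t * a j) := by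
    intro g
    simp only [PiLp.inner_apply, RCLike.inner_apply, conj_trivial, Finset.mul_sum]
    exact Finset.sum_congr rfl fun j _ => by ring
  simp_rw [e, h, charFun_gaussianReal, ← Complex.exp_sum]
  congr 1
  rw [Real.coe_toNNReal _ (Finset.sum_nonneg fun j _ => sq_nonneg _)]
  push_cast
  simp only [mul_zero, zero_mul, zero_sub, one_mul,
    Finset.sum_neg_distrib, Finset.sum_mul, Finset.sum_div]
  congr 1
  exact Finset.sum_congr rfl fun j _ => by ring

/-- Tail of a linear combination of independent standard normal variables. -/
lemma real_linear_ge {m : ℕ} (a : Fin m → ℝ) {V c : ℝ} (hV : ∑ j, a j ^ 2 ≤ V) (hV0 : 0 < V)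
    (hc : 0 < c) :
    (Measure.pi fun _ : Fin m => gaussianReal 0 1).real {g | c ≤ |∑ j, a j * g j|}
      ≤ pValue (c / √V) := by
  set W := ∑ j, a j ^ 2 with hW
  have hW0 : 0 ≤ W := Finset.sum_nonneg fun j _ => sq_nonneg _
  have hms : MeasurableSet {x : ℝ | c ≤ |x|} := measurableSet_le (by fun_prop) (by fun_prop)
  have h1 : (Measure.pi fun _ : Fin m => gaussianReal 0 1).real {g | c ≤ |∑ j, a j * g j|}
      = (gaussianReal 0 W.toNNReal).real {x | c ≤ |x|} := by
    rw [← map_linear_pi_gaussian a, map_measureReal_apply (by fun_prop) hms]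
    rfl
  have h2 := gaussianReal_map_const_mul (μ := 0) (v := 1) (√W)
  have h3 : NNReal.mk ((√W) ^ 2) (sq_nonneg _) * 1 = W.toNNReal := by
    ext; simp [Real.sq_sqrt hW0, hW0]
  rw [h3, mul_zero] at h2
  rw [h1, ← h2, map_measureReal_apply (by fun_prop) hms, pValue_eq_real]
  refine measureReal_mono fun x hx => ?_
  have hx' : c ≤ |√W * x| := hx
  change |c / √V| ≤ |x|
  rw [abs_mul, abs_of_nonneg (Real.sqrt_nonneg _)] at hx'
  have hsV : 0 < √V := Real.sqrt_pos.mpr hV0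
  rw [abs_of_pos (by positivity), div_le_iff₀ hsV]
  have : √W ≤ √V := Real.sqrt_le_sqrt hV
  nlinarith [abs_nonneg x]

/-! ### Centring and equicorrelated noise. -/

lemma measurable_center {m : ℕ} : Measurable (center (m := m)) := by
  unfold center
  fun_prop

lemma center_add {m : ℕ} (x y : Fin m → ℝ) :
    center (fun i => x i + y i) = fun i => center x i + center y i := by
  funext i
  simp only [center, Finset.sum_add_distrib]
  ring

lemma center_mul {m : ℕ} (c : ℝ) (x : Fin m → ℝ) :
    center (fun i => c * x i) = fun i => c * center x i := by
  funext i
  simp only [center, ← Finset.mul_sum]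
  ring

lemma sum_center {m : ℕ} (x : Fin m → ℝ) : ∑ i, center x i = 0 := by
  rcases Nat.eq_zero_or_pos m with rfl | hm
  · simp
  · have : (m : ℝ) ≠ 0 := by positivity
    simp only [center, Finset.sum_sub_distrib, Finset.sum_const, Finset.card_univ,
      Fintype.card_fin, nsmul_eq_mul]
    field_simp
    ring

/-- Centring is an orthogonal projection, hence self-adjoint. This moves it from the data to the
coefficients of a linear form or to the argument of a characteristic function. -/
lemma sum_center_mul {m : ℕ} (x t : Fin m → ℝ) :
    ∑ i, center x i * t i = ∑ i, x i * center t i := by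
  simp only [center, sub_mul, mul_sub, Finset.sum_sub_distrib, ← Finset.mul_sum, ← Finset.sum_mul]
  ring

lemma noiseCov_eq (P : Params) (ρ : ℝ) (m : ℕ) :
    P.noiseCov ρ m = (P.σε ^ 2 * (1 - ρ)) • (1 : Matrix (Fin m) (Fin m) ℝ)
      + (P.σε ^ 2 * ρ) • Matrix.vecMulVec (fun _ => 1) (star fun _ => 1) := by
  ext i j
  by_cases h : i = j
  · subst h; simp [Params.noiseCov, Matrix.vecMulVec]; ring
  · simp [Params.noiseCov, Matrix.vecMulVec, h]

lemma posSemidef_noiseCov (P : Params) {ρ : ℝ} (hρ : ρ ∈ Set.Icc (0 : ℝ) 1) (m : ℕ) :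
    (P.noiseCov ρ m).PosSemidef := by
  rw [noiseCov_eq]
  have h1 : 0 ≤ P.σε ^ 2 * (1 - ρ) := mul_nonneg (sq_nonneg _) (by linarith [hρ.2])
  have h2 : 0 ≤ P.σε ^ 2 * ρ := mul_nonneg (sq_nonneg _) hρ.1
  exact (Matrix.PosSemidef.one.smul h1).add ((Matrix.posSemidef_vecMulVec_self_star _).smul h2)

/-- The common component of the noise contributes a multiple of the all-ones matrix, which
annihilates vectors with zero sum. -/
lemma noiseCov_quadratic (P : Params) (ρ : ℝ) (m : ℕ) (x : Fin m → ℝ) (hx : ∑ i, x i = 0) :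
    x ⬝ᵥ (P.noiseCov ρ m).mulVec x = P.σε ^ 2 * (1 - ρ) * ∑ i, x i ^ 2 := by
  have h : (P.noiseCov ρ m).mulVec x = fun i => P.σε ^ 2 * (1 - ρ) * x i := by
    funext i
    have : ∀ j, P.noiseCov ρ m i j * x j
        = P.σε ^ 2 * ρ * x j + (if i = j then P.σε ^ 2 * (1 - ρ) * x j else 0) := by
      intro j
      by_cases h : i = j
      · subst h; simp [Params.noiseCov]; ring
      · simp [Params.noiseCov, h]
    simp only [Matrix.mulVec, dotProduct, this, Finset.sum_add_distrib, ← Finset.mul_sum, hx]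
    simp
  rw [h]
  simp only [dotProduct, Finset.mul_sum]
  exact Finset.sum_congr rfl fun i _ => by ring

/-- The deviations from the mean of equicorrelated noise have the same law as those of
independent noise with variance `σε² (1 - ρ)`. -/
lemma map_center_noise (P : Params) {ρ : ℝ} (hρ : ρ ∈ Set.Icc (0 : ℝ) 1) (m : ℕ) :
    ((multivariateGaussian 0 (P.noiseCov ρ m)).map fun x i => x i).map center
      = (Measure.pi fun _ : Fin m => gaussianReal 0 (Real.toNNReal (P.σε ^ 2 * (1 - ρ)))).map
          center := by
  have h1 : 0 ≤ P.σε ^ 2 * (1 - ρ) := mul_nonneg (sq_nonneg _) (by linarith [hρ.2])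
  set v := Real.toNNReal (P.σε ^ 2 * (1 - ρ)) with hv
  have hc := measurable_center (m := m)
  have hf : Measurable fun (x : EuclideanSpace ℝ (Fin m)) (i : Fin m) => x i := by fun_prop
  have hl : Measurable (WithLp.toLp 2 : (Fin m → ℝ) → EuclideanSpace ℝ (Fin m)) := by fun_prop
  set cE : EuclideanSpace ℝ (Fin m) → EuclideanSpace ℝ (Fin m) :=
    fun x => WithLp.toLp 2 (center fun i => x i) with hcE
  have hcEm : Measurable cE := hl.comp (hc.comp hf)
  have hinner : ∀ x t : EuclideanSpace ℝ (Fin m), inner ℝ (cE x) t = inner ℝ x (cE t) := by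
    intro x t
    simp only [hcE, PiLp.inner_apply, RCLike.inner_apply, conj_trivial]
    simp_rw [mul_comm _ (center _ _)]
    rw [sum_center_mul (fun i => x i) (fun i => t i)]
    exact Finset.sum_congr rfl fun i _ => mul_comm _ _
  -- By self-adjointness only arguments with zero coordinate sum occur, where both noise laws have
  -- the same quadratic form.
  have hchar : ∀ (μ : Measure (EuclideanSpace ℝ (Fin m))) (t : EuclideanSpace ℝ (Fin m)),
      charFun (μ.map cE) t = charFun μ (cE t) := by
    intro μ t
    rw [charFun_apply, charFun_apply, integral_map hcEm.aemeasurable (by fun_prop)]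
    simp_rw [hinner]
  have key : (multivariateGaussian 0 (P.noiseCov ρ m)).map cE
      = ((Measure.pi fun _ : Fin m => gaussianReal 0 v).map (WithLp.toLp 2)).map cE := by
    have : IsProbabilityMeasure ((Measure.pi fun _ : Fin m => gaussianReal 0 v).map
      (WithLp.toLp 2 : (Fin m → ℝ) → EuclideanSpace ℝ (Fin m))) :=
      Measure.isProbabilityMeasure_map hl.aemeasurable
    have := Measure.isProbabilityMeasure_map (μ := (Measure.pi fun _ : Fin m => gaussianReal 0 v).map
      (WithLp.toLp 2 : (Fin m → ℝ) → EuclideanSpace ℝ (Fin m))) hcEm.aemeasurable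
    have := Measure.isProbabilityMeasure_map (μ := multivariateGaussian 0 (P.noiseCov ρ m))
      hcEm.aemeasurable
    apply Measure.ext_of_charFun
    ext t
    rw [hchar, hchar, charFun_multivariateGaussian (posSemidef_noiseCov P hρ m), charFun_pi]
    simp_rw [charFun_gaussianReal, ← Complex.exp_sum]
    have h2 := noiseCov_quadratic P ρ m (center fun i => t i) (sum_center _)
    congr 1
    rw [inner_zero_right]
    have h3 : (cE t).ofLp = center fun i => t i := rfl
    rw [h3, h2, hv, Real.coe_toNNReal _ h1]
    push_cast
    simp only [mul_zero, zero_mul, zero_sub, Finset.sum_neg_distrib, Finset.mul_sum,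
      Finset.sum_div]
  have e1 : (fun (x : EuclideanSpace ℝ (Fin m)) (i : Fin m) => x i) ∘ cE
      = center ∘ fun (x : EuclideanSpace ℝ (Fin m)) (i : Fin m) => x i := rfl
  rw [Measure.map_map hc hf, ← e1, ← Measure.map_map hf hcEm, key, Measure.map_map hcEm hl,
    Measure.map_map hf (hcEm.comp hl)]
  rfl

/-- `(θ, X - X̄)` and `(θ, Z - Z̄)` have the same law. -/
lemma map_center_observedLaw (P : Params) {ρ : ℝ} (hρ : ρ ∈ Set.Icc (0 : ℝ) 1) (m : ℕ) :
    (P.observedLaw ρ m).map (fun ω => (ω.1, center ω.2))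
      = (P.reducedLaw ρ m).map (fun ω => (ω.1, center ω.2)) := by
  have hc := measurable_center (m := m)
  have hf : Measurable fun (x : EuclideanSpace ℝ (Fin m)) (i : Fin m) => x i := by fun_prop
  have key : ∀ noise : Measure (Fin m → ℝ), IsProbabilityMeasure noise →
      (P.dataLaw m noise).map (fun ω => (ω.1, center ω.2))
      = ((Measure.pi fun _ : Fin m => P.priorLaw).prod (noise.map center)).map
          (fun ω => (fun i => (ω.1 i).1, fun i => center (fun i => (ω.1 i).2) i + ω.2 i)) := by
    intro noise _
    rw [Params.dataLaw, Measure.map_map (by fun_prop) (by fun_prop)]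
    conv_rhs => rw [← Measure.map_id (μ := Measure.pi fun _ : Fin m => P.priorLaw)]
    rw [Measure.map_prod_map _ _ measurable_id hc, Measure.map_map (by fun_prop) (by fun_prop)]
    congr 1
    funext ω
    simp only [Function.comp, Prod.map, id, center_add]
  have := Measure.isProbabilityMeasure_map (μ := multivariateGaussian 0 (P.noiseCov ρ m))
      hf.aemeasurable
  rw [Params.observedLaw, Params.reducedLaw, key _ inferInstance, key _ inferInstance,
    map_center_noise P hρ]

/-- The risk of a rule based on the deviations from the mean is the same in the equicorrelated
model and in the reduced model. -/
lemma risk_observed_center (P : Params) {ρ : ℝ} (hρ : ρ ∈ Set.Icc (0 : ℝ) 1) (m : ℕ)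
    (rule : (Fin m → ℝ) → Set (Fin m)) (hrule : ∀ i, MeasurableSet {y | i ∈ rule y}) :
    P.risk (P.observedLaw ρ m) (fun x => rule (center x))
      = P.risk (P.reducedLaw ρ m) (fun x => rule (center x)) := by
  have hc := measurable_center (m := m)
  have hm : Measurable fun ω : (Fin m → Bool) × (Fin m → ℝ) => (ω.1, center ω.2) := by fun_prop
  have key : ∀ s : Set ((Fin m → Bool) × (Fin m → ℝ)), MeasurableSet s →
      (P.observedLaw ρ m).real ((fun ω => (ω.1, center ω.2)) ⁻¹' s)
      = (P.reducedLaw ρ m).real ((fun ω => (ω.1, center ω.2)) ⁻¹' s) := by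
    intro s hs
    rw [← map_measureReal_apply hm hs, ← map_measureReal_apply hm hs, map_center_observedLaw P hρ]
  have hmeas : ∀ (i : Fin m) (b : Bool),
      MeasurableSet {ω : (Fin m → Bool) × (Fin m → ℝ) | ω.1 i = b} := fun i b =>
    (show Measurable fun ω : (Fin m → Bool) × (Fin m → ℝ) => ω.1 i by fun_prop)
      (measurableSet_singleton b)
  unfold Params.risk
  refine Finset.sum_congr rfl fun i _ => ?_
  congr 2
  · exact key _ ((hmeas i false).inter ((hrule i).preimage measurable_snd))
  · exact key _ ((hmeas i true).inter ((hrule i).compl.preimage measurable_snd))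

/-! ### The Bayes rule and its risk. -/

/-- Law of `Zᵢ` under the null (`false`) and the alternative (`true`). -/
noncomputable def groupLaw (P : Params) (ρ : ℝ) (b : Bool) : Measure ℝ :=
  gaussianReal 0 (Real.toNNReal (if b then P.sigmaSq ρ + P.τ ^ 2 else P.sigmaSq ρ))

instance (P : Params) (ρ : ℝ) (b : Bool) : IsProbabilityMeasure (groupLaw P ρ b) := by
  unfold groupLaw; infer_instance

/-- Prior probability of the null (`false`) and the alternative (`true`). -/
noncomputable def groupProb (P : Params) (b : Bool) : ℝ := if b then P.p else 1 - P.p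

lemma groupProb_nonneg (P : Params) (b : Bool) : 0 ≤ groupProb P b := by
  unfold groupProb
  split_ifs
  · exact P.p_pos.le
  · linarith [P.p_lt_one]

lemma real_pairLaw (P : Params) (ρ : ℝ) (b : Bool) (A : Set ℝ) :
    (P.pairLaw ρ).real {y | y.1 = b ∧ y.2 ∈ A} = groupProb P b * (groupLaw P ρ b).real A := by
  have h : ∀ (c : Bool) (μ : Measure ℝ) [IsProbabilityMeasure μ],
      ((Measure.dirac c).prod μ).real {y | y.1 = b ∧ y.2 ∈ A} = if c = b then μ.real A else 0 := by
    intro c μ _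
    have : {y : Bool × ℝ | y.1 = b ∧ y.2 ∈ A} = {b} ×ˢ A := by
      ext y; simp
    rw [this, measureReal_prod_prod]
    by_cases hcb : c = b
    · subst hcb; simp [measureReal_def]
    · simp [measureReal_def, hcb]
  rw [Params.pairLaw, real_mix P.p_pos.le P.p_lt_one.le, h, h]
  cases b <;> simp [groupProb, groupLaw]

lemma measurableSet_coord {m : ℕ} (i : Fin m) (b : Bool) :
    MeasurableSet {ω : (Fin m → Bool) × (Fin m → ℝ) | ω.1 i = b} :=
  (show Measurable fun ω : (Fin m → Bool) × (Fin m → ℝ) => ω.1 i by fun_prop)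
    (measurableSet_singleton b)

/-- Probability of an event about one indicator and the data, by conditioning on the data of the
other coordinates. -/
lemma real_reducedLaw_eq (P : Params) {ρ : ℝ} (hρ : ρ ≤ 1) {m : ℕ} (i : Fin m) (b : Bool)
    {A : Set (Fin m → ℝ)} (hA : MeasurableSet A) :
    Integrable (fun x : Fin m → Bool × ℝ => groupProb P b * (groupLaw P ρ b).real
        {t | Function.update (fun j => (x j).2) i t ∈ A}) (Measure.pi fun _ => P.pairLaw ρ) ∧
    (P.reducedLaw ρ m).real {ω | ω.1 i = b ∧ ω.2 ∈ A}
      = ∫ x : Fin m → Bool × ℝ, groupProb P b * (groupLaw P ρ b).real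
          {t | Function.update (fun j => (x j).2) i t ∈ A} ∂(Measure.pi fun _ => P.pairLaw ρ) := by
  have hm : Measurable fun ω : Fin m → Bool × ℝ => (fun i => (ω i).1, fun i => (ω i).2) := by
    fun_prop
  have hs : MeasurableSet {ω : (Fin m → Bool) × (Fin m → ℝ) | ω.1 i = b ∧ ω.2 ∈ A} :=
    (measurableSet_coord i b).inter (hA.preimage measurable_snd)
  have heq : ∀ x : Fin m → Bool × ℝ, (P.pairLaw ρ).real {y | Function.update x i y ∈
      (fun ω : Fin m → Bool × ℝ => (fun i => (ω i).1, fun i => (ω i).2)) ⁻¹'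
        {ω | ω.1 i = b ∧ ω.2 ∈ A}} = groupProb P b * (groupLaw P ρ b).real
          {t | Function.update (fun j => (x j).2) i t ∈ A} := by
    intro x
    rw [← real_pairLaw P ρ b]
    congr 1
    ext y
    have : (fun j => (Function.update x i y j).2) = Function.update (fun j => (x j).2) i y.2 := by
      funext j
      by_cases h : j = i
      · subst h; simp
      · simp [Function.update_of_ne h]
    simp [this]
  have hpres := measurePreserving_update (fun _ : Fin m => P.pairLaw ρ) i
  constructor
  · have := integrable_real_prodMk (μ := Measure.pi fun _ : Fin m => P.pairLaw ρ)
      (ν := P.pairLaw ρ) (hpres.measurable (hm hs))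
    refine this.congr (ae_of_all _ fun x => ?_)
    exact heq x
  · rw [reducedLaw_eq_map_pairLaw P hρ, map_measureReal_apply hm hs,
      real_pi_eq_integral_update _ i (hm hs)]
    exact integral_congr_ae (ae_of_all _ heq)

/-- The rejection region of the Bayes rule for a single statistic. -/
def bayesRegion (P : Params) (ρ : ℝ) : Set ℝ :=
  {t | ((1 - P.p) * P.δ₀) / (P.p * P.δA) ≤
    gaussianPDFReal 0 (Real.toNNReal (P.sigmaSq ρ + P.τ ^ 2)) t /
      gaussianPDFReal 0 (Real.toNNReal (P.sigmaSq ρ)) t}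

lemma measurableSet_bayesRegion (P : Params) (ρ : ℝ) : MeasurableSet (bayesRegion P ρ) :=
  measurableSet_le measurable_const
    ((measurable_gaussianPDFReal _ _).div (measurable_gaussianPDFReal _ _))

lemma real_gaussian_eq_setIntegral {v : NNReal} (hv : v ≠ 0) (s : Set ℝ) :
    (gaussianReal 0 v).real s = ∫ x in s, gaussianPDFReal 0 v x := by
  rw [measureReal_def, gaussianReal_apply_eq_integral 0 hv, ENNReal.toReal_ofReal]
  exact integral_nonneg fun x => gaussianPDFReal_nonneg _ _ _

/-- The Bayes region minimises the one-coordinate Bayes risk. -/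
lemma bayesRegion_optimal (P : Params) {ρ : ℝ} (hσ : 0 < P.sigmaSq ρ) {A : Set ℝ}
    (hA : MeasurableSet A) :
    P.δ₀ * (groupProb P false * (groupLaw P ρ false).real (bayesRegion P ρ))
      + P.δA * (groupProb P true * (groupLaw P ρ true).real (bayesRegion P ρ)ᶜ)
    ≤ P.δ₀ * (groupProb P false * (groupLaw P ρ false).real A)
      + P.δA * (groupProb P true * (groupLaw P ρ true).real Aᶜ) := by
  have hv0 : Real.toNNReal (P.sigmaSq ρ) ≠ 0 := by simpa using hσ
  have hv1 : Real.toNNReal (P.sigmaSq ρ + P.τ ^ 2) ≠ 0 := by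
    have : 0 < P.sigmaSq ρ + P.τ ^ 2 := by positivity
    simpa using this
  set φ₀ := gaussianPDFReal 0 (Real.toNNReal (P.sigmaSq ρ)) with hφ₀
  set φ₁ := gaussianPDFReal 0 (Real.toNNReal (P.sigmaSq ρ + P.τ ^ 2)) with hφ₁
  -- The risk of a region is a constant plus the integral of h over it, hence minimal on the set
  -- where h ≤ 0.
  set h : ℝ → ℝ := fun x => P.δ₀ * (1 - P.p) * φ₀ x - P.δA * P.p * φ₁ x with hh
  have hi0 : Integrable φ₀ := integrable_gaussianPDFReal _ _
  have hi1 : Integrable φ₁ := integrable_gaussianPDFReal _ _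
  have hinteg : Integrable h := (hi0.const_mul _).sub (hi1.const_mul _)
  have hval : ∀ B : Set ℝ, MeasurableSet B →
      P.δ₀ * (groupProb P false * (groupLaw P ρ false).real B)
      + P.δA * (groupProb P true * (groupLaw P ρ true).real Bᶜ)
      = P.δA * P.p + ∫ x in B, h x := by
    intro B hB
    rw [probReal_compl_eq_one_sub hB]
    simp only [groupProb, groupLaw, if_true, Bool.false_eq_true, if_false]
    rw [real_gaussian_eq_setIntegral hv0, real_gaussian_eq_setIntegral hv1, hh,
      integral_sub (hi0.const_mul _).integrableOn (hi1.const_mul _).integrableOn,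
      integral_const_mul, integral_const_mul]
    ring
  have hregion : bayesRegion P ρ = {x | h x ≤ 0} := by
    ext x
    have hp0 : 0 < φ₀ x := gaussianPDFReal_pos _ _ _ hv0
    have hb : 0 < P.p * P.δA := mul_pos P.p_pos P.δA_pos
    change ((1 - P.p) * P.δ₀) / (P.p * P.δA) ≤ φ₁ x / φ₀ x ↔ h x ≤ 0
    rw [div_le_div_iff₀ hb hp0, hh]
    simp only [sub_nonpos]
    constructor <;> intro hx <;> linarith
  rw [hval _ (measurableSet_bayesRegion P ρ), hval _ hA, hregion]
  refine add_le_add le_rfl ?_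
  have hmeas : StronglyMeasurable h := by
    have h0 := stronglyMeasurable_gaussianPDFReal 0 (Real.toNNReal (P.sigmaSq ρ))
    have h1 := stronglyMeasurable_gaussianPDFReal 0 (Real.toNNReal (P.sigmaSq ρ + P.τ ^ 2))
    exact (h0.const_mul _).sub (h1.const_mul _)
  exact setIntegral_nonpos_le hA hmeas hinteg

/-- The risk of the Bayes rule. -/
lemma optRisk_eq (P : Params) {ρ : ℝ} (hρ : ρ ≤ 1) (m : ℕ) :
    P.optRisk ρ m = m * (P.δ₀ * (groupProb P false * (groupLaw P ρ false).real (bayesRegion P ρ))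
      + P.δA * (groupProb P true * (groupLaw P ρ true).real (bayesRegion P ρ)ᶜ)) := by
  have hset : ∀ i : Fin m, MeasurableSet {y : Fin m → ℝ | i ∈ P.bayesRule ρ m y} := fun i =>
    (measurableSet_bayesRegion P ρ).preimage (measurable_pi_apply i)
  have hu : ∀ (i : Fin m) (x : Fin m → ℝ),
      {t | Function.update x i t ∈ {y : Fin m → ℝ | i ∈ P.bayesRule ρ m y}} = bayesRegion P ρ := by
    intro i x
    ext t
    simp [Params.bayesRule, bayesRegion]
  have hu' : ∀ (i : Fin m) (x : Fin m → ℝ),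
      {t | Function.update x i t ∈ {y : Fin m → ℝ | i ∈ P.bayesRule ρ m y}ᶜ}
        = (bayesRegion P ρ)ᶜ := by
    intro i x
    rw [← hu i x]
    rfl
  have h1 : ∀ i : Fin m, (P.reducedLaw ρ m).real
      {ω | ω.1 i = false ∧ ω.2 ∈ {y : Fin m → ℝ | i ∈ P.bayesRule ρ m y}}
      = groupProb P false * (groupLaw P ρ false).real (bayesRegion P ρ) := by
    intro i
    rw [(real_reducedLaw_eq P hρ i false (hset i)).2]
    simp_rw [hu i]
    simp
  have h2 : ∀ i : Fin m, (P.reducedLaw ρ m).real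
      {ω | ω.1 i = true ∧ ω.2 ∈ {y : Fin m → ℝ | i ∈ P.bayesRule ρ m y}ᶜ}
      = groupProb P true * (groupLaw P ρ true).real (bayesRegion P ρ)ᶜ := by
    intro i
    rw [(real_reducedLaw_eq P hρ i true (hset i).compl).2]
    simp_rw [hu' i]
    simp
  have : P.optRisk ρ m = ∑ i : Fin m, (P.δ₀ * (P.reducedLaw ρ m).real
      {ω | ω.1 i = false ∧ ω.2 ∈ {y : Fin m → ℝ | i ∈ P.bayesRule ρ m y}}
      + P.δA * (P.reducedLaw ρ m).real
      {ω | ω.1 i = true ∧ ω.2 ∈ {y : Fin m → ℝ | i ∈ P.bayesRule ρ m y}ᶜ}) := rfl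
  rw [this]
  simp_rw [h1, h2]
  simp [mul_add]

/-- No rule has smaller risk than the Bayes rule. -/
lemma optRisk_le_risk (P : Params) {ρ : ℝ} (hρ : ρ ≤ 1) (hσ : 0 < P.sigmaSq ρ) (m : ℕ)
    (rule : (Fin m → ℝ) → Set (Fin m)) (hrule : ∀ i, MeasurableSet {y | i ∈ rule y}) :
    P.optRisk ρ m ≤ P.risk (P.reducedLaw ρ m) rule := by
  rw [optRisk_eq P hρ]
  have hsum : ∀ c : ℝ, (m : ℝ) * c = ∑ _i : Fin m, c := fun c => by simp
  rw [hsum, Params.risk]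
  refine Finset.sum_le_sum fun i _ => ?_
  obtain ⟨hi1, he1⟩ := real_reducedLaw_eq P hρ i false (hrule i)
  obtain ⟨hi2, he2⟩ := real_reducedLaw_eq P hρ i true (hrule i).compl
  change _ ≤ P.δ₀ * (P.reducedLaw ρ m).real {ω | ω.1 i = false ∧ ω.2 ∈ {y | i ∈ rule y}}
    + P.δA * (P.reducedLaw ρ m).real {ω | ω.1 i = true ∧ ω.2 ∈ {y | i ∈ rule y}ᶜ}
  rw [he1, he2, ← integral_const_mul, ← integral_const_mul,
    ← integral_add (hi1.const_mul _) (hi2.const_mul _)]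
  have hconst : ∀ c : ℝ, c = ∫ _x : Fin m → Bool × ℝ, c ∂(Measure.pi fun _ => P.pairLaw ρ) :=
    fun c => by simp
  rw [hconst (P.δ₀ * _ + _)]
  refine integral_mono (integrable_const _) ((hi1.const_mul _).add (hi2.const_mul _)) fun x => ?_
  -- With the other coordinates frozen, an arbitrary rule decides about i through a region for the
  -- i-th statistic alone.
  exact bayesRegion_optimal P hσ
    ((show Measurable fun t : ℝ => Function.update (fun j => (x j).2) i t from
      measurable_update _) (hrule i))

/-- Discarding the type I part is asymptotically free: BH will be shown to attain this lower bound
up to a factor tending to one. -/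
lemma le_optRisk (P : Params) {ρ : ℝ} (hρ : ρ ≤ 1) (m : ℕ) :
    m * (P.δA * (P.p * (groupLaw P ρ true).real (bayesRegion P ρ)ᶜ)) ≤ P.optRisk ρ m := by
  rw [optRisk_eq P hρ]
  have : 0 ≤ P.δ₀ * (groupProb P false * (groupLaw P ρ false).real (bayesRegion P ρ)) :=
    mul_nonneg P.δ₀_pos.le (mul_nonneg (groupProb_nonneg P _) measureReal_nonneg)
  have h2 : groupProb P true = P.p := by simp [groupProb]
  rw [h2]
  gcongr
  linarith

/-! ### Error counts in normalised form. -/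

/-- Expected number of false rejections of the Benjamini–Hochberg procedure applied to the
transformed normalised statistics. -/
noncomputable def falseRej {m : ℕ} (p u α : ℝ) (T : (Fin m → ℝ) → (Fin m → ℝ)) : ℝ :=
  ∑ i, (baseLaw p m).real
    {ω | ω.1 i = false ∧ i ∈ benjaminiHochberg α fun j => pValue (T (zvec u ω) j)}

/-- Expected number of false acceptances of the Benjamini–Hochberg procedure applied to the
transformed normalised statistics. -/
noncomputable def falseAcc {m : ℕ} (p u α : ℝ) (T : (Fin m → ℝ) → (Fin m → ℝ)) : ℝ :=
  ∑ i, (baseLaw p m).real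
    {ω | ω.1 i = true ∧ i ∉ benjaminiHochberg α fun j => pValue (T (zvec u ω) j)}

lemma measurableSet_mem_bhRule (P : Params) (ρ : ℝ) {α : ℝ} (hα : 0 ≤ α) {m : ℕ} (i : Fin m) :
    MeasurableSet {y : Fin m → ℝ | i ∈ P.bhRule ρ α y} :=
  measurableSet_mem_benjaminiHochberg hα
    (fun j => measurable_pValue.comp ((measurable_pi_apply j).div_const _)) i

/-- Homogeneity of T cancels σ from the p-values, leaving only p, u and α. The identity and centring
both qualify, so the two parts of the theorem share one analysis. -/
lemma risk_bhRule_eq (P : Params) {ρ : ℝ} (hρ : ρ ≤ 1) (hσ : 0 < P.sigmaSq ρ) {α : ℝ}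
    (hα : 0 ≤ α) (m : ℕ) (T : (Fin m → ℝ) → (Fin m → ℝ)) (hT : Measurable T)
    (hTs : ∀ (c : ℝ) (x : Fin m → ℝ), T (fun i => c * x i) = fun i => c * T x i) :
    P.risk (P.reducedLaw ρ m) (fun y => P.bhRule ρ α (T y))
      = P.δ₀ * falseRej P.p (P.u ρ) α T + P.δA * falseAcc P.p (P.u ρ) α T := by
  have hz := measurable_zvec (m := m) (P.u ρ)
  have hm : Measurable fun ω : (Fin m → Bool) × (Fin m → ℝ) =>
      (ω.1, fun i => √(P.sigmaSq ρ) * zvec (P.u ρ) ω i) := by fun_prop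
  have hs : 0 < √(P.sigmaSq ρ) := Real.sqrt_pos.mpr hσ
  have hrule : ∀ ω : (Fin m → Bool) × (Fin m → ℝ),
      P.bhRule ρ α (T fun i => √(P.sigmaSq ρ) * zvec (P.u ρ) ω i)
        = benjaminiHochberg α fun j => pValue (T (zvec (P.u ρ) ω) j) := by
    intro ω
    rw [Params.bhRule, hTs]
    congr 1
    funext j
    rw [mul_div_cancel_left₀ _ hs.ne']
  have hset : ∀ i : Fin m, MeasurableSet {y : Fin m → ℝ | i ∈ P.bhRule ρ α (T y)} := fun i =>
    (measurableSet_mem_bhRule P ρ hα i).preimage hT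
  have e1 : ∀ i : Fin m, (P.reducedLaw ρ m).real {ω | ω.1 i = false ∧ i ∈ P.bhRule ρ α (T ω.2)}
      = (baseLaw P.p m).real {ω | ω.1 i = false ∧
          i ∈ benjaminiHochberg α fun j => pValue (T (zvec (P.u ρ) ω) j)} := by
    intro i
    have hs : MeasurableSet {ω : (Fin m → Bool) × (Fin m → ℝ) |
        ω.1 i = false ∧ i ∈ P.bhRule ρ α (T ω.2)} :=
      (measurableSet_coord i false).inter ((hset i).preimage measurable_snd)
    rw [reducedLaw_eq_map_base P hρ hσ, map_measureReal_apply hm hs]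
    simp_rw [← hrule]
    rfl
  have e2 : ∀ i : Fin m, (P.reducedLaw ρ m).real {ω | ω.1 i = true ∧ i ∉ P.bhRule ρ α (T ω.2)}
      = (baseLaw P.p m).real {ω | ω.1 i = true ∧
          i ∉ benjaminiHochberg α fun j => pValue (T (zvec (P.u ρ) ω) j)} := by
    intro i
    have hs : MeasurableSet {ω : (Fin m → Bool) × (Fin m → ℝ) |
        ω.1 i = true ∧ i ∉ P.bhRule ρ α (T ω.2)} :=
      (measurableSet_coord i true).inter ((hset i).compl.preimage measurable_snd)
    rw [reducedLaw_eq_map_base P hρ hσ, map_measureReal_apply hm hs]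
    simp_rw [← hrule]
    rfl
  unfold Params.risk falseRej falseAcc
  simp_rw [e1, e2, Finset.mul_sum, Finset.sum_add_distrib]

/-! ### False acceptances. -/

lemma real_bern_true (P : Params) : (bern P.p).real {true} = P.p := by
  rw [bern, real_mix P.p_pos.le P.p_lt_one.le]
  simp [measureReal_def]

lemma integral_bern (P : Params) (f : Bool → ℝ) :
    ∫ b, f b ∂(bern P.p) = (1 - P.p) * f false + P.p * f true := by
  have : ∀ b : Bool, Integrable f (Measure.dirac b) := fun b => .of_finite
  rw [bern, integral_add_measure
    ((this _).smul_measure ENNReal.ofReal_ne_top) ((this _).smul_measure ENNReal.ofReal_ne_top),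
    integral_smul_measure, integral_smul_measure, integral_dirac, integral_dirac,
    ENNReal.toReal_ofReal (by linarith [P.p_lt_one]), ENNReal.toReal_ofReal P.p_pos.le]
  simp

/-- The base space as a product over coordinates. -/
lemma real_baseLaw_eq_pi (P : Params) {m : ℕ} {s : Set ((Fin m → Bool) × (Fin m → ℝ))}
    (hs : MeasurableSet s) :
    (baseLaw P.p m).real s
      = (Measure.pi fun _ : Fin m => (bern P.p).prod (gaussianReal 0 1)).real
          {x | ((fun i => (x i).1), (fun i => (x i).2)) ∈ s} := by
  have h := measurePreserving_arrowProdEquivProdArrow Bool ℝ (Fin m) (fun _ => bern P.p)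
      (fun _ => gaussianReal 0 1)
  rw [baseLaw, ← h.map_eq, map_measureReal_apply h.measurable hs]
  rfl

lemma sum_scale_sq {m : ℕ} {u : ℝ} (hu : 0 ≤ u) (θ : Fin m → Bool) :
    ∑ j, scale u (θ j) ^ 2 = m + (Finset.univ.filter fun j => θ j = true).card * u := by
  have : ∀ j, scale u (θ j) ^ 2 = 1 + if θ j = true then u else 0 := by
    intro j
    unfold scale
    split_ifs
    · rw [Real.sq_sqrt (by linarith)]
    · simp
  simp_rw [this, Finset.sum_add_distrib, ← Finset.sum_filter]
  simp

lemma scale_sq_le {u : ℝ} (hu : 0 ≤ u) (b : Bool) : scale u b ^ 2 ≤ 1 + u := by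
  unfold scale
  split_ifs
  · rw [Real.sq_sqrt (by linarith)]
  · simpa using hu

/-- Tail of the mean of the normalised statistics, given the indicators. -/
lemma real_mean_ge {m : ℕ} (hm : 0 < m) {u c : ℝ} (hu : 0 ≤ u) (hc : 0 < c) (θ : Fin m → Bool) :
    (Measure.pi fun _ : Fin m => gaussianReal 0 1).real
        {g | c ≤ |(∑ j, zvec u (θ, g) j) / m|}
      ≤ 2 * Real.exp (-(c ^ 2 * m / (2 * (1 + u)))) := by
  have hm0 : (0 : ℝ) < m := by exact_mod_cast hm
  have e : ∀ g : Fin m → ℝ, (∑ j, zvec u (θ, g) j) / m = ∑ j, (scale u (θ j) / m) * g j := by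
    intro g
    rw [Finset.sum_div]
    exact Finset.sum_congr rfl fun j _ => by simp only [zvec]; ring
  simp_rw [e]
  have hV : ∑ j, (scale u (θ j) / m) ^ 2 ≤ (1 + u) / m := by
    calc ∑ j, (scale u (θ j) / m) ^ 2 ≤ ∑ _j : Fin m, (1 + u) / (m : ℝ) ^ 2 := by
          refine Finset.sum_le_sum fun j _ => ?_
          rw [div_pow]
          gcongr
          exact scale_sq_le hu _
      _ = (1 + u) / m := by
          simp only [Finset.sum_const, Finset.card_univ, Fintype.card_fin, nsmul_eq_mul]
          field_simp
  have hV0 : 0 < (1 + u) / m := by positivity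
  refine (real_linear_ge _ hV hV0 hc).trans ((pValue_chernoff _).trans ?_)
  rw [div_pow, Real.sq_sqrt hV0.le]
  apply le_of_eq
  congr 2
  field_simp

/-- Given the indicators, the mean is Gaussian with variance at most (1 + u)/m whatever they are, so
the factor p survives. Weakening the exponential by e^(-x) ≤ 1/x leaves a bound that vanishes when u
= o(m). -/
lemma real_coord_true_mean_gt (P : Params) {m : ℕ} (hm : 0 < m) {u : ℝ} (hu : 0 ≤ u) (i : Fin m) :
    (baseLaw P.p m).real {ω | ω.1 i = true ∧ 1 < |(∑ j, zvec u ω j) / m|}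
      ≤ P.p * (4 * (1 + u) / m) := by
  have hz := measurable_zvec (m := m) u
  have hm0 : (0 : ℝ) < m := by exact_mod_cast hm
  have hmean : Measurable fun ω : (Fin m → Bool) × (Fin m → ℝ) => |(∑ j, zvec u ω j) / m| := by
    fun_prop
  have hs : MeasurableSet {ω : (Fin m → Bool) × (Fin m → ℝ) |
      ω.1 i = true ∧ 1 < |(∑ j, zvec u ω j) / m|} :=
    (measurableSet_coord i true).inter (measurableSet_lt measurable_const hmean)
  set g : (Fin m → Bool) → ℝ := fun θ => ({b : Bool | b = true}.indicator
    (fun _ => 4 * (1 + u) / m)) (θ i) with hg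
  have hbound : ∀ θ : Fin m → Bool, (Measure.pi fun _ : Fin m => gaussianReal 0 1).real
      (Prod.mk θ ⁻¹' {ω | ω.1 i = true ∧ 1 < |(∑ j, zvec u ω j) / m|}) ≤ g θ := by
    intro θ
    by_cases hθ : θ i = true
    · have h1 : g θ = 4 * (1 + u) / m := by simp [hg, hθ]
      rw [h1]
      refine le_trans (measureReal_mono (s₂ := {g | 1 ≤ |(∑ j, zvec u (θ, g) j) / m|}) ?_) ?_
      · intro x hx
        exact (hx.2 : 1 < |(∑ j, zvec u (θ, x) j) / m|).le
      · refine (real_mean_ge hm hu one_pos θ).trans ?_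
        set x := (1 : ℝ) ^ 2 * m / (2 * (1 + u)) with hx
        have hx0 : 0 < x := by positivity
        have h2 : Real.exp (-x) ≤ 1 / x := by
          rw [Real.exp_neg, ← one_div]
          exact one_div_le_one_div_of_le hx0 (by linarith [Real.add_one_le_exp x])
        have h3 : 4 * (1 + u) / m = 2 * (1 / x) := by rw [hx]; field_simp; ring
        rw [h3]
        gcongr
    · have : Prod.mk θ ⁻¹' {ω : (Fin m → Bool) × (Fin m → ℝ) |
          ω.1 i = true ∧ 1 < |(∑ j, zvec u ω j) / m|} = ∅ := by
        ext x; simp [hθ]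
      rw [this]
      simp [hg, hθ]
  refine (real_prod_le hs .of_finite hbound).trans (le_of_eq ?_)
  have he := measurePreserving_eval (fun _ : Fin m => bern P.p) i
  rw [hg, ← integral_map (φ := fun θ : Fin m → Bool => θ i) (μ := Measure.pi fun _ => bern P.p)
    (f := {b : Bool | b = true}.indicator (fun _ => 4 * (1 + u) / (m : ℝ)))
    (measurable_pi_apply i).aemeasurable (Measurable.aestronglyMeasurable
      (measurable_of_countable _))]
  have h2 : Measure.map (fun θ : Fin m → Bool => θ i) (Measure.pi fun _ => bern P.p) = bern P.p :=
    he.map_eq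
  rw [h2, integral_bern]
  simp

lemma real_coord_true_small (P : Params) {m : ℕ} {u c : ℝ} (hu : 0 ≤ u) (hc : 0 ≤ c)
    (i : Fin m) :
    (baseLaw P.p m).real {ω | ω.1 i = true ∧ |zvec u ω i| < c}
      = P.p * (1 - pValue (c / √(1 + u))) := by
  have hz := measurable_zvec (m := m) u
  have hs1 : 0 < √(1 + u) := Real.sqrt_pos.mpr (by linarith)
  have habs : Measurable fun ω : (Fin m → Bool) × (Fin m → ℝ) => |zvec u ω i| := by fun_prop
  have hs : MeasurableSet {ω : (Fin m → Bool) × (Fin m → ℝ) | ω.1 i = true ∧ |zvec u ω i| < c} :=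
    (measurableSet_coord i true).inter (measurableSet_lt habs measurable_const)
  have hms : MeasurableSet {x : ℝ | |c / √(1 + u)| ≤ |x|} :=
    measurableSet_le (by fun_prop) (by fun_prop)
  rw [real_baseLaw_eq_pi P hs]
  have hset : {x : Fin m → Bool × ℝ | ((fun i => (x i).1), (fun i => (x i).2)) ∈
      {ω : (Fin m → Bool) × (Fin m → ℝ) | ω.1 i = true ∧ |zvec u ω i| < c}}
      = Function.eval i ⁻¹' ({true} ×ˢ {x : ℝ | |c / √(1 + u)| ≤ |x|}ᶜ) := by
    ext x
    simp only [zvec, Set.mem_ofPred_eq, Set.mem_preimage, Function.eval, Set.mem_prod,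
      Set.mem_singleton_iff, Set.mem_compl_iff, not_le]
    refine and_congr_right fun h => ?_
    rw [h, scale, if_pos rfl, abs_mul, abs_of_pos hs1, abs_of_nonneg (div_nonneg hc hs1.le),
      lt_div_iff₀ hs1, mul_comm]
  have he := measurePreserving_eval (fun _ : Fin m => (bern P.p).prod (gaussianReal 0 1)) i
  rw [hset, he.measureReal_preimage
    ((measurableSet_singleton true).prod hms.compl).nullMeasurableSet, measureReal_prod_prod,
    real_bern_true, probReal_compl_eq_one_sub hms, ← pValue_eq_real]

/-- Indicator that a coordinate is an alternative with a large statistic. -/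
noncomputable def hit (u c : ℝ) (y : Bool × ℝ) : ℝ :=
  ({true} ×ˢ {x : ℝ | |c / √(1 + u)| ≤ |x|} : Set (Bool × ℝ)).indicator (fun _ => 1) y

lemma measurable_hit (u c : ℝ) : Measurable (hit u c) :=
  measurable_const.indicator ((measurableSet_singleton true).prod
    (measurableSet_le (by fun_prop) (by fun_prop)))

lemma hit_mem (u c : ℝ) (y : Bool × ℝ) : 0 ≤ hit u c y ∧ hit u c y ≤ 1 := by
  classical
  rw [hit, Set.indicator_apply]
  split_ifs <;> simp

lemma integral_hit (P : Params) (u c : ℝ) :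
    ∫ y, hit u c y ∂((bern P.p).prod (gaussianReal 0 1)) = P.p * pValue (c / √(1 + u)) := by
  have hms : MeasurableSet {x : ℝ | |c / √(1 + u)| ≤ |x|} :=
    measurableSet_le (by fun_prop) (by fun_prop)
  unfold hit
  rw [integral_indicator_const _ ((measurableSet_singleton true).prod hms),
    measureReal_prod_prod, real_bern_true, ← pValue_eq_real]
  simp

/-- With high probability a positive fraction of the alternatives have large statistics. -/
lemma real_few_hits (P : Params) {m : ℕ} (hm : 2 ≤ m) {u c η : ℝ}
    (hη : η ≤ pValue (c / √(1 + u)) / 4) (hηm : 1 < η * (m * P.p)) (i : Fin m) :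
    (Measure.pi fun _ : Fin m => (bern P.p).prod (gaussianReal 0 1)).real
        {x | ∑ j ∈ Finset.univ.erase i, hit u c (x j) < η * (m * P.p)}
      ≤ 16 * η / pValue (c / √(1 + u)) ^ 2 := by
  set β := pValue (c / √(1 + u)) with hβ
  set M := Measure.pi fun _ : Fin m => (bern P.p).prod (gaussianReal 0 1) with hM
  have hβ0 : 0 < β := pValue_pos _
  have hp := P.p_pos
  have hm2 : (2 : ℝ) ≤ m := by exact_mod_cast hm
  set X : Fin m → (Fin m → Bool × ℝ) → ℝ := fun j x => hit u c (x j) with hX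
  have hmeas : ∀ j, Measurable (X j) := fun j => (measurable_hit u c).comp (measurable_pi_apply j)
  have hmem : ∀ j, MemLp (X j) 2 M := fun j =>
    MemLp.of_bound (hmeas j).aestronglyMeasurable 1 (ae_of_all _ fun x => by
      rw [Real.norm_eq_abs, abs_le]
      have := hit_mem u c (x j)
      constructor <;> simp only [hX] <;> linarith)
  have hinteg : ∀ j, ∫ x, X j x ∂M = P.p * β := by
    intro j
    have he := measurePreserving_eval (fun _ : Fin m => (bern P.p).prod (gaussianReal 0 1)) j
    rw [hβ, ← integral_hit P u c, ← he.map_eq, integral_map he.measurable.aemeasurable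
      (measurable_hit u c).aestronglyMeasurable]
  have hindep : iIndepFun X M := iIndepFun_pi fun _ => (measurable_hit u c).aemeasurable
  have hvar1 : ∀ j, Var[X j; M] ≤ P.p := by
    intro j
    refine (variance_le_expectation_sq (hmeas j).aestronglyMeasurable).trans ?_
    have h1 : ∫ x, (X j ^ 2) x ∂M ≤ ∫ x, X j x ∂M := by
      refine integral_mono (hmem j).integrable_sq ((hmem j).integrable (by norm_num)) fun x => ?_
      have := hit_mem u c (x j)
      simp only [Pi.pow_apply, hX]
      nlinarith
    rw [hinteg] at h1
    refine h1.trans ?_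
    have : β ≤ 1 := pValue_le_one _
    nlinarith
  set S := Finset.univ.erase i with hS
  have hScard : (S.card : ℝ) = m - 1 := by
    rw [hS, Finset.card_erase_of_mem (Finset.mem_univ i), Finset.card_univ, Fintype.card_fin,
      Nat.cast_sub (by omega)]
    simp
  have hvar : Var[∑ j ∈ S, X j; M] ≤ m * P.p := by
    rw [IndepFun.variance_sum (fun j _ => hmem j) (fun a _ b _ hab => hindep.indepFun hab)]
    refine (Finset.sum_le_sum fun j _ => hvar1 j).trans ?_
    rw [Finset.sum_const, nsmul_eq_mul, hScard]
    nlinarith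
  have hmean : ∫ x, (∑ j ∈ S, X j) x ∂M = (m - 1) * (P.p * β) := by
    simp only [Finset.sum_apply]
    rw [integral_finsetSum _ fun j _ => (hmem j).integrable (by norm_num)]
    simp_rw [hinteg]
    rw [Finset.sum_const, nsmul_eq_mul, hScard]
  have hmp : 0 < m * P.p := by positivity
  -- The mean (m - 1) p β is at least m p β / 2 and the count in question is below m p β / 4, so
  -- Chebyshev is used with this deviation.
  have hdev : 0 < m * P.p * β / 4 := by positivity
  have hmemS : MemLp (∑ j ∈ S, X j) 2 M := memLp_finsetSum' S fun j _ => hmem j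
  have hcheb := meas_ge_le_variance_div_sq hmemS hdev
  rw [hmean] at hcheb
  have hsub : {x : Fin m → Bool × ℝ | ∑ j ∈ S, hit u c (x j) < η * (m * P.p)} ⊆
      {ω | m * P.p * β / 4 ≤ |(∑ j ∈ S, X j) ω - (m - 1) * (P.p * β)|} := by
    intro x hx
    have hx' : ∑ j ∈ S, hit u c (x j) < η * (m * P.p) := hx
    change m * P.p * β / 4 ≤ |(∑ j ∈ S, X j) x - (m - 1) * (P.p * β)|
    rw [abs_sub_comm]
    refine le_trans ?_ (le_abs_self _)
    simp only [Finset.sum_apply, hX]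
    have h1 : η * (m * P.p) ≤ β / 4 * (m * P.p) := by gcongr
    have h2 : m / 2 * (P.p * β) ≤ (m - 1) * (P.p * β) := by
      gcongr
      linarith
    linarith
  have h3 : M.real {ω | m * P.p * β / 4 ≤ |(∑ j ∈ S, X j) ω - (m - 1) * (P.p * β)|}
      ≤ Var[∑ j ∈ S, X j; M] / (m * P.p * β / 4) ^ 2 :=
    ENNReal.toReal_le_of_le_ofReal (div_nonneg (variance_nonneg _ _) (sq_nonneg _)) hcheb
  refine (measureReal_mono hsub).trans (h3.trans ?_)
  calc Var[∑ j ∈ S, X j; M] / (m * P.p * β / 4) ^ 2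
      ≤ m * P.p / (m * P.p * β / 4) ^ 2 := by gcongr
    _ = 16 / (m * P.p * β ^ 2) := by field_simp; norm_num
    -- Chebyshev gives order 1/(m p), which is below η because η m p > 1. The bound is thus small
    -- with η even when m p stays bounded.
    _ ≤ 16 * η / β ^ 2 := by
        rw [div_le_div_iff₀ (by positivity) (by positivity)]
        have : 16 * β ^ 2 * 1 ≤ 16 * β ^ 2 * (η * (m * P.p)) := by gcongr
        nlinarith

lemma measurable_sum_hit {m : ℕ} (u c : ℝ) (S : Finset (Fin m)) :
    Measurable fun x : Fin m → Bool × ℝ => ∑ j ∈ S, hit u c (x j) :=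
  Finset.measurable_fun_sum _ fun j _ => (measurable_hit u c).comp (measurable_pi_apply j)

lemma real_coord_true_few_hits (P : Params) {m : ℕ} (u c K : ℝ) (i : Fin m) :
    (Measure.pi fun _ : Fin m => (bern P.p).prod (gaussianReal 0 1)).real
        {x | (x i).1 = true ∧ ∑ j ∈ Finset.univ.erase i, hit u c (x j) < K}
      = P.p * (Measure.pi fun _ : Fin m => (bern P.p).prod (gaussianReal 0 1)).real
        {x | ∑ j ∈ Finset.univ.erase i, hit u c (x j) < K} := by
  have hN : MeasurableSet {x : Fin m → Bool × ℝ | ∑ j ∈ Finset.univ.erase i, hit u c (x j) < K} :=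
    measurableSet_lt (measurable_sum_hit u c _) measurable_const
  have hc : MeasurableSet {x : Fin m → Bool × ℝ | (x i).1 = true} :=
    (show Measurable fun x : Fin m → Bool × ℝ => (x i).1 by fun_prop) (measurableSet_singleton true)
  have hs : MeasurableSet {x : Fin m → Bool × ℝ |
      (x i).1 = true ∧ ∑ j ∈ Finset.univ.erase i, hit u c (x j) < K} := hc.inter hN
  rw [real_pi_eq_integral_update _ i hs]
  have hpt : ∀ x : Fin m → Bool × ℝ, ((bern P.p).prod (gaussianReal 0 1)).real
      {y | Function.update x i y ∈ {x : Fin m → Bool × ℝ |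
        (x i).1 = true ∧ ∑ j ∈ Finset.univ.erase i, hit u c (x j) < K}}
      = {x : Fin m → Bool × ℝ | ∑ j ∈ Finset.univ.erase i, hit u c (x j) < K}.indicator
          (fun _ => P.p) x := by
    intro x
    classical
    have hsum : ∀ y, ∑ j ∈ Finset.univ.erase i, hit u c (Function.update x i y j)
        = ∑ j ∈ Finset.univ.erase i, hit u c (x j) := fun y =>
      Finset.sum_congr rfl fun j hj => by rw [Function.update_of_ne (Finset.ne_of_mem_erase hj)]
    simp only [Set.mem_ofPred_eq, Function.update_self, hsum, Set.indicator_apply]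
    split_ifs with h
    · have : {y : Bool × ℝ | y.1 = true ∧ ∑ j ∈ Finset.univ.erase i, hit u c (x j) < K}
          = {true} ×ˢ Set.univ := by
        ext y
        simp only [Set.mem_ofPred_eq, h, and_true, Set.mem_prod, Set.mem_singleton_iff,
          Set.mem_univ]
      rw [this, measureReal_prod_prod, real_bern_true]
      simp
    · simp only [h, and_false]
      simp
  simp_rw [hpt]
  rw [integral_indicator_const _ hN, smul_eq_mul, mul_comm]

/-- Any k ≥ η m p has a threshold kα/m at least η p α. If η m p ≤ 1 the coordinate i supports k = 1
by itself; otherwise the set S supports k = |S|. This treats bounded and unbounded m p together. -/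
lemma mem_bh_of_hits {m : ℕ} (hm : 0 < m) {α b η p : ℝ} (hα : 0 < α) (hη : 0 < η) (hp : 0 < p)
    (hb : 0 ≤ b) (hbp : pValue b ≤ η * (p * α)) {y : Fin m → ℝ} {i : Fin m} (hi : b ≤ |y i|)
    (S : Finset (Fin m)) (hiS : i ∉ S) (hS : ∀ j ∈ S, b ≤ |y j|)
    (hcard : η * (m * p) ≤ 1 ∨ η * (m * p) ≤ S.card) :
    i ∈ benjaminiHochberg α fun j => pValue (y j) := by
  have hm0 : (0 : ℝ) < m := by exact_mod_cast hm
  have hx : 0 < η * (m * p) := by positivity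
  rw [mem_benjaminiHochberg_iff hα.le]
  have hk : ∀ k : ℕ, η * (m * p) ≤ k → ∀ j, b ≤ |y j| → pValue (y j) ≤ k * α / m := by
    intro k hk j hj
    refine (pValue_anti (by rwa [abs_of_nonneg hb])).trans (hbp.trans ?_)
    rw [le_div_iff₀ hm0]
    calc η * (p * α) * m = η * (m * p) * α := by ring
      _ ≤ k * α := by gcongr
  have hins : ∀ k : ℕ, η * (m * p) ≤ k → k ≤ S.card + 1 → ∃ k : ℕ, pValue (y i) ≤ k * α / m ∧
      k ≤ (Finset.univ.filter fun j => pValue (y j) ≤ k * α / m).card := by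
    intro k hk1 hk2
    refine ⟨k, hk k hk1 i hi, ?_⟩
    rw [← Finset.card_insert_of_notMem hiS] at hk2
    refine hk2.trans (Finset.card_le_card fun j hj => ?_)
    simp only [Finset.mem_filter, Finset.mem_univ, true_and]
    rcases Finset.mem_insert.mp hj with rfl | hj
    · exact hk k hk1 j hi
    · exact hk k hk1 j (hS j hj)
  rcases hcard with h | h
  · exact hins 1 (by simpa using h) (by omega)
  · exact hins (S.card) h (by omega)

/-- Bound for the expected number of false acceptances, valid for any statistics which differ from
the `Zᵢ / σ` by at most the absolute value of their mean. -/
lemma falseAcc_le (P : Params) {m : ℕ} (hm : 2 ≤ m) {u α b η : ℝ} (hu : 0 ≤ u) (hα : 0 < α)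
    (hb : 0 ≤ b) (hη0 : 0 < η) (hη : η ≤ pValue ((b + 1) / √(1 + u)) / 4)
    (hbp : pValue b ≤ η * (P.p * α)) (T : (Fin m → ℝ) → (Fin m → ℝ))
    (hT : ∀ z j, |T z j - z j| ≤ |(∑ l, z l) / m|) :
    falseAcc P.p u α T ≤ m * P.p * (1 - pValue ((b + 1) / √(1 + u))
      + 16 * η / pValue ((b + 1) / √(1 + u)) ^ 2 + 4 * (1 + u) / m) := by
  set β := pValue ((b + 1) / √(1 + u)) with hβ
  have hm1 : 0 < m := by omega
  have hs1 : 0 < √(1 + u) := Real.sqrt_pos.mpr (by linarith)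
  have hc0 : 0 ≤ b + 1 := by linarith
  have key : ∀ i : Fin m, (baseLaw P.p m).real
      {ω | ω.1 i = true ∧ i ∉ benjaminiHochberg α fun j => pValue (T (zvec u ω) j)}
      ≤ P.p * (1 - β) + P.p * (16 * η / β ^ 2) + P.p * (4 * (1 + u) / m) := by
    intro i
    -- An alternative is missed only if its own statistic is small, or too few others are large, or
    -- the mean exceeds one. The margin b + 1 pays for a mean of size at most one; the second event
    -- matters only when η m p > 1.
    set E1 : Set ((Fin m → Bool) × (Fin m → ℝ)) := {ω | ω.1 i = true ∧ |zvec u ω i| < b + 1}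
      with hE1
    set E2 : Set ((Fin m → Bool) × (Fin m → ℝ)) := {ω | (ω.1 i = true ∧
      ∑ j ∈ Finset.univ.erase i, hit u (b + 1) (ω.1 j, ω.2 j) < η * (m * P.p)) ∧
      1 < η * (m * P.p)} with hE2
    set E3 : Set ((Fin m → Bool) × (Fin m → ℝ)) :=
      {ω | ω.1 i = true ∧ 1 < |(∑ j, zvec u ω j) / m|} with hE3
    have hE2m : MeasurableSet E2 := by
      have h1 : Measurable fun ω : (Fin m → Bool) × (Fin m → ℝ) =>
          ∑ j ∈ Finset.univ.erase i, hit u (b + 1) (ω.1 j, ω.2 j) := by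
        have := measurable_hit u (b + 1)
        refine Finset.measurable_fun_sum _ fun j _ => this.comp ?_
        fun_prop
      exact ((measurableSet_coord i true).inter (measurableSet_lt h1 measurable_const)).inter
        (MeasurableSet.const _)
    have hsub : {ω : (Fin m → Bool) × (Fin m → ℝ) | ω.1 i = true ∧
        i ∉ benjaminiHochberg α fun j => pValue (T (zvec u ω) j)} ⊆ E1 ∪ E2 ∪ E3 := by
      rintro ω ⟨hi, hnot⟩
      by_contra hcon
      simp only [Set.mem_union, not_or] at hcon
      obtain ⟨⟨h1, h2⟩, h3⟩ := hcon
      have h1' : b + 1 ≤ |zvec u ω i| := by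
        by_contra! h; exact h1 ⟨hi, h⟩
      have h3' : |(∑ j, zvec u ω j) / m| ≤ 1 := by
        by_contra! h; exact h3 ⟨hi, h⟩
      have hTb : ∀ j, b + 1 ≤ |zvec u ω j| → b ≤ |T (zvec u ω) j| := by
        intro j hj
        have e1 := (hT (zvec u ω) j).trans h3'
        have e2 := abs_sub_abs_le_abs_sub (zvec u ω j) (T (zvec u ω) j)
        rw [abs_sub_comm] at e2
        linarith
      classical
      set S := (Finset.univ.erase i).filter fun j =>
        (ω.1 j, ω.2 j) ∈ ({true} ×ˢ {x : ℝ | |(b + 1) / √(1 + u)| ≤ |x|} : Set (Bool × ℝ)) with hS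
      have hScard : (S.card : ℝ)
          = ∑ j ∈ Finset.univ.erase i, hit u (b + 1) (ω.1 j, ω.2 j) := by
        simp only [hit, Set.indicator_apply]
        rw [hS, Finset.card_filter]
        push_cast
        rfl
      apply hnot
      refine mem_bh_of_hits hm1 hα hη0 P.p_pos hb hbp (hTb i h1') S (by simp [hS]) ?_ ?_
      · intro j hj
        apply hTb
        have hj' := (Finset.mem_filter.mp hj).2
        have ht : ω.1 j = true := hj'.1
        have hx : |(b + 1) / √(1 + u)| ≤ |ω.2 j| := hj'.2
        rw [abs_of_nonneg (by positivity), div_le_iff₀ hs1] at hx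
        rw [zvec, ht, scale, if_pos rfl, abs_mul, abs_of_pos hs1, mul_comm]
        exact hx
      · by_contra! hlt
        refine h2 ⟨⟨hi, ?_⟩, hlt.1⟩
        rw [← hScard]
        exact hlt.2
    have hb2 : (baseLaw P.p m).real E2 ≤ P.p * (16 * η / β ^ 2) := by
      by_cases hx : 1 < η * (m * P.p)
      · rw [real_baseLaw_eq_pi P hE2m]
        have : {x : Fin m → Bool × ℝ | ((fun i => (x i).1), (fun i => (x i).2)) ∈ E2}
            = {x | (x i).1 = true ∧
              ∑ j ∈ Finset.univ.erase i, hit u (b + 1) (x j) < η * (m * P.p)} := by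
          ext x; simp [hE2, hx]
        rw [this, real_coord_true_few_hits]
        exact mul_le_mul_of_nonneg_left (real_few_hits P hm hη hx i) P.p_pos.le
      · have : E2 = ∅ := by ext ω; simp [hE2, hx]
        rw [this]
        have := P.p_pos
        simp only [measureReal_empty]
        positivity
    have hb1 := real_coord_true_small P (m := m) hu hc0 i
    have hb3 := real_coord_true_mean_gt P hm1 hu i
    calc _ ≤ (baseLaw P.p m).real (E1 ∪ E2 ∪ E3) := measureReal_mono hsub
      _ ≤ (baseLaw P.p m).real (E1 ∪ E2) + (baseLaw P.p m).real E3 := measureReal_union_le _ _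
      _ ≤ (baseLaw P.p m).real E1 + (baseLaw P.p m).real E2 + (baseLaw P.p m).real E3 := by
          gcongr
          exact measureReal_union_le _ _
      _ ≤ _ := by
          rw [hb1]
          gcongr
  refine (Finset.sum_le_sum fun i _ => key i).trans (le_of_eq ?_)
  simp only [Finset.sum_const, Finset.card_univ, Fintype.card_fin, nsmul_eq_mul]
  ring

/-! ### False rejections given the indicators. -/

/-- The coordinates at which the null hypothesis holds. -/
def nulls {m : ℕ} (θ : Fin m → Bool) : Finset (Fin m) := Finset.univ.filter fun i => θ i = false

/-- The number of coordinates at which the alternative holds. -/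
def altCount {m : ℕ} (θ : Fin m → Bool) : ℕ := (Finset.univ.filter fun i => θ i = true).card

lemma card_nulls {m : ℕ} (θ : Fin m → Bool) : ((nulls θ).card : ℝ) = m - altCount θ := by
  have h := Finset.card_filter_add_card_filter_not (s := (Finset.univ : Finset (Fin m)))
    (fun i => θ i = true)
  simp only [Bool.not_eq_true, Finset.card_univ, Fintype.card_fin] at h
  have h' : (altCount θ : ℝ) + (nulls θ).card = m := by exact_mod_cast h
  linarith

lemma altCount_le {m : ℕ} (θ : Fin m → Bool) : (altCount θ : ℝ) ≤ m := by
  have := card_nulls θ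
  have h : (0 : ℝ) ≤ (nulls θ).card := Nat.cast_nonneg _
  linarith

lemma altCount_eq_sum {m : ℕ} (θ : Fin m → Bool) :
    (altCount θ : ℝ) = ∑ i, if θ i = true then (1 : ℝ) else 0 := by
  rw [altCount, Finset.card_filter]
  push_cast
  rfl

lemma measurable_zvec_right {m : ℕ} (u : ℝ) (θ : Fin m → Bool) :
    Measurable fun g : Fin m → ℝ => zvec u (θ, g) :=
  (measurable_zvec u).comp measurable_prodMk_left

lemma falseRej_le_integral (P : Params) {m : ℕ} {u α : ℝ} (hα : 0 ≤ α)
    (T : (Fin m → ℝ) → (Fin m → ℝ)) (hT : Measurable T) (h : (Fin m → Bool) → ℝ)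
    (hh : ∀ θ, ∑ i ∈ nulls θ, (Measure.pi fun _ : Fin m => gaussianReal 0 1).real
      {g | i ∈ benjaminiHochberg α fun j => pValue (T (zvec u (θ, g)) j)} ≤ h θ) :
    falseRej P.p u α T ≤ ∫ θ, h θ ∂(Measure.pi fun _ : Fin m => bern P.p) := by
  have hz := measurable_zvec (m := m) u
  have hs : ∀ i : Fin m, MeasurableSet {ω : (Fin m → Bool) × (Fin m → ℝ) |
      ω.1 i = false ∧ i ∈ benjaminiHochberg α fun j => pValue (T (zvec u ω) j)} := fun i =>
    (measurableSet_coord i false).inter (measurableSet_mem_benjaminiHochberg hα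
      (fun j => measurable_pValue.comp ((measurable_pi_apply j).comp (hT.comp hz))) i)
  unfold falseRej
  simp_rw [baseLaw, real_prod_eq_integral (hs _)]
  rw [← integral_finsetSum _ fun i _ => .of_finite]
  refine integral_mono .of_finite .of_finite fun θ => le_trans (le_of_eq ?_) (hh θ)
  rw [nulls, Finset.sum_filter]
  refine Finset.sum_congr rfl fun i _ => ?_
  split_ifs with hi
  · congr 1
    ext g
    simp [hi]
  · have : Prod.mk θ ⁻¹' {ω : (Fin m → Bool) × (Fin m → ℝ) |
        ω.1 i = false ∧ i ∈ benjaminiHochberg α fun j => pValue (T (zvec u ω) j)} = ∅ := by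
      ext g
      simp [hi]
    rw [this]
    simp

lemma integral_altCount (P : Params) (m : ℕ) :
    ∫ θ : Fin m → Bool, (altCount θ : ℝ) ∂(Measure.pi fun _ => bern P.p) = m * P.p := by
  simp_rw [altCount_eq_sum]
  rw [integral_finsetSum _ fun i _ => .of_finite]
  have : ∀ i : Fin m, ∫ θ : Fin m → Bool, (if θ i = true then (1 : ℝ) else 0)
      ∂(Measure.pi fun _ => bern P.p) = P.p := by
    intro i
    have he := measurePreserving_eval (fun _ : Fin m => bern P.p) i
    have h1 := integral_map (μ := Measure.pi fun _ : Fin m => bern P.p)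
      he.measurable.aemeasurable (f := fun b : Bool => if b = true then (1 : ℝ) else 0)
      (Measurable.aestronglyMeasurable (measurable_of_countable _))
    rw [he.map_eq, integral_bern] at h1
    simp only [Function.eval] at h1
    rw [← h1]
    simp
  simp_rw [this]
  simp

/-- By 1 + x ≤ e^x, the binomial exponential moment is dominated by the Poisson one with the same
mean. -/
lemma integral_exp_altCount_le (P : Params) (m : ℕ) (t : ℝ) :
    ∫ θ : Fin m → Bool, Real.exp (t * altCount θ) ∂(Measure.pi fun _ => bern P.p)
      ≤ Real.exp (m * P.p * (Real.exp t - 1)) := by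
  have h1 : ∀ θ : Fin m → Bool, Real.exp (t * altCount θ)
      = ∏ i, (if θ i = true then Real.exp t else 1) := by
    intro θ
    rw [altCount_eq_sum, Finset.mul_sum, Real.exp_sum]
    refine Finset.prod_congr rfl fun i _ => ?_
    split_ifs <;> simp
  simp_rw [h1]
  have h2 := integral_fintype_prod_eq_prod (𝕜 := ℝ) (ι := Fin m) (μ := fun _ => bern P.p)
    (fun _ (b : Bool) => if b = true then Real.exp t else 1)
  rw [h2]
  simp_rw [integral_bern]
  simp only [Bool.false_eq_true, if_false, if_true, mul_one, Finset.prod_const, Finset.card_univ,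
    Fintype.card_fin]
  have h3 : 1 - P.p + P.p * Real.exp t ≤ Real.exp (P.p * (Real.exp t - 1)) := by
    have := Real.add_one_le_exp (P.p * (Real.exp t - 1))
    linarith
  have h4 : 0 ≤ 1 - P.p + P.p * Real.exp t := by
    have := mul_pos P.p_pos (Real.exp_pos t)
    linarith [P.p_lt_one]
  calc (1 - P.p + P.p * Real.exp t) ^ m ≤ Real.exp (P.p * (Real.exp t - 1)) ^ m := by gcongr
    _ = _ := by rw [← Real.exp_nat_mul]; ring_nf

/-- False rejections given the indicators, for the independent statistics. -/
lemma sum_nulls_mem_bh_le {m : ℕ} {u α : ℝ} (hα : α ∈ Set.Ioo (0 : ℝ) 1) (θ : Fin m → Bool) :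
    ∑ i ∈ nulls θ, (Measure.pi fun _ : Fin m => gaussianReal 0 1).real
      {g | i ∈ benjaminiHochberg α fun j => pValue (zvec u (θ, g) j)}
      ≤ odds α * altCount θ + odds α / (1 - α) := by
  have h := sum_real_mem_bh_le (fun _ : Fin m => gaussianReal 0 1) hα (nulls θ)
    (fun j x => pValue (scale u (θ j) * x))
    (fun j => measurable_pValue.comp (by fun_prop)) (fun j x => pValue_nonneg _) ?_
  · rw [card_nulls, sub_sub_cancel] at h
    exact h
  · intro i hi t ht
    have hi' : θ i = false := (Finset.mem_filter.mp hi).2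
    simp only [hi', scale, Bool.false_eq_true, if_false, one_mul]
    exact gaussian_pValue_le ht

lemma falseRej_id_le (P : Params) {m : ℕ} {u α : ℝ} (hα : α ∈ Set.Ioo (0 : ℝ) 1) :
    falseRej (m := m) P.p u α id ≤ odds α * (m * P.p) + odds α / (1 - α) := by
  refine (falseRej_le_integral P hα.1.le id measurable_id
    (fun θ => odds α * altCount θ + odds α / (1 - α)) fun θ => sum_nulls_mem_bh_le hα θ).trans
      (le_of_eq ?_)
  rw [integral_add .of_finite .of_finite, integral_const_mul, integral_altCount]
  simp

lemma odds_nonneg {α : ℝ} (hα : α ∈ Set.Ioo (0 : ℝ) 1) : 0 ≤ odds α :=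
  div_nonneg hα.1.le (by linarith [hα.2])

/-! ### Centring when the sample mean is small. -/

/-- False rejections of the procedure based on deviations from the mean, when these deviations are
close to the independent statistics. -/
lemma falseRej_center_le_of_close (P : Params) {m : ℕ} (hm : 0 < m) {u α ε η B : ℝ} (hu : 0 ≤ u)
    (hα : 0 < α) (hε : 0 ≤ ε) (hα' : (1 + ε) * α < 1) (hη : 0 < η) (hB : 0 ≤ B)
    (hBα : (1 + ε) * pValue B ≤ α / m) (hBε : η * (1 + B) * Real.exp (3 / 2 + B * η) ≤ ε) :
    falseRej (m := m) P.p u α center ≤ odds ((1 + ε) * α) * (m * P.p)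
      + odds ((1 + ε) * α) / (1 - (1 + ε) * α)
      + m * (2 * Real.exp (-(η ^ 2 * m / (2 * (1 + u))))) := by
  have hm0 : (0 : ℝ) < m := by exact_mod_cast hm
  have hα1 : (1 + ε) * α ∈ Set.Ioo (0 : ℝ) 1 := ⟨by positivity, hα'⟩
  set E := 2 * Real.exp (-(η ^ 2 * m / (2 * (1 + u)))) with hE
  refine (falseRej_le_integral P hα.le center measurable_center
    (fun θ => odds ((1 + ε) * α) * altCount θ + odds ((1 + ε) * α) / (1 - (1 + ε) * α)
      + m * E) fun θ => ?_).trans (le_of_eq ?_)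
  · set Γ := Measure.pi fun _ : Fin m => gaussianReal 0 1 with hΓ
    have hterm : ∀ i, Γ.real
        {g | i ∈ benjaminiHochberg α fun j => pValue (center (zvec u (θ, g)) j)}
        ≤ Γ.real {g | i ∈ benjaminiHochberg ((1 + ε) * α) fun j => pValue (zvec u (θ, g) j)}
          + E := by
      intro i
      have hsub : {g | i ∈ benjaminiHochberg α fun j => pValue (center (zvec u (θ, g)) j)} ⊆
          {g | i ∈ benjaminiHochberg ((1 + ε) * α) fun j => pValue (zvec u (θ, g) j)} ∪
          {g | η ≤ |(∑ j, zvec u (θ, g) j) / m|} := by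
        intro g hg
        by_cases hclose : η ≤ |(∑ j, zvec u (θ, g) j) / m|
        · exact Or.inr hclose
        · left
          push Not at hclose
          change i ∈ benjaminiHochberg ((1 + ε) * α) fun j => pValue (zvec u (θ, g) j)
          refine benjaminiHochberg_subset hα.le hα1.1.le ?_ (fun j => pValue_pos _) hg
          intro k hk1 _ j hj
          have hk : (1 : ℝ) ≤ k := by exact_mod_cast hk1
          rw [mul_left_comm, mul_div_assoc]
          -- All thresholds are at least α/m, so the single cutoff B chosen for that one serves
          -- every k.
          refine pValue_perturb (y := center (zvec u (θ, g)) j) hη.le ?_ hB ?_ hε hBε hj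
          · rw [center, sub_sub_cancel_left, abs_neg]
            exact hclose.le
          · refine hBα.trans ?_
            gcongr
            nlinarith
      refine (measureReal_mono hsub).trans ((measureReal_union_le _ _).trans ?_)
      gcongr
      exact real_mean_ge hm hu hη θ
    refine (Finset.sum_le_sum fun i _ => hterm i).trans ?_
    rw [Finset.sum_add_distrib, Finset.sum_const, nsmul_eq_mul]
    have h1 := sum_nulls_mem_bh_le (u := u) hα1 θ
    have h2 : ((nulls θ).card : ℝ) * E ≤ m * E := by
      have : ((nulls θ).card : ℝ) ≤ m := by
        rw [card_nulls]
        have : (0 : ℝ) ≤ altCount θ := Nat.cast_nonneg _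
        linarith
      gcongr
    linarith
  · rw [integral_add .of_finite .of_finite, integral_add .of_finite .of_finite,
      integral_const_mul, integral_altCount]
    simp

/-! ### Centring at very small levels: first and second moments. -/

lemma sum_center_zvec_eq {m : ℕ} (u : ℝ) (θ : Fin m → Bool) (g : Fin m → ℝ) (a : Fin m → ℝ) :
    ∑ i, a i * center (zvec u (θ, g)) i = ∑ j, (center a j * scale u (θ j)) * g j := by
  simp_rw [mul_comm (a _)]
  rw [sum_center_mul]
  exact Finset.sum_congr rfl fun j _ => by simp only [zvec]; ring

lemma center_zvec_eq {m : ℕ} (u : ℝ) (θ : Fin m → Bool) (g : Fin m → ℝ) (i : Fin m) :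
    center (zvec u (θ, g)) i = ∑ j, (center (Pi.single i 1) j * scale u (θ j)) * g j := by
  rw [← sum_center_zvec_eq]
  simp [Pi.single_apply]

/-- Variance of a combination of deviations from the mean over null coordinates. -/
lemma sum_center_scale_sq {m : ℕ} {u : ℝ} (hu : 0 ≤ u) (θ : Fin m → Bool) (hm : 0 < m)
    (a : Fin m → ℝ) (ha : ∀ j, θ j = true → a j = 0) :
    ∑ j, (center a j * scale u (θ j)) ^ 2
      ≤ ∑ j, a j ^ 2 + ((∑ j, a j) / m) ^ 2 * (altCount θ * u) := by
  have hm0 : (0 : ℝ) < m := by exact_mod_cast hm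
  set A := (∑ j, a j) / m with hA
  have hsum : ∑ j, a j = m * A := by rw [hA]; field_simp
  -- Where the scale differs from one the coefficient vanishes, so the scale only multiplies the
  -- squared mean of the coefficients.
  have hterm : ∀ j, (center a j * scale u (θ j)) ^ 2
      = a j ^ 2 - 2 * A * a j + A ^ 2 * scale u (θ j) ^ 2 := by
    intro j
    rw [center, ← hA]
    by_cases h : θ j = true
    · rw [ha j h]; ring
    · have h' : scale u (θ j) = 1 := by simp [scale, h]
      rw [h']; ring
  simp_rw [hterm, Finset.sum_add_distrib, Finset.sum_sub_distrib, ← Finset.mul_sum]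
  rw [sum_scale_sq hu, hsum]
  change _ ≤ _ + A ^ 2 * ((altCount θ : ℝ) * u)
  have : (Finset.univ.filter fun j => θ j = true).card = altCount θ := rfl
  rw [this]
  nlinarith [sq_nonneg A]

/-- The alternatives reach a centred null statistic only through the mean, so it is Gaussian with
variance at most 1 + m₁u/m², where m₁ is their number. The inflation bound then applies with this
excess. -/
lemma real_center_pValue_le {m : ℕ} (hm : 0 < m) {u A t L : ℝ} (hu : 0 ≤ u) (hA : 1 ≤ A)
    (hAb : ∀ w t L : ℝ, 0 ≤ w → 0 < t → 0 ≤ L → Real.log (2 / t) ≤ L → ∀ c, pValue c ≤ t →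
      pValue (c / √(1 + w)) ≤ A * Real.exp (w * (1 + L)) * t)
    (ht : 0 < t) (hL : 0 ≤ L) (hLt : Real.log (2 / t) ≤ L) (θ : Fin m → Bool) {i : Fin m}
    (hi : θ i = false) :
    (Measure.pi fun _ : Fin m => gaussianReal 0 1).real
        {g | pValue (center (zvec u (θ, g)) i) ≤ t}
      ≤ A * Real.exp (altCount θ * u / m ^ 2 * (1 + L)) * t := by
  have hm0 : (0 : ℝ) < m := by exact_mod_cast hm
  set w := altCount θ * u / (m : ℝ) ^ 2 with hw
  have hw0 : 0 ≤ w := by positivity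
  have hexp : 1 ≤ Real.exp (w * (1 + L)) := Real.one_le_exp (by positivity)
  rcases le_or_gt 1 t with h1 | h1
  · calc _ ≤ (1 : ℝ) := measureReal_le_one
      _ = 1 * 1 * 1 := by norm_num
      _ ≤ A * Real.exp (w * (1 + L)) * t := by gcongr
  · obtain ⟨c, hc, rfl⟩ := exists_pValue_eq ht h1.le
    have hc0 : 0 < c := by
      rcases hc.eq_or_lt with rfl | h
      · rw [pValue_zero] at h1; linarith
      · exact h
    refine le_trans ?_ (hAb w _ L hw0 ht hL hLt c le_rfl)
    simp_rw [pValue_le_iff, abs_of_pos hc0, center_zvec_eq]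
    refine real_linear_ge _ ?_ (by linarith) hc0
    refine (sum_center_scale_sq hu θ hm _ ?_).trans ?_
    · intro j hj
      have : j ≠ i := by rintro rfl; rw [hi] at hj; cases hj
      simp [this]
    · have e1 : ∑ j, (Pi.single i (1 : ℝ) : Fin m → ℝ) j ^ 2 = 1 := by
        simp [Pi.single_apply]
      have e2 : ∑ j, (Pi.single i (1 : ℝ) : Fin m → ℝ) j = 1 := by simp
      rw [e1, e2, hw]
      apply le_of_eq
      field_simp

/-- Two numbers of modulus at least h have a sum or a difference of modulus at least 2h. Both
combinations have variance close to 2, so no joint density is needed, and the exponent of α stays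
above one. -/
lemma real_center_pair_le {m : ℕ} (hm : 0 < m) {u a α : ℝ} (hu : 0 ≤ u) (hum : u / m ≤ 1 / 20)
    (ha : 0 < a) (hab : ∀ y : ℝ, a * Real.exp (-(3 / 5) * y ^ 2) ≤ pValue y) (hα : 0 < α)
    (hαa : α < a) (θ : Fin m → Bool) {i j : Fin m} (hij : i ≠ j) (hi : θ i = false)
    (hj : θ j = false) :
    (Measure.pi fun _ : Fin m => gaussianReal 0 1).real
        {g | pValue (center (zvec u (θ, g)) i) ≤ α ∧ pValue (center (zvec u (θ, g)) j) ≤ α}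
      ≤ 4 * Real.exp (-(3 / 2) * Real.log (a / α)) := by
  have hm0 : (0 : ℝ) < m := by exact_mod_cast hm
  set ℓ := Real.log (a / α) with hℓ
  have hℓ0 : 0 < ℓ := Real.log_pos (by rw [one_lt_div hα]; exact hαa)
  -- A p-value at most α forces (3/5) y² ≥ ℓ by the Gaussian lower bound.
  set h := √(5 / 3 * ℓ) with hh
  have hh0 : 0 < h := Real.sqrt_pos.mpr (by positivity)
  have hhsq : h ^ 2 = 5 / 3 * ℓ := Real.sq_sqrt (by positivity)
  have hlow : ∀ y : ℝ, pValue y ≤ α → h ≤ |y| := by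
    intro y hy
    have h1 := (hab y).trans hy
    have h2 : a / α ≤ Real.exp (3 / 5 * y ^ 2) := by
      rw [div_le_iff₀ hα]
      have h3 : Real.exp (3 / 5 * y ^ 2) * Real.exp (-(3 / 5) * y ^ 2) = 1 := by
        rw [← Real.exp_add]; ring_nf; simp
      have := mul_le_mul_of_nonneg_left h1 (Real.exp_pos (3 / 5 * y ^ 2)).le
      calc a = Real.exp (3 / 5 * y ^ 2) * (a * Real.exp (-(3 / 5) * y ^ 2)) := by
            linear_combination -a * h3
        _ ≤ _ := this
    have h3 : ℓ ≤ 3 / 5 * y ^ 2 := by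
      have := Real.log_le_log (by positivity) h2
      rwa [Real.log_exp] at this
    apply abs_le_of_sq_le_sq' _ (abs_nonneg y) |>.2
    rw [hhsq, sq_abs]
    linarith
  have htail : ∀ b : Fin m → ℝ, (∀ l, θ l = true → b l = 0) → ∑ l, b l ^ 2 = 2 →
      |∑ l, b l| ≤ 2 → (Measure.pi fun _ : Fin m => gaussianReal 0 1).real
        {g | 2 * h ≤ |∑ l, b l * center (zvec u (θ, g)) l|}
      ≤ 2 * Real.exp (-(3 / 2) * ℓ) := by
    intro b hb hb2 hb1
    simp_rw [sum_center_zvec_eq]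
    -- The variance is at most 2 + 4u/m ≤ 2.2, and (2h)²/(2 · 2.2) = (50/33) ℓ exceeds (3/2) ℓ.
    refine (real_linear_ge _ (V := 2.2) ?_ (by norm_num) (by positivity)).trans
      ((pValue_chernoff _).trans ?_)
    · refine (sum_center_scale_sq hu θ hm b hb).trans ?_
      rw [hb2]
      have h1 : ((∑ l, b l) / m) ^ 2 ≤ 4 / (m : ℝ) ^ 2 := by
        rw [div_pow]
        gcongr
        rw [← sq_abs]
        nlinarith [abs_nonneg (∑ l, b l)]
      have h2 : (altCount θ : ℝ) * u ≤ m * u := by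
        exact mul_le_mul_of_nonneg_right (altCount_le θ) hu
      have h3 : ((∑ l, b l) / m) ^ 2 * (altCount θ * u) ≤ 4 / (m : ℝ) ^ 2 * (m * u) := by gcongr
      have h4 : 4 / (m : ℝ) ^ 2 * (m * u) = 4 * (u / m) := by field_simp
      rw [h4] at h3
      norm_num
      linarith
    · rw [div_pow, Real.sq_sqrt (by norm_num), mul_pow, hhsq]
      gcongr
      norm_num
      linarith
  have hsub : {g : Fin m → ℝ | pValue (center (zvec u (θ, g)) i) ≤ α ∧
      pValue (center (zvec u (θ, g)) j) ≤ α} ⊆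
      {g | 2 * h ≤ |∑ l, (Pi.single i 1 + Pi.single j 1 : Fin m → ℝ) l *
        center (zvec u (θ, g)) l|} ∪
      {g | 2 * h ≤ |∑ l, (Pi.single i 1 - Pi.single j 1 : Fin m → ℝ) l *
        center (zvec u (θ, g)) l|} := by
    rintro g ⟨h1, h2⟩
    have e1 := hlow _ h1
    have e2 := hlow _ h2
    have s1 : ∑ l, (Pi.single i 1 + Pi.single j 1 : Fin m → ℝ) l * center (zvec u (θ, g)) l
        = center (zvec u (θ, g)) i + center (zvec u (θ, g)) j := by
      simp [Pi.single_apply, add_mul, Finset.sum_add_distrib]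
    have s2 : ∑ l, (Pi.single i 1 - Pi.single j 1 : Fin m → ℝ) l * center (zvec u (θ, g)) l
        = center (zvec u (θ, g)) i - center (zvec u (θ, g)) j := by
      simp [Pi.single_apply, sub_mul, Finset.sum_sub_distrib]
    change 2 * h ≤ |∑ l, (Pi.single i 1 + Pi.single j 1 : Fin m → ℝ) l *
        center (zvec u (θ, g)) l| ∨ 2 * h ≤ |∑ l, (Pi.single i 1 - Pi.single j 1 : Fin m → ℝ) l *
        center (zvec u (θ, g)) l|
    rw [s1, s2]
    generalize center (zvec u (θ, g)) i = x at *
    generalize center (zvec u (θ, g)) j = y at *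
    by_contra! hcon
    obtain ⟨c1, c2⟩ := hcon
    rw [abs_lt] at c1 c2
    rcases le_abs'.mp e1 with e1 | e1 <;> rcases le_abs'.mp e2 with e2 | e2 <;> linarith
  have hne : ∀ l, θ l = true → l ≠ i ∧ l ≠ j := by
    intro l hl
    constructor
    · rintro rfl; rw [hi] at hl; cases hl
    · rintro rfl; rw [hj] at hl; cases hl
  refine (measureReal_mono hsub).trans ((measureReal_union_le _ _).trans ?_)
  have t1 := htail (Pi.single i 1 + Pi.single j 1) (fun l hl => by
      simp [(hne l hl).1, (hne l hl).2]) (by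
      have : ∀ l, (Pi.single i 1 + Pi.single j 1 : Fin m → ℝ) l ^ 2
          = (Pi.single i 1 + Pi.single j 1 : Fin m → ℝ) l := by
        intro l
        by_cases h1 : l = i <;> by_cases h2 : l = j <;>
          simp_all [Pi.single_apply]
      simp_rw [this]
      simp [Finset.sum_add_distrib]
      norm_num) (by simp [Finset.sum_add_distrib]; norm_num)
  have t2 := htail (Pi.single i 1 - Pi.single j 1) (fun l hl => by
      simp [(hne l hl).1, (hne l hl).2]) (by
      have : ∀ l, (Pi.single i 1 - Pi.single j 1 : Fin m → ℝ) l ^ 2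
          = (Pi.single i 1 + Pi.single j 1 : Fin m → ℝ) l := by
        intro l
        by_cases h1 : l = i <;> by_cases h2 : l = j <;>
          simp_all [Pi.single_apply]
      simp_rw [this]
      simp [Finset.sum_add_distrib]
      norm_num) (by simp [Finset.sum_sub_distrib])
  linarith

open Classical in
lemma integral_card_filter {Ω ι : Type*} [MeasurableSpace Ω] (μ : Measure Ω)
    [IsProbabilityMeasure μ] (S : Finset ι) (A : ι → Set Ω) (hA : ∀ i, MeasurableSet (A i)) :
    Integrable (fun ω => ((S.filter fun i => ω ∈ A i).card : ℝ)) μ ∧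
    ∫ ω, ((S.filter fun i => ω ∈ A i).card : ℝ) ∂μ = ∑ i ∈ S, μ.real (A i) := by
  have e : (fun ω => ((S.filter fun i => ω ∈ A i).card : ℝ))
      = fun ω => ∑ i ∈ S, (A i).indicator (fun _ => (1 : ℝ)) ω := by
    funext ω
    rw [Finset.card_filter]
    push_cast
    simp only [Set.indicator_apply]
  have hi : ∀ i, Integrable ((A i).indicator (fun _ => (1 : ℝ))) μ := fun i =>
    (integrable_const 1).indicator (hA i)
  refine ⟨by rw [e]; exact integrable_finsetSum _ fun i _ => hi i, ?_⟩
  rw [e, integral_finsetSum _ fun i _ => hi i]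
  refine Finset.sum_congr rfl fun i _ => ?_
  rw [integral_indicator_const _ (hA i)]
  simp

open Classical in
lemma sum_real_le_of_pointwise {Ω ι κ : Type*} [MeasurableSpace Ω] (μ : Measure Ω)
    [IsProbabilityMeasure μ] (S : Finset ι) (K : Finset κ) (A B : ι → Set Ω) (D : κ → Set Ω)
    (hA : ∀ i, MeasurableSet (A i)) (hB : ∀ i, MeasurableSet (B i)) (hD : ∀ k, MeasurableSet (D k))
    (c : ℝ) (h : ∀ ω, ((S.filter fun i => ω ∈ A i).card : ℝ)
      ≤ (S.filter fun i => ω ∈ B i).card + c * (K.filter fun k => ω ∈ D k).card) :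
    ∑ i ∈ S, μ.real (A i) ≤ ∑ i ∈ S, μ.real (B i) + c * ∑ k ∈ K, μ.real (D k) := by
  obtain ⟨iA, eA⟩ := integral_card_filter μ S A hA
  obtain ⟨iB, eB⟩ := integral_card_filter μ S B hB
  obtain ⟨iD, eD⟩ := integral_card_filter μ K D hD
  rw [← eA, ← eB, ← eD, ← integral_const_mul, ← integral_add iB (iD.const_mul c)]
  exact integral_mono iA (iB.add (iD.const_mul c)) h

open Classical in
/-- Deterministic bound for the number of false rejections: either there are few rejections, or
many nulls have p-values at most `α`. -/
lemma card_false_rejections_le {m : ℕ} {α x : ℝ} (hα : 0 ≤ α) (hx : 0 < x) (q : Fin m → ℝ)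
    (θ : Fin m → Bool) {k : ℕ} (hk : altCount θ + x ≤ k) :
    (((nulls θ).filter fun i => i ∈ benjaminiHochberg α q).card : ℝ)
      ≤ ((nulls θ).filter fun i => q i ≤ k * α / m).card
        + 1 / x * ((nulls θ).offDiag.filter fun ij => q ij.1 ≤ α ∧ q ij.2 ≤ α).card := by
  set R := (bhFinset α q).card with hR
  set V := ((nulls θ).filter fun i => i ∈ benjaminiHochberg α q).card with hV
  have hRV : R ≤ V + altCount θ := by
    have : bhFinset α q ⊆ ((nulls θ).filter fun i => i ∈ benjaminiHochberg α q) ∪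
        (Finset.univ.filter fun i => θ i = true) := by
      intro i hi
      rw [mem_bhFinset] at hi
      simp only [Finset.mem_union, Finset.mem_filter, nulls, Finset.mem_univ, true_and]
      cases θ i <;> simp [hi]
    exact (Finset.card_le_card this).trans (Finset.card_union_le _ _)
  rcases le_or_gt R k with h | h
  · have h1 : V ≤ ((nulls θ).filter fun i => q i ≤ k * α / m).card := by
      refine Finset.card_le_card fun i hi => ?_
      rw [Finset.mem_filter] at hi ⊢
      refine ⟨hi.1, (le_of_mem_benjaminiHochberg hα hi.2).trans ?_⟩
      have : ((bhFinset α q).card : ℝ) ≤ k := by exact_mod_cast h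
      gcongr
    have h1' : (V : ℝ) ≤ ((nulls θ).filter fun i => q i ≤ k * α / m).card := by exact_mod_cast h1
    have h2 : 0 ≤ 1 / x * (((nulls θ).offDiag.filter fun ij => q ij.1 ≤ α ∧ q ij.2 ≤ α).card : ℝ) :=
      by positivity
    linarith
  · set S' := (nulls θ).filter fun i => q i ≤ α with hS'
    have hVS : V ≤ S'.card := by
      refine Finset.card_le_card fun i hi => ?_
      rw [Finset.mem_filter] at hi ⊢
      refine ⟨hi.1, (le_of_mem_benjaminiHochberg hα hi.2).trans ?_⟩
      have hRm : ((bhFinset α q).card : ℝ) ≤ m := by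
        have := Finset.card_le_univ (bhFinset α q)
        rw [Fintype.card_fin] at this
        exact_mod_cast this
      have hm0 : (0 : ℝ) < m := by
        have : 0 < m := lt_of_le_of_lt (Nat.zero_le _) i.2
        exact_mod_cast this
      rw [div_le_iff₀ hm0, mul_comm]
      gcongr
    have hoff : S'.offDiag ⊆ (nulls θ).offDiag.filter fun ij => q ij.1 ≤ α ∧ q ij.2 ≤ α := by
      intro ij hij
      rw [Finset.mem_offDiag] at hij
      rw [Finset.mem_filter, Finset.mem_offDiag]
      have h1 := Finset.mem_filter.mp hij.1
      have h2 := Finset.mem_filter.mp hij.2.1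
      exact ⟨⟨h1.1, h2.1, hij.2.2⟩, h1.2, h2.2⟩
    have hcard : ((S'.offDiag).card : ℝ) = S'.card * (S'.card - 1) := by
      rw [Finset.offDiag_card, Nat.cast_sub (Nat.le_mul_self _)]
      push_cast; ring
    have h3 : (S'.card : ℝ) * (S'.card - 1)
        ≤ ((nulls θ).offDiag.filter fun ij => q ij.1 ≤ α ∧ q ij.2 ≤ α).card := by
      rw [← hcard]
      exact_mod_cast Finset.card_le_card hoff
    -- More than k rejections, of which at most `altCount θ` are correct, leave V - 1 ≥ x; hence V ≤
    -- V (V - 1)/x, a count of ordered pairs.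
    have hx1 : x + 1 ≤ V := by
      have e1 : (k : ℝ) + 1 ≤ R := by exact_mod_cast h
      have e2 : (R : ℝ) ≤ V + altCount θ := by exact_mod_cast hRV
      linarith
    have hVS' : (V : ℝ) ≤ S'.card := by exact_mod_cast hVS
    have h4 : (V : ℝ) ≤ 1 / x * (S'.card * (S'.card - 1)) := by
      rw [one_div, inv_mul_eq_div, le_div_iff₀ hx]
      nlinarith
    have h5 : 1 / x * ((S'.card : ℝ) * (S'.card - 1)) ≤ 1 / x *
        ((nulls θ).offDiag.filter fun ij => q ij.1 ≤ α ∧ q ij.2 ≤ α).card := by gcongr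
    have h6 : (0 : ℝ) ≤ ((nulls θ).filter fun i => q i ≤ k * α / m).card := Nat.cast_nonneg _
    linarith

/-- False rejections of the procedure based on deviations from the mean for very small levels. -/
lemma falseRej_center_le_of_small_level (P : Params) {m : ℕ} (hm : 0 < m) {u A a α L : ℝ}
    (hu : 0 ≤ u) (hum : u / m ≤ 1 / 20) (hA : 1 ≤ A)
    (hAb : ∀ w t L : ℝ, 0 ≤ w → 0 < t → 0 ≤ L → Real.log (2 / t) ≤ L → ∀ c, pValue c ≤ t →
      pValue (c / √(1 + w)) ≤ A * Real.exp (w * (1 + L)) * t)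
    (ha : 0 < a) (hab : ∀ y : ℝ, a * Real.exp (-(3 / 5) * y ^ 2) ≤ pValue y) (hα : 0 < α)
    (hαa : α < a) (hL : 0 ≤ L) (hLα : Real.log (2 / (P.p * α)) ≤ L)
    (hlam : u * (1 + L) / m ^ 2 ≤ 1) :
    falseRej (m := m) P.p u α center
      ≤ A * α * (m * P.p + 1) * Real.exp (8 + 8 * (P.p * u * (1 + L) / m))
        + 4 * (m / P.p) * Real.exp (-(3 / 2) * Real.log (a / α)) := by
  classical
  have hm0 : (0 : ℝ) < m := by exact_mod_cast hm
  have hp := P.p_pos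
  have hmp : 0 < m * P.p := by positivity
  set Γ := Measure.pi fun _ : Fin m => gaussianReal 0 1 with hΓ
  set lam := u * (1 + L) / (m : ℝ) ^ 2 with hlamdef
  have hlam0 : 0 ≤ lam := by positivity
  -- The exponent per alternative: `lam` from the variance inflation, and 1/(mp + 1) from the bound
  -- k ≤ (mp + 1) exp(m₁/(mp + 1)), with m₁ the number of alternatives.
  set t := lam + 1 / (m * P.p + 1) with ht
  set E := Real.exp (-(3 / 2) * Real.log (a / α)) with hE
  have hbound : ∀ θ : Fin m → Bool, ∑ i ∈ nulls θ, Γ.real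
      {g | i ∈ benjaminiHochberg α fun j => pValue (center (zvec u (θ, g)) j)}
      ≤ A * α * (m * P.p + 1) * Real.exp (t * altCount θ) + 4 * (m / P.p) * E := by
    intro θ
    set k := altCount θ + ⌈m * P.p⌉₊ with hk
    have hk1 : altCount θ + m * P.p ≤ k := by
      rw [hk]; push_cast
      gcongr
      exact Nat.le_ceil _
    have hk2 : (k : ℝ) ≤ altCount θ + (m * P.p + 1) := by
      rw [hk]; push_cast
      gcongr
      exact (Nat.ceil_lt_add_one hmp.le).le
    have hac : (0 : ℝ) ≤ altCount θ := Nat.cast_nonneg _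
    have hk0 : (0 : ℝ) < k := by linarith
    have hc : ∀ i, Measurable fun g : Fin m → ℝ => pValue (center (zvec u (θ, g)) i) := fun i =>
      measurable_pValue.comp ((measurable_pi_apply i).comp
        (measurable_center.comp (measurable_zvec_right u θ)))
    have hmain := sum_real_le_of_pointwise Γ (nulls θ) (nulls θ).offDiag
      (fun i => {g | i ∈ benjaminiHochberg α fun j => pValue (center (zvec u (θ, g)) j)})
      (fun i => {g | pValue (center (zvec u (θ, g)) i) ≤ k * α / m})
      (fun ij => {g | pValue (center (zvec u (θ, g)) ij.1) ≤ α ∧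
        pValue (center (zvec u (θ, g)) ij.2) ≤ α})
      (fun i => measurableSet_mem_benjaminiHochberg hα.le hc i)
      (fun i => measurableSet_le (hc i) measurable_const)
      (fun ij => (measurableSet_le (hc ij.1) measurable_const).inter
        (measurableSet_le (hc ij.2) measurable_const))
      (1 / (m * P.p)) (fun g => by
        have := card_false_rejections_le hα.le hmp
          (fun j => pValue (center (zvec u (θ, g)) j)) θ hk1
        convert! this)
    refine hmain.trans (add_le_add ?_ ?_)
    · have htpos : 0 < k * α / m := by positivity
      have hlog : Real.log (2 / (k * α / m)) ≤ L := by
        refine le_trans (Real.log_le_log (by positivity) ?_) hLα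
        gcongr
        rw [le_div_iff₀ hm0]
        have : m * P.p ≤ k := by linarith
        nlinarith
      have h1 : ∀ i ∈ nulls θ, Γ.real {g | pValue (center (zvec u (θ, g)) i) ≤ k * α / m}
          ≤ A * Real.exp (altCount θ * u / m ^ 2 * (1 + L)) * (k * α / m) := fun i hi =>
        real_center_pValue_le hm hu hA hAb htpos hL hlog θ (Finset.mem_filter.mp hi).2
      refine (Finset.sum_le_sum h1).trans ?_
      rw [Finset.sum_const, nsmul_eq_mul]
      have hn : ((nulls θ).card : ℝ) ≤ m := by rw [card_nulls]; linarith
      have hkexp : (k : ℝ) ≤ (m * P.p + 1) * Real.exp (1 / (m * P.p + 1) * altCount θ) := by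
        have e := Real.add_one_le_exp (1 / (m * P.p + 1) * altCount θ)
        calc (k : ℝ) ≤ altCount θ + (m * P.p + 1) := hk2
          _ = (m * P.p + 1) * (1 / (m * P.p + 1) * altCount θ + 1) := by field_simp
          _ ≤ _ := by gcongr
      calc ((nulls θ).card : ℝ) *
            (A * Real.exp (altCount θ * u / m ^ 2 * (1 + L)) * (k * α / m))
          ≤ m * (A * Real.exp (altCount θ * u / m ^ 2 * (1 + L)) * (k * α / m)) := by gcongr
        _ = A * α * Real.exp (altCount θ * u / m ^ 2 * (1 + L)) * k := by field_simp
        _ ≤ A * α * Real.exp (altCount θ * u / m ^ 2 * (1 + L)) *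
            ((m * P.p + 1) * Real.exp (1 / (m * P.p + 1) * altCount θ)) := by gcongr
        _ = A * α * (m * P.p + 1) * (Real.exp (altCount θ * u / m ^ 2 * (1 + L)) *
            Real.exp (1 / (m * P.p + 1) * altCount θ)) := by ring
        _ = A * α * (m * P.p + 1) * Real.exp (t * altCount θ) := by
            rw [← Real.exp_add, ht, hlamdef]
            congr 2
            ring
    · have h1 : ∀ ij ∈ (nulls θ).offDiag, Γ.real {g | pValue (center (zvec u (θ, g)) ij.1) ≤ α ∧
          pValue (center (zvec u (θ, g)) ij.2) ≤ α} ≤ 4 * E := by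
        intro ij hij
        rw [Finset.mem_offDiag] at hij
        exact real_center_pair_le hm hu hum ha hab hα hαa θ hij.2.2
          (Finset.mem_filter.mp hij.1).2 (Finset.mem_filter.mp hij.2.1).2
      have h2 := Finset.sum_le_sum h1
      rw [Finset.sum_const, nsmul_eq_mul] at h2
      have h3 : ((nulls θ).offDiag.card : ℝ) ≤ m * m := by
        have e1 : (nulls θ).offDiag.card ≤ (nulls θ).card * (nulls θ).card := by
          rw [Finset.offDiag_card]; omega
        have e2 : (nulls θ).card ≤ m := by
          have := Finset.card_le_univ (nulls θ)
          rwa [Fintype.card_fin] at this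
        exact_mod_cast e1.trans (Nat.mul_le_mul e2 e2)
      calc 1 / (m * P.p) * ∑ ij ∈ (nulls θ).offDiag, Γ.real
            {g | pValue (center (zvec u (θ, g)) ij.1) ≤ α ∧
              pValue (center (zvec u (θ, g)) ij.2) ≤ α}
          ≤ 1 / (m * P.p) * (m * m * (4 * E)) := by
            gcongr
            refine h2.trans ?_
            gcongr
        _ = 4 * (m / P.p) * E := by field_simp
  refine (falseRej_le_integral P hα.le center measurable_center _ hbound).trans ?_
  rw [integral_add .of_finite .of_finite, integral_const_mul]
  simp only [integral_const, probReal_univ, one_smul]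
  gcongr ?_ * ?_ + _
  refine (integral_exp_altCount_le P m t).trans ?_
  gcongr
  have h1 : 1 / (m * P.p + 1) ≤ 1 := by rw [div_le_one (by positivity)]; linarith
  have ht0 : 0 ≤ t := by positivity
  have ht2 : t ≤ 2 := by rw [ht]; linarith
  -- Both summands of t are at most one, and e² < 8.
  have hexp : Real.exp t - 1 ≤ 8 * t := by
    have e1 : Real.exp t - 1 ≤ t * Real.exp t := by
      have := Real.add_one_le_exp (-t)
      have e2 : Real.exp (-t) * Real.exp t = 1 := by rw [← Real.exp_add]; simp
      nlinarith [Real.exp_pos t]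
    have e3 : Real.exp t ≤ 8 := by
      have : Real.exp t ≤ Real.exp 2 := Real.exp_le_exp.mpr ht2
      have h1 := Real.exp_one_lt_d9
      have h2 : Real.exp 2 = Real.exp 1 * Real.exp 1 := by rw [← Real.exp_add]; norm_num
      nlinarith [Real.exp_pos 1]
    nlinarith
  calc m * P.p * (Real.exp t - 1) ≤ m * P.p * (8 * t) := by gcongr
    _ = 8 * (m * P.p / (m * P.p + 1)) + 8 * (P.p * u * (1 + L) / m) := by
        rw [ht, hlamdef]; field_simp; ring
    _ ≤ 8 + 8 * (P.p * u * (1 + L) / m) := by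
        have : m * P.p / (m * P.p + 1) ≤ 1 := by rw [div_le_one (by positivity)]; linarith
        linarith

/-! ### Type II error of the Bayes rule. -/

/-- The type II error of the Bayes rule is at least that of the fixed threshold
`√(log v / u)` on the scale of the alternative. -/
lemma le_real_compl_bayesRegion (P : Params) {ρ : ℝ} (hσ : 0 < P.sigmaSq ρ)
    (hv : 1 ≤ P.v ρ) :
    1 - pValue √(Real.log (P.v ρ) / P.u ρ) ≤ (groupLaw P ρ true).real (bayesRegion P ρ)ᶜ := by
  set S := P.sigmaSq ρ with hS
  have hτ := P.τ_pos
  have hu : 0 < P.u ρ := div_pos (by positivity) hσ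
  set u := P.u ρ with hudef
  have hτu : P.τ ^ 2 = S * u := by
    rw [hudef, Params.u, ← hS]; field_simp
  set F := ((1 - P.p) * P.δ₀) / (P.p * P.δA) with hF
  have hF0 : 0 < F := div_pos (mul_pos (by linarith [P.p_lt_one]) P.δ₀_pos)
    (mul_pos P.p_pos P.δA_pos)
  have hvF : P.v ρ = u * F ^ 2 := rfl
  have hlogv : 0 ≤ Real.log (P.v ρ) := Real.log_nonneg hv
  set d := √(Real.log (P.v ρ) / u) with hd
  have hd0 : 0 ≤ d := Real.sqrt_nonneg _
  have hdsq : d ^ 2 = Real.log (P.v ρ) / u := Real.sq_sqrt (by positivity)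
  have hV : 0 < S * (1 + u) := by positivity
  have hgroup : groupLaw P ρ true = (gaussianReal 0 1).map (fun x => √(S * (1 + u)) * x) := by
    have h2 := gaussianReal_map_const_mul (μ := 0) (v := 1) (√(S * (1 + u)))
    have h3 : NNReal.mk ((√(S * (1 + u))) ^ 2) (sq_nonneg _) * 1 = (S + P.τ ^ 2).toNNReal := by
      ext
      rw [hτu]
      simp [Real.sq_sqrt hV.le]
      rw [max_eq_left (by positivity)]
      ring
    rw [h3, mul_zero] at h2
    rw [h2, groupLaw, if_pos rfl]
  have hms : MeasurableSet {x : ℝ | |d| ≤ |x|} := measurableSet_le (by fun_prop) (by fun_prop)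
  rw [hgroup, map_measureReal_apply (by fun_prop) (measurableSet_bayesRegion P ρ).compl,
    pValue_eq_real, ← probReal_compl_eq_one_sub hms]
  refine measureReal_mono fun x hx => ?_
  have hx' : |x| < d := by
    have : ¬ |d| ≤ |x| := hx
    rw [abs_of_nonneg hd0] at this
    exact not_le.mp this
  intro hmem
  have hmem' : F ≤ gaussianPDFReal 0 (Real.toNNReal (S + P.τ ^ 2)) (√(S * (1 + u)) * x) /
      gaussianPDFReal 0 (Real.toNNReal S) (√(S * (1 + u)) * x) := hmem
  have hxsq : x ^ 2 < d ^ 2 := by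
    rw [← sq_abs x]
    exact pow_lt_pow_left₀ hx' (abs_nonneg x) two_ne_zero
  have hSτ : S + P.τ ^ 2 = S * (1 + u) := by rw [hτu]; ring
  simp only [gaussianPDFReal, sub_zero, mul_pow, Real.sq_sqrt hV.le, hSτ,
    Real.coe_toNNReal _ hV.le, Real.coe_toNNReal _ hσ.le] at hmem'
  have e1 : -(S * (1 + u) * x ^ 2) / (2 * (S * (1 + u))) = -x ^ 2 / 2 := by field_simp
  have e2 : -(S * (1 + u) * x ^ 2) / (2 * S) = -((1 + u) * x ^ 2) / 2 := by field_simp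
  rw [e1, e2, mul_div_mul_comm, ← Real.exp_sub] at hmem'
  have e3 : -x ^ 2 / 2 - -((1 + u) * x ^ 2) / 2 = u * x ^ 2 / 2 := by ring
  rw [e3] at hmem'
  have e4 : (√(2 * Real.pi * (S * (1 + u))))⁻¹ / (√(2 * Real.pi * S))⁻¹ = (√(1 + u))⁻¹ := by
    rw [← mul_assoc, Real.sqrt_mul (by positivity : 0 ≤ 2 * Real.pi * S)]
    have : √(2 * Real.pi * S) ≠ 0 := (Real.sqrt_pos.mpr (by positivity)).ne'
    field_simp
  rw [e4] at hmem'
  -- The likelihood ratio is e^(ux²/2)/√(1 + u). Below the threshold d the numerator is under √v =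
  -- √u F, so the ratio is under F √(u/(1 + u)) < F and the Bayes rule accepts.
  have e5 : Real.exp (u * x ^ 2 / 2) < √u * F := by
    have h1 : u * x ^ 2 / 2 < Real.log (P.v ρ) / 2 := by
      have : u * d ^ 2 = Real.log (P.v ρ) := by rw [hdsq]; field_simp
      nlinarith
    have h2 : Real.exp (Real.log (P.v ρ) / 2) = √u * F := by
      rw [← Real.log_sqrt (by linarith), Real.exp_log (Real.sqrt_pos.mpr (by linarith)), hvF,
        Real.sqrt_mul hu.le, Real.sqrt_sq hF0.le]
    rw [← h2]
    exact Real.exp_lt_exp.mpr h1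
  have hs : √u < √(1 + u) := Real.sqrt_lt_sqrt hu.le (by linarith)
  have hs0 : 0 < √(1 + u) := Real.sqrt_pos.mpr (by linarith)
  rw [inv_mul_eq_div, le_div_iff₀ hs0] at hmem'
  nlinarith

/-! ### The asymptotic regime. -/

/-- Consequences of the assumptions of the theorem used in the asymptotic analysis. -/
structure Regime (P : ℕ → Params) (ρ : ℝ) (α : ℕ → ℝ) (C : ℝ) : Prop where
  C_pos : 0 < C
  α_mem : ∀ m, α m ∈ Set.Ioo (0 : ℝ) 1
  p_tendsto : Tendsto (fun m => (P m).p) atTop (𝓝 0)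
  u_tendsto : Tendsto (fun m => (P m).u ρ) atTop atTop
  sigma_pos : ∀ᶠ m in atTop, 0 < (P m).sigmaSq ρ
  v_tendsto : Tendsto (fun m => (P m).v ρ) atTop atTop
  log_v : Tendsto (fun m => Real.log ((P m).v ρ) / (P m).u ρ) atTop (𝓝 C)
  log_pα : Tendsto (fun m => Real.log (1 / ((P m).p * α m)) / (P m).u ρ) atTop (𝓝 (C / 2))
  log_δ : Tendsto (fun m => Real.log ((P m).δ / (P m).p) / (P m).u ρ) atTop (𝓝 (C / 2))
  δ_odds : Tendsto (fun m => (P m).δ * odds (α m)) atTop (𝓝 0)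
  u_div : Tendsto (fun m : ℕ => (P m).u ρ / m) atTop (𝓝 0)
  mp_lower : ∃ c : ℝ, 0 < c ∧ ∀ᶠ m : ℕ in atTop, c ≤ m * (P m).p
  α_upper : ∃ α₁ : ℝ, 0 < α₁ ∧ α₁ < 1 ∧ ∀ᶠ m in atTop, α m ≤ α₁

lemma δ_pos (P : Params) : 0 < P.δ := div_pos P.δ₀_pos P.δA_pos

lemma f_pos (P : Params) : 0 < P.f := div_pos (by linarith [P.p_lt_one]) P.p_pos

lemma v_eq (P : Params) (ρ : ℝ) : P.v ρ = P.u ρ * (P.f * P.δ) ^ 2 := by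
  have := P.p_pos.ne'
  have := P.δA_pos.ne'
  unfold Params.v Params.f Params.δ
  congr 2
  field_simp

/-- Since 1 + s_m is log v divided by 2 log(f/r_α), the condition s_m → 0 transfers the limit of log
v / u to log(f/r_α)/u, and so to log(1/(pα))/u. Exponentiating the last hypothesis gives δ r_α → 0.
As log(δ/p) is comparable to u, its being o(m) means u = o(m). -/
lemma regime_of_framework {ρ : ℝ} {P : ℕ → Params} (hP : AsymptoticFramework P ρ)
    {α : ℕ → ℝ} (hα : ∀ m, α m ∈ Set.Ioo (0 : ℝ) 1)
    {αinf : ℝ} (hαinf : αinf < 1) (hαlim : Tendsto α atTop (𝓝 αinf))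
    {s : EReal} (hs : 0 < s)
    (hmp : Tendsto (fun m : ℕ => (((m : ℝ) * (P m).p : ℝ) : EReal)) atTop (𝓝 s))
    (hlog : (fun m : ℕ => Real.log ((P m).δ / (P m).p)) =o[atTop] fun m : ℕ => (m : ℝ))
    (hs_zero : Tendsto (fun m => sSeq (P m) ρ (α m)) atTop (𝓝 0))
    (hs_log : Tendsto (fun m =>
        2 * sSeq (P m) ρ (α m) * Real.log ((P m).f / odds (α m))
          - Real.log (Real.log ((P m).f / odds (α m)))) atTop atBot) :
    ∃ C, Regime P ρ α C := by
  obtain ⟨C, hC, hratio⟩ := hP.ratio_tendsto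
  refine ⟨C, ?_⟩
  have hu := hP.u_tendsto
  have hu0 : ∀ᶠ m in atTop, 1 ≤ (P m).u ρ := hu.eventually_ge_atTop 1
  have hv1 : ∀ᶠ m in atTop, 1 < (P m).v ρ := hP.v_tendsto.eventually_gt_atTop 1
  have hodds : ∀ m, 0 < odds (α m) := fun m => div_pos (hα m).1 (by linarith [(hα m).2])
  set ℓ : ℕ → ℝ := fun m => Real.log ((P m).f / odds (α m)) with hℓ
  -- `log (f δ √u)` is half of `log v`
  have hhalf : ∀ᶠ m in atTop, Real.log ((P m).f * (P m).δ * √((P m).u ρ))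
      = Real.log ((P m).v ρ) / 2 := by
    filter_upwards [hu0] with m hm
    have h1 : 0 < (P m).f * (P m).δ := mul_pos (f_pos _) (δ_pos _)
    have h2 : 0 < (P m).u ρ := by linarith
    rw [Real.log_mul h1.ne' (Real.sqrt_pos.mpr h2).ne', Real.log_sqrt h2.le, v_eq,
      Real.log_mul h2.ne' (pow_pos h1 2).ne', Real.log_pow]
    push_cast; ring
  have hs1 : Tendsto (fun m => (Real.log ((P m).v ρ) / 2) / ℓ m) atTop (𝓝 1) := by
    have h1 : Tendsto (fun m => sSeq (P m) ρ (α m) + 1) atTop (𝓝 (0 + 1)) := hs_zero.add_const 1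
    rw [zero_add] at h1
    refine h1.congr' ?_
    filter_upwards [hhalf] with m hm
    rw [sSeq, hm, sub_add_cancel]
  have hℓu : Tendsto (fun m => ℓ m / (P m).u ρ) atTop (𝓝 (C / 2)) := by
    have h1 := (hs1.inv₀ one_ne_zero).mul (hratio.div_const 2)
    rw [inv_one, one_mul] at h1
    refine h1.congr' ?_
    filter_upwards [hv1, hu0] with m hm hm'
    have h2 : Real.log ((P m).v ρ) ≠ 0 := (Real.log_pos hm).ne'
    rw [inv_div]
    field_simp
  have hℓtop : Tendsto ℓ atTop atTop := by
    have h1 := hℓu.pos_mul_atTop (by positivity : 0 < C / 2) hu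
    refine h1.congr' ?_
    filter_upwards [hu0] with m hm
    have : (P m).u ρ ≠ 0 := by linarith
    field_simp
  have hinvu : Tendsto (fun m => ((P m).u ρ)⁻¹) atTop (𝓝 0) := tendsto_inv_atTop_zero.comp hu
  have hlog1p : Tendsto (fun m => Real.log (1 - (P m).p)) atTop (𝓝 0) := by
    have h1 : Tendsto (fun m => 1 - (P m).p) atTop (𝓝 (1 - 0)) := hP.p_tendsto.const_sub 1
    rw [sub_zero] at h1
    have := (Real.continuousAt_log one_ne_zero).tendsto.comp h1
    rwa [Real.log_one] at this
  have hlog1α : Tendsto (fun m => Real.log (1 - α m)) atTop (𝓝 (Real.log (1 - αinf))) :=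
    (Real.continuousAt_log (by linarith)).tendsto.comp (hαlim.const_sub 1)
  have hlogf : Tendsto (fun m => Real.log ((P m).f * (P m).δ) / (P m).u ρ) atTop (𝓝 (C / 2)) := by
    have hlu : Tendsto (fun m => Real.log ((P m).u ρ) / (P m).u ρ) atTop (𝓝 0) :=
      Real.isLittleO_log_id_atTop.tendsto_div_nhds_zero.comp hu
    have h1 := (hratio.sub hlu).div_const 2
    rw [sub_zero] at h1
    refine h1.congr' ?_
    filter_upwards [hu0] with m hm
    have h1 : 0 < (P m).f * (P m).δ := mul_pos (f_pos _) (δ_pos _)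
    have h2 : 0 < (P m).u ρ := by linarith
    rw [v_eq, Real.log_mul h2.ne' (pow_pos h1 2).ne', Real.log_pow]
    push_cast
    ring
  have hlogδ : Tendsto (fun m => Real.log ((P m).δ / (P m).p) / (P m).u ρ) atTop (𝓝 (C / 2)) := by
    have h1 := hlogf.sub (hlog1p.mul hinvu)
    rw [mul_zero, sub_zero] at h1
    refine h1.congr fun m => ?_
    have e1 : (P m).f * (P m).δ = (P m).δ / (P m).p * (1 - (P m).p) := by
      rw [Params.f]; ring
    have h0 : 0 < (P m).δ / (P m).p := div_pos (δ_pos _) (P m).p_pos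
    have h2 : 0 < 1 - (P m).p := by linarith [(P m).p_lt_one]
    rw [e1, Real.log_mul h0.ne' h2.ne', ← div_eq_mul_inv]
    ring
  refine ⟨hC, hα, hP.p_tendsto, hu, ?_, hP.v_tendsto, hratio, ?_, hlogδ, ?_, ?_, ?_, ?_⟩
  · filter_upwards [hu0] with m hm
    by_contra! h
    have : (P m).u ρ ≤ 0 := div_nonpos_of_nonneg_of_nonpos (sq_nonneg _) h
    linarith
  · have h1 := (hℓu.sub (hlog1p.mul hinvu)).sub (hlog1α.mul hinvu)
    rw [mul_zero, mul_zero, sub_zero, sub_zero] at h1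
    refine h1.congr fun m => ?_
    have hp := (P m).p_pos
    have hp1 : 0 < 1 - (P m).p := by linarith [(P m).p_lt_one]
    have ha := (hα m).1
    have ha1 : 0 < 1 - α m := by linarith [(hα m).2]
    have e1 : (P m).f / odds (α m) = 1 / ((P m).p * α m) * (1 - (P m).p) * (1 - α m) := by
      rw [Params.f, odds]; field_simp
    simp only [hℓ]
    rw [e1, Real.log_mul (by positivity) ha1.ne', Real.log_mul (by positivity) hp1.ne',
      ← div_eq_mul_inv, ← div_eq_mul_inv]
    ring
  · -- the last hypothesis says that `δ r_α → 0`
    have h1 : Tendsto (fun m => ((P m).δ * odds (α m)) ^ 2 * (P m).u ρ / ℓ m) atTop (𝓝 0) := by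
      have h2 := Real.tendsto_exp_atBot.comp hs_log
      refine h2.congr' ?_
      filter_upwards [hu0, hℓtop.eventually_gt_atTop 0, hhalf] with m hm hℓm hh
      have hu' : 0 < (P m).u ρ := by linarith
      have hfδ : 0 < (P m).f * (P m).δ * √((P m).u ρ) :=
        mul_pos (mul_pos (f_pos _) (δ_pos _)) (Real.sqrt_pos.mpr hu')
      have hfo : 0 < (P m).f / odds (α m) := div_pos (f_pos _) (hodds m)
      have e1 : 2 * sSeq (P m) ρ (α m) * ℓ m
          = 2 * Real.log ((P m).f * (P m).δ * √((P m).u ρ)) - 2 * ℓ m := by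
        rw [sSeq]
        change 2 * (_ / ℓ m - 1) * ℓ m = _
        field_simp
      have e2 : 2 * Real.log ((P m).f * (P m).δ * √((P m).u ρ)) - 2 * ℓ m
          = Real.log (((P m).δ * odds (α m)) ^ 2 * (P m).u ρ) := by
        rw [← mul_sub, ← Real.log_div hfδ.ne' hfo.ne']
        have hf := (f_pos (P m)).ne'
        have ho := (hodds m).ne'
        have e3 : (P m).f * (P m).δ * √((P m).u ρ) / ((P m).f / odds (α m))
            = (P m).δ * odds (α m) * √((P m).u ρ) := by field_simp
        have e4 : ((P m).δ * odds (α m)) ^ 2 * (P m).u ρ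
            = ((P m).δ * odds (α m) * √((P m).u ρ)) ^ 2 := by
          rw [mul_pow _ (√((P m).u ρ)), Real.sq_sqrt hu'.le]
        rw [e3, e4, Real.log_pow]
        push_cast; ring
      have hpos : 0 < ((P m).δ * odds (α m)) ^ 2 * (P m).u ρ :=
        mul_pos (pow_pos (mul_pos (δ_pos _) (hodds m)) 2) hu'
      change Real.exp (2 * sSeq (P m) ρ (α m) * ℓ m - Real.log (ℓ m)) = _
      rw [e1, e2, ← Real.log_div hpos.ne' hℓm.ne', Real.exp_log (div_pos hpos hℓm)]
    -- The factor u/ℓ is removed using the finite limit of ℓ/u.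
    have h2 := h1.mul hℓu
    rw [zero_mul] at h2
    have h3 : Tendsto (fun m => ((P m).δ * odds (α m)) ^ 2) atTop (𝓝 0) := by
      refine h2.congr' ?_
      filter_upwards [hu0, hℓtop.eventually_gt_atTop 0] with m hm hℓm
      have : (P m).u ρ ≠ 0 := by linarith
      field_simp
    have h4 := (Real.continuous_sqrt.tendsto 0).comp h3
    rw [Real.sqrt_zero] at h4
    refine h4.congr fun m => ?_
    exact Real.sqrt_sq (mul_pos (δ_pos _) (hodds m)).le
  · have h1 : Tendsto (fun m : ℕ => Real.log ((P m).δ / (P m).p) / m) atTop (𝓝 0) :=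
      hlog.tendsto_div_nhds_zero
    have h2 := h1.mul (hlogδ.inv₀ (by positivity))
    rw [zero_mul] at h2
    refine h2.congr' ?_
    filter_upwards [hu0, hlogδ.eventually (lt_mem_nhds (by positivity : (0 : ℝ) < C / 2))]
      with m hm hl
    have hu' : 0 < (P m).u ρ := by linarith
    have hne : Real.log ((P m).δ / (P m).p) ≠ 0 := by
      intro h0
      rw [h0, zero_div] at hl
      exact lt_irrefl _ hl
    rw [inv_div]
    field_simp
  · obtain ⟨c, hc0, hcs⟩ := EReal.lt_iff_exists_real_btwn.mp hs
    refine ⟨c, by exact_mod_cast hc0, ?_⟩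
    filter_upwards [hmp.eventually (lt_mem_nhds hcs)] with m hm
    exact (by exact_mod_cast hm : c < m * (P m).p).le
  · have h0 : 0 ≤ αinf := ge_of_tendsto' hαlim fun m => (hα m).1.le
    refine ⟨(αinf + 1) / 2, by linarith, by linarith, ?_⟩
    filter_upwards [hαlim.eventually (gt_mem_nhds (by linarith : αinf < (αinf + 1) / 2))]
      with m hm
    exact hm.le

/-- The final squeeze: both risks, normalised by D = m p δA, are trapped around the limiting type II
error K > 0. -/
lemma tendsto_ratio_one {R O D y : ℕ → ℝ} {K : ℝ} (hK : 0 < K) (hD : ∀ᶠ m in atTop, 0 < D m)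
    (hRO : ∀ᶠ m in atTop, O m ≤ R m) (hy : Tendsto y atTop (𝓝 K))
    (hO : ∀ᶠ m in atTop, D m * y m ≤ O m)
    (hR : ∀ ε, 0 < ε → ∀ᶠ m in atTop, R m ≤ D m * (K + ε)) :
    Tendsto (fun m => R m / O m) atTop (𝓝 1) := by
  have hOpos : ∀ᶠ m in atTop, 0 < O m := by
    filter_upwards [hD, hO, hy.eventually (lt_mem_nhds hK)] with m h1 h2 h3
    exact lt_of_lt_of_le (mul_pos h1 h3) h2
  rw [tendsto_order]
  constructor
  · intro b hb
    filter_upwards [hOpos, hRO] with m h1 h2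
    exact lt_of_lt_of_le hb ((one_le_div h1).mpr h2)
  · intro b hb
    -- Half of the value at which K + ε = b (K - ε).
    set ε := (b - 1) * K / (2 * (b + 1)) with hε
    have hb1 : 0 < b + 1 := by linarith
    have hε0 : 0 < ε := by
      have : 0 < b - 1 := by linarith
      positivity
    have hεb : ε * (b + 1) = (b - 1) * K / 2 := by rw [hε]; field_simp
    filter_upwards [hD, hO, hOpos, hR ε hε0,
      hy.eventually (lt_mem_nhds (show K - ε < K by linarith))] with m h1 h2 h3 h4 h5
    rw [div_lt_iff₀ h3]
    have h6 : K + ε < b * (K - ε) := by nlinarith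
    calc R m ≤ D m * (K + ε) := h4
      _ < D m * (b * (K - ε)) := by gcongr
      _ ≤ D m * (b * y m) := by gcongr
      _ = b * (D m * y m) := by ring
      _ ≤ b * O m := by gcongr

/-! ### Asymptotic optimality from negligible type I error. -/

section

variable {P : ℕ → Params} {ρ : ℝ} {α : ℕ → ℝ} {C : ℝ}

/-- The limiting type II error of the Bayes rule is `1 - pValue √C`. -/
lemma one_sub_pValue_sqrt_pos (h : Regime P ρ α C) : 0 < 1 - pValue √C := by
  have := pValue_strictAnti (a := 0) (b := √C)
    (by rw [abs_zero, abs_of_pos (Real.sqrt_pos.mpr h.C_pos)]; exact Real.sqrt_pos.mpr h.C_pos)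
  rw [pValue_zero] at this
  linarith

/-- The square root is the critical value at which the Chernoff bound guarantees a p-value at most η
p α. Against the scale √(1 + u) only log(1/(pα)) ~ Cu/2 survives; the constants and the margin one
disappear. -/
lemma tendsto_power_threshold (h : Regime P ρ α C) {η : ℝ} (hη : 0 < η) :
    Tendsto (fun m => (√(2 * Real.log (2 / (η * ((P m).p * α m)))) + 1) / √(1 + (P m).u ρ))
      atTop (𝓝 √C) := by
  have hu0 : ∀ᶠ m in atTop, 1 ≤ (P m).u ρ := h.u_tendsto.eventually_ge_atTop 1
  have hinv : Tendsto (fun m => ((P m).u ρ)⁻¹) atTop (𝓝 0) :=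
    tendsto_inv_atTop_zero.comp h.u_tendsto
  have h1 : Tendsto (fun m => 2 * Real.log (2 / (η * ((P m).p * α m))) / (P m).u ρ) atTop
      (𝓝 C) := by
    have h2 := ((hinv.const_mul (Real.log (2 / η))).add h.log_pα).const_mul 2
    have e : 2 * (Real.log (2 / η) * 0 + C / 2) = C := by ring
    rw [e] at h2
    refine h2.congr fun m => ?_
    have hp := (P m).p_pos
    have ha := (h.α_mem m).1
    have e2 : 2 / (η * ((P m).p * α m)) = 2 / η * (1 / ((P m).p * α m)) := by field_simp
    rw [e2, Real.log_mul (by positivity) (by positivity)]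
    ring
  have h2 := (Real.continuous_sqrt.tendsto C).comp h1
  have hsu : Tendsto (fun m => √((P m).u ρ)) atTop atTop :=
    Real.tendsto_sqrt_atTop.comp h.u_tendsto
  have h3 : Tendsto (fun m => √(((P m).u ρ)⁻¹)) atTop (𝓝 0) := by
    have := (Real.continuous_sqrt.tendsto 0).comp hinv
    rwa [Real.sqrt_zero] at this
  have h4 : Tendsto (fun m => √(1 + ((P m).u ρ)⁻¹)) atTop (𝓝 1) := by
    have := (Real.continuous_sqrt.tendsto (1 + 0)).comp (hinv.const_add 1)
    rwa [add_zero, Real.sqrt_one] at this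
  have h5 := (h2.add h3).div h4 one_ne_zero
  rw [add_zero, div_one] at h5
  refine h5.congr' ?_
  filter_upwards [hu0] with m hm
  have hu' : 0 < (P m).u ρ := by linarith
  have hs : 0 < √((P m).u ρ) := Real.sqrt_pos.mpr hu'
  have e1 : √(1 + (P m).u ρ) = √((P m).u ρ) * √(1 + ((P m).u ρ)⁻¹) := by
    rw [← Real.sqrt_mul hu'.le]
    congr 1
    field_simp
    ring
  have hs2 : 0 < √(1 + ((P m).u ρ)⁻¹) := Real.sqrt_pos.mpr (by positivity)
  simp only [Function.comp, Pi.div_apply]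
  rw [Real.sqrt_div' _ hu'.le, Real.sqrt_inv, e1]
  field_simp

lemma eventually_falseAcc_le (h : Regime P ρ α C) (T : ∀ m : ℕ, (Fin m → ℝ) → (Fin m → ℝ))
    (hT : ∀ m z j, |T m z j - z j| ≤ |(∑ l, z l) / m|) {ε : ℝ} (hε : 0 < ε) :
    ∀ᶠ m : ℕ in atTop, falseAcc (P m).p ((P m).u ρ) (α m) (T m)
      ≤ m * (P m).p * (1 - pValue √C + ε) := by
  set β := pValue √C with hβ
  have hβ0 : 0 < β := pValue_pos _
  -- The first bound keeps η strictly below β/4, hence below the corresponding quantity for large m;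
  -- the second makes 16 η/β² at most ε/2.
  set η := min (β / 8) (ε * β ^ 2 / 32) with hη
  have hη0 : 0 < η := lt_min (by positivity) (by positivity)
  have hη1 : η < β / 4 := lt_of_le_of_lt (min_le_left _ _) (by linarith)
  have hthr := (continuous_pValue.tendsto _).comp (tendsto_power_threshold h hη0)
  rw [← hβ] at hthr
  have hinvm : Tendsto (fun m : ℕ => (4 : ℝ) / m) atTop (𝓝 0) :=
    tendsto_const_div_atTop_nhds_zero_nat 4
  have hum : Tendsto (fun m : ℕ => 4 * (1 + (P m).u ρ) / (m : ℝ)) atTop (𝓝 0) := by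
    have := hinvm.add (h.u_div.const_mul 4)
    rw [mul_zero, add_zero] at this
    refine this.congr fun m => ?_
    ring
  have hlim := ((hthr.const_sub 1).add ((tendsto_const_nhds (x := 16 * η)).div
    (hthr.pow 2) (pow_pos hβ0 2).ne')).add hum
  have hlt : 1 - β + 16 * η / β ^ 2 + 0 < 1 - β + ε := by
    have h1 : 16 * η / β ^ 2 ≤ ε / 2 := by
      rw [div_le_iff₀ (by positivity)]
      have := min_le_right (β / 8) (ε * β ^ 2 / 32)
      nlinarith
    linarith
  filter_upwards [hlim.eventually (gt_mem_nhds hlt), hthr.eventually (lt_mem_nhds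
    (show 4 * η < β by linarith)), eventually_ge_atTop 2,
    h.u_tendsto.eventually_ge_atTop 0] with m h1 h2 hm hu
  have hp := (P m).p_pos
  have ha := (h.α_mem m).1
  simp only [Function.comp] at h2
  have hx : 0 < η * ((P m).p * α m) := by positivity
  have hpa : (P m).p * α m ≤ 1 :=
    mul_le_one₀ (P m).p_lt_one.le ha.le (h.α_mem m).2.le
  have hlog : 0 ≤ Real.log (2 / (η * ((P m).p * α m))) := by
    apply Real.log_nonneg
    rw [le_div_iff₀ hx, one_mul]
    have : η ≤ 1 := by
      have := pValue_le_one √C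
      linarith
    nlinarith
  have hb : pValue √(2 * Real.log (2 / (η * ((P m).p * α m)))) ≤ η * ((P m).p * α m) := by
    refine (pValue_chernoff _).trans ?_
    rw [Real.sq_sqrt (by positivity),
      show ∀ x : ℝ, -(2 * x) / 2 = -x by intro x; ring, Real.exp_neg,
      Real.exp_log (by positivity), inv_div]
    apply le_of_eq; ring
  have hm2 : 2 ≤ m := hm
  refine (falseAcc_le (P m) hm2 hu ha (Real.sqrt_nonneg _) hη0 (by linarith) hb (T m)
    (hT m)).trans ?_
  have hmp : (0 : ℝ) ≤ m * (P m).p := by positivity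
  refine mul_le_mul_of_nonneg_left ?_ hmp
  exact le_of_lt h1

/-- If the type I component of the risk is negligible, the Benjamini–Hochberg procedure is
asymptotically optimal. -/
lemma isABOS_of_falseRej (hρ : ρ ≤ 1) (h : Regime P ρ α C)
    (T : ∀ m : ℕ, (Fin m → ℝ) → (Fin m → ℝ)) (hTm : ∀ m, Measurable (T m))
    (hT : ∀ m z j, |T m z j - z j| ≤ |(∑ l, z l) / m|)
    (hTs : ∀ m (c : ℝ) (x : Fin m → ℝ), T m (fun i => c * x i) = fun i => c * T m x i)
    (hrej : ∀ ε, 0 < ε → ∀ᶠ m : ℕ in atTop,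
      (P m).δ * falseRej (P m).p ((P m).u ρ) (α m) (T m) ≤ m * (P m).p * ε) :
    IsABOS P ρ (fun m => (P m).reducedLaw ρ m) (fun m z => (P m).bhRule ρ (α m) (T m z)) := by
  have hK := one_sub_pValue_sqrt_pos h
  refine tendsto_ratio_one (D := fun m : ℕ => m * ((P m).p * (P m).δA))
    (y := fun m => 1 - pValue √(Real.log ((P m).v ρ) / (P m).u ρ)) hK ?_ ?_ ?_ ?_ ?_
  · filter_upwards [eventually_gt_atTop 0] with m hm
    have := (P m).p_pos
    have := (P m).δA_pos
    positivity
  · filter_upwards [h.sigma_pos] with m hσ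
    refine optRisk_le_risk (P m) hρ hσ m _ fun i => ?_
    exact (measurableSet_mem_bhRule (P m) ρ (h.α_mem m).1.le i).preimage (hTm m)
  · have := (continuous_pValue.tendsto _).comp
      ((Real.continuous_sqrt.tendsto C).comp h.log_v)
    exact this.const_sub 1
  · filter_upwards [h.sigma_pos, h.v_tendsto.eventually_ge_atTop 1] with m hσ hv
    refine le_trans ?_ (le_optRisk (P m) hρ m)
    have h1 := le_real_compl_bayesRegion (P m) hσ hv
    have := (P m).p_pos
    have := (P m).δA_pos
    calc (m : ℝ) * ((P m).p * (P m).δA) * (1 - pValue √(Real.log ((P m).v ρ) / (P m).u ρ))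
        ≤ m * ((P m).p * (P m).δA) * (groupLaw (P m) ρ true).real (bayesRegion (P m) ρ)ᶜ := by
          gcongr
      _ = _ := by ring
  · intro ε hε
    filter_upwards [h.sigma_pos, hrej (ε / 2) (by positivity),
      eventually_falseAcc_le h T hT (show 0 < ε / 2 by positivity)] with m hσ h1 h2
    rw [risk_bhRule_eq (P m) hρ hσ (h.α_mem m).1.le m (T m) (hTm m) (hTs m)]
    have hδA := (P m).δA_pos
    have e : (P m).δ₀ = (P m).δA * (P m).δ := by rw [Params.δ]; field_simp
    rw [e]
    have h3 := mul_le_mul_of_nonneg_left (add_le_add h1 h2) hδA.le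
    calc _ = (P m).δA * ((P m).δ * falseRej (P m).p ((P m).u ρ) (α m) (T m)
          + falseAcc (P m).p ((P m).u ρ) (α m) (T m)) := by ring
      _ ≤ _ := h3
      _ = _ := by ring

lemma α_le_odds {a : ℝ} (ha : a ∈ Set.Ioo (0 : ℝ) 1) : a ≤ odds a := by
  rw [odds, le_div_iff₀ (by linarith [ha.2])]
  nlinarith [ha.1]

lemma Regime.tendsto_δα (h : Regime P ρ α C) :
    Tendsto (fun m => (P m).δ * α m) atTop (𝓝 0) := by
  refine squeeze_zero (fun m => mul_nonneg (δ_pos _).le (h.α_mem m).1.le) (fun m => ?_) h.δ_odds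
  exact mul_le_mul_of_nonneg_left (α_le_odds (h.α_mem m)) (δ_pos _).le

/-- Relative to m p, the leave-one-out bound is r_α (1 + 1/((1 - α) m p)). The bracket is bounded
since m p ≥ c and α ≤ α₁ < 1, so δ r_α → 0 suffices. -/
lemma eventually_falseRej_id_le (h : Regime P ρ α C) {ε : ℝ} (hε : 0 < ε) :
    ∀ᶠ m : ℕ in atTop, (P m).δ * falseRej (m := m) (P m).p ((P m).u ρ) (α m) id
      ≤ m * (P m).p * ε := by
  obtain ⟨c, hc, hmp⟩ := h.mp_lower
  obtain ⟨α₁, hα₁0, hα₁, hαle⟩ := h.α_upper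
  have h1α : 0 < 1 - α₁ := by linarith
  set K := 1 + 1 / ((1 - α₁) * c) with hK
  have hlim := h.δ_odds.mul_const K
  rw [zero_mul] at hlim
  filter_upwards [hmp, hαle, hlim.eventually (gt_mem_nhds hε)] with m h1 h2 h3
  have hδ := δ_pos (P m)
  have hod := odds_nonneg (h.α_mem m)
  have hmp0 : 0 < m * (P m).p := by linarith
  have h4 : odds (α m) / (1 - α m) ≤ odds (α m) * (m * (P m).p) * (1 / ((1 - α₁) * c)) := by
    have e1 : odds (α m) / (1 - α m) ≤ odds (α m) / (1 - α₁) := by gcongr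
    refine e1.trans ?_
    rw [mul_one_div, div_le_div_iff₀ h1α (by positivity)]
    have : odds (α m) * (1 - α₁) * c ≤ odds (α m) * (1 - α₁) * (m * (P m).p) := by gcongr
    linarith
  calc (P m).δ * falseRej (m := m) (P m).p ((P m).u ρ) (α m) id
      ≤ (P m).δ * (odds (α m) * (m * (P m).p) + odds (α m) / (1 - α m)) := by
        gcongr
        exact falseRej_id_le (P m) (h.α_mem m)
    _ ≤ (P m).δ * (odds (α m) * (m * (P m).p)
        + odds (α m) * (m * (P m).p) * (1 / ((1 - α₁) * c))) := by gcongr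
    _ = m * (P m).p * ((P m).δ * odds (α m) * K) := by rw [hK]; ring
    _ ≤ m * (P m).p * ε := by gcongr

end

/-! ### Negligible type I error after centring. -/

section

variable {P : ℕ → Params} {ρ : ℝ} {α : ℕ → ℝ} {C : ℝ}

/-- The limiting ratio to u is C/2, so a coefficient C leaves room for any additive constant. It
supplies the logarithmic bound L = Cu in the variance inflation estimate. -/
lemma Regime.eventually_log_pα_le (h : Regime P ρ α C) (b : ℝ) :
    ∀ᶠ m in atTop, b + Real.log (1 / ((P m).p * α m)) ≤ C * (P m).u ρ := by
  have hC := h.C_pos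
  filter_upwards [h.u_tendsto.eventually_gt_atTop 0, h.u_tendsto.eventually_ge_atTop (4 * b / C),
    h.log_pα.eventually (gt_mem_nhds (show C / 2 < 3 * C / 4 by linarith))] with m h0 h1 h2
  rw [div_lt_iff₀ h0] at h2
  rw [div_le_iff₀ hC] at h1
  linarith

/-- When the level is polynomially small in `p`, centring costs only a constant factor. -/
lemma eventually_falseRej_center_le_of_small_level (h : Regime P ρ α C)
    (hpu : (fun m : ℕ => (P m).p * (P m).u ρ ^ 2) =o[atTop] (fun m : ℕ => (m : ℝ)))
    {ε : ℝ} (hε : 0 < ε) :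
    ∀ᶠ m : ℕ in atTop, α m ≤ (P m).p ^ 4 →
      (P m).δ * falseRej (m := m) (P m).p ((P m).u ρ) (α m) center ≤ m * (P m).p * ε := by
  have hC := h.C_pos
  obtain ⟨A, hA, hAb⟩ := exists_inflated_pValue_bound
  obtain ⟨a, ha, hab⟩ := exists_pValue_gaussian_lower
  obtain ⟨c, hc, hmp⟩ := h.mp_lower
  set D := Real.exp (-(3 / 2) * Real.log a) with hD
  set K := A * (1 + 1 / c) * Real.exp 16 + 4 * D with hK
  have hlim := h.tendsto_δα.mul_const K
  rw [zero_mul] at hlim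
  have hp4 : Tendsto (fun m => (P m).p ^ 4) atTop (𝓝 0) := by
    simpa using h.p_tendsto.pow 4
  have hum2 : Tendsto (fun m : ℕ => (1 + C) * ((P m).u ρ / m) ^ 2) atTop (𝓝 0) := by
    simpa using (h.u_div.pow 2).const_mul (1 + C)
  have hpum : Tendsto (fun m : ℕ => (1 + C) * ((P m).p * (P m).u ρ ^ 2 / m)) atTop (𝓝 0) := by
    simpa using hpu.tendsto_div_nhds_zero.const_mul (1 + C)
  filter_upwards [hmp, hlim.eventually (gt_mem_nhds hε), hp4.eventually (gt_mem_nhds ha),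
    hum2.eventually (gt_mem_nhds one_pos), hpum.eventually (gt_mem_nhds one_pos),
    h.u_div.eventually (gt_mem_nhds (show (0 : ℝ) < 1 / 20 by norm_num)),
    h.u_tendsto.eventually_ge_atTop 1, h.eventually_log_pα_le (Real.log 2),
    eventually_gt_atTop 0] with m hcm hK' hpa hu2 hpu2 hu20 hu1 hlog hm hαp
  have hm0 : (0 : ℝ) < m := by exact_mod_cast hm
  have hδ := δ_pos (P m)
  have hα := (h.α_mem m).1
  have hp := (P m).p_pos
  set p := (P m).p
  set u := (P m).u ρ
  have hL1 : 1 + C * u ≤ (1 + C) * u := by linarith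
  have key := falseRej_center_le_of_small_level (P m) hm (u := u) (A := A) (a := a) (α := α m)
    (L := C * u) (by linarith) hu20.le hA hAb ha hab hα (hαp.trans_lt hpa) (by positivity)
    (by
      have e : 2 / (p * α m) = 2 * (1 / (p * α m)) := by ring
      rw [e, Real.log_mul two_ne_zero (by positivity)]
      exact hlog)
    (by
      calc u * (1 + C * u) / m ^ 2 ≤ u * ((1 + C) * u) / m ^ 2 := by gcongr
        _ = (1 + C) * (u / m) ^ 2 := by ring
        _ ≤ 1 := hu2.le)
  have h8 : Real.exp (8 + 8 * (p * u * (1 + C * u) / m)) ≤ Real.exp 16 := by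
    refine Real.exp_le_exp.mpr ?_
    have : p * u * (1 + C * u) / m ≤ 1 := by
      calc p * u * (1 + C * u) / m ≤ p * u * ((1 + C) * u) / m := by gcongr
        _ = (1 + C) * (p * u ^ 2 / m) := by ring
        _ ≤ 1 := hpu2.le
    linarith
  -- The left side is D α^(3/2), and α ≤ p⁴ gives α^(1/2) ≤ p². Multiplied by m/p, this is of the
  -- order m p α, the same as the first-moment term.
  have hE : Real.exp (-(3 / 2) * Real.log (a / α m)) ≤ D * (α m * p ^ 2) := by
    have hlogα : Real.log (α m) ≤ 4 * Real.log p := by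
      have := Real.log_le_log hα hαp
      rwa [Real.log_pow] at this
    have e : α m * p ^ 2 = Real.exp (Real.log (α m) + 2 * Real.log p) := by
      rw [Real.exp_add, Real.exp_log hα, two_mul, Real.exp_add, Real.exp_log hp, sq]
    rw [e, hD, ← Real.exp_add, Real.log_div ha.ne' hα.ne']
    refine Real.exp_le_exp.mpr ?_
    linarith
  have h1c : m * p + 1 ≤ m * p * (1 + 1 / c) := by
    have : 1 ≤ m * p * (1 / c) := by rw [mul_one_div, one_le_div hc]; exact hcm
    linarith
  calc (P m).δ * falseRej (m := m) p u (α m) center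
      ≤ (P m).δ * (A * α m * (m * p + 1) * Real.exp (8 + 8 * (p * u * (1 + C * u) / m))
        + 4 * (m / p) * Real.exp (-(3 / 2) * Real.log (a / α m))) := by gcongr
    _ ≤ (P m).δ * (A * α m * (m * p * (1 + 1 / c)) * Real.exp 16
        + 4 * (m / p) * (D * (α m * p ^ 2))) := by gcongr
    _ = m * p * ((P m).δ * α m * K) := by rw [hK]; field_simp
    _ ≤ m * p * ε := by gcongr

/-- When the level is at least polynomial in `p`, the signal strength is logarithmic in the number
of coordinates and the sample mean is negligible. -/
lemma eventually_falseRej_center_le_of_large_level (h : Regime P ρ α C) {ε : ℝ} (hε : 0 < ε) :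
    ∀ᶠ m : ℕ in atTop, (P m).p ^ 4 < α m →
      (P m).δ * falseRej (m := m) (P m).p ((P m).u ρ) (α m) center ≤ m * (P m).p * ε := by
  have hC := h.C_pos
  obtain ⟨c, hc, hmp⟩ := h.mp_lower
  obtain ⟨α₁, hα₁0, hα₁, hαle⟩ := h.α_upper
  -- Keeps the enlarged level below one: 1 - (1 + ε₀)α₁ = (1 - α₁)(1 - α₁/2).
  set ε₀ := (1 - α₁) / 2 with hε₀
  have hε₀0 : 0 < ε₀ := by rw [hε₀]; linarith
  have hε₀1 : ε₀ ≤ 1 := by rw [hε₀]; linarith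
  set D := 1 - (1 + ε₀) * α₁ with hD
  have hD0 : 0 < D := by rw [hD]; nlinarith
  set K := 2 / D * (1 + 1 / (D * c)) with hK
  have hlim := h.tendsto_δα.mul_const K
  rw [zero_mul] at hlim
  have hlogm : Tendsto (fun m : ℕ => Real.log m) atTop atTop :=
    Real.tendsto_log_atTop.comp tendsto_natCast_atTop_atTop
  have hdecay : Tendsto (fun x : ℝ => Real.exp (-(x / 4)) * (1 + 10 * x)) atTop (𝓝 0) := by
    have h4 : Tendsto (fun x : ℝ => x / 4) atTop atTop :=
      tendsto_id.atTop_div_const (by norm_num)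
    have t1 := (Real.tendsto_exp_neg_atTop_nhds_zero.comp h4)
    have t2 := ((Real.tendsto_pow_mul_exp_neg_atTop_nhds_zero 1).comp h4).const_mul 40
    have t3 := t1.add t2
    rw [mul_zero, add_zero] at t3
    refine t3.congr fun x => ?_
    simp only [Function.comp, pow_one]
    ring
  have hgrow : ∀ b k : ℝ, ∀ᶠ x : ℝ in atTop, b + k * x ≤ Real.exp (x / 4) := by
    intro b k
    have h4 : Tendsto (fun x : ℝ => x / 4) atTop atTop :=
      tendsto_id.atTop_div_const (by norm_num)
    have t1 := (Real.tendsto_exp_neg_atTop_nhds_zero.comp h4).const_mul b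
    have t2 := ((Real.tendsto_pow_mul_exp_neg_atTop_nhds_zero 1).comp h4).const_mul (4 * k)
    have t3 := t1.add t2
    rw [mul_zero, mul_zero, add_zero] at t3
    filter_upwards [t3.eventually (gt_mem_nhds one_pos)] with x hx
    have h5 : (b + k * x) * Real.exp (-(x / 4)) < 1 := by
      simp only [Function.comp, pow_one] at hx
      linarith
    rw [Real.exp_neg, ← div_eq_mul_inv, div_lt_one (Real.exp_pos _)] at h5
    exact h5.le
  have hneg : ∀ᶠ x : ℝ in atTop, Real.exp (-x) < ε / 4 :=
    Real.tendsto_exp_neg_atTop_nhds_zero.eventually (gt_mem_nhds (by linarith))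
  have hq : 0 < min 1 (ε₀ * Real.exp (-(5 / 2))) := lt_min one_pos (by positivity)
  filter_upwards [hmp, hαle, hlim.eventually (gt_mem_nhds (half_pos hε)),
    hlogm.eventually (hdecay.eventually (gt_mem_nhds hq)),
    hlogm.eventually (hgrow 2 (80 / C)), hlogm.eventually (hgrow 0 41), hlogm.eventually hneg,
    hlogm.eventually (eventually_ge_atTop 1),
    h.u_tendsto.eventually_ge_atTop 1, h.eventually_log_pα_le 0,
    h.log_pα.eventually (lt_mem_nhds (show C / 4 < C / 2 by linarith)),
    h.log_δ.eventually (gt_mem_nhds (show C / 2 < C by linarith)),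
    h.u_tendsto.eventually_ge_atTop (-(40 * Real.log c) / C),
    eventually_gt_atTop 0] with m hcm hαm hK' hdec hg1 hg2 hne hx1 hu1 hlogle hlogge hlogδ huc hm hpα
  have hm0 : (0 : ℝ) < m := by exact_mod_cast hm
  have hm1 : (1 : ℝ) ≤ m := by exact_mod_cast hm
  have hδ := δ_pos (P m)
  obtain ⟨hα, hα1⟩ := h.α_mem m
  have hp := (P m).p_pos
  have hp1 := (P m).p_lt_one
  set p := (P m).p
  set u := (P m).u ρ
  set x := Real.log m with hx
  have hu0 : 0 < u := by linarith
  have hmexp : Real.exp x = m := Real.exp_log hm0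
  have hlogp : Real.log p < 0 := Real.log_neg hp hp1
  have elog : Real.log (1 / (p * α m)) = -Real.log p - Real.log (α m) := by
    rw [one_div, Real.log_inv, Real.log_mul hp.ne' hα.ne']; ring
  rw [elog] at hlogle hlogge
  rw [lt_div_iff₀ hu0] at hlogge
  rw [div_lt_iff₀ hu0] at hlogδ
  rw [div_le_iff₀ hC] at huc
  have hlogα : 4 * Real.log p ≤ Real.log (α m) := by
    have := Real.log_le_log (by positivity) hpα.le
    rwa [Real.log_pow] at this
  have hxc : Real.log c ≤ x + Real.log p := by
    have := Real.log_le_log hc hcm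
    rwa [Real.log_mul hm0.ne' hp.ne'] at this
  -- Cu/4 < log(1/(pα)) ≤ 5 log(1/p) ≤ 5 (x - log c), and the term in log c is absorbed into half of
  -- Cu because u is large.
  have hux : C * u ≤ 40 * x := by linarith
  have hux' : u ≤ 40 / C * x := by
    rw [div_mul_eq_mul_div, le_div_iff₀ hC]; linarith
  -- η = m^(-1/4): small enough to beat powers of log m in the perturbation bound, yet η² m = √m
  -- still dominates u = O(log m).
  set η := Real.exp (-(x / 4)) with hη
  have hη0 : 0 < η := Real.exp_pos _
  have hx0 : 0 ≤ x := by linarith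
  -- By Chernoff the p-value at B is at most α/(2m), which leaves room for 1 + ε₀ ≤ 2.
  set B := √(2 * Real.log (4 * m / α m)) with hB
  have hB0 : 0 ≤ B := Real.sqrt_nonneg _
  have hlogB : Real.log (4 * m / α m) = Real.log 4 + x - Real.log (α m) := by
    rw [Real.log_div (by positivity) hα.ne', Real.log_mul (by norm_num) hm0.ne']
  have hlogB0 : 0 ≤ Real.log (4 * m / α m) := by
    refine Real.log_nonneg ?_
    rw [one_le_div hα]; linarith
  have hB2 : B ^ 2 = 2 * Real.log (4 * m / α m) := Real.sq_sqrt (by linarith)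
  have hB10 : B ≤ 10 * x := by
    have h4 : Real.log 4 ≤ 3 := by
      have := Real.log_le_sub_one_of_pos (show (0 : ℝ) < 4 by norm_num)
      linarith
    rw [hB]
    refine Real.sqrt_le_iff.mpr ⟨by linarith, ?_⟩
    rw [hlogB]
    nlinarith
  have hdec1 : η * (1 + 10 * x) ≤ 1 := hdec.le.trans (min_le_left _ _)
  have hdec2 : η * (1 + 10 * x) ≤ ε₀ * Real.exp (-(5 / 2)) := hdec.le.trans (min_le_right _ _)
  have hαD : D ≤ 1 - (1 + ε₀) * α m := by
    have : (1 + ε₀) * α m ≤ (1 + ε₀) * α₁ := by gcongr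
    rw [hD]; linarith
  have key := falseRej_center_le_of_close (P m) hm (u := u) (α := α m) (ε := ε₀) (η := η) (B := B)
    hu0.le hα hε₀0.le (by linarith) hη0 hB0
    (by
      have h1 := pValue_chernoff B
      have e : -B ^ 2 / 2 = -Real.log (4 * m / α m) := by rw [hB2]; ring
      have e2 : Real.exp (-B ^ 2 / 2) = α m / (4 * m) := by
        rw [e, Real.exp_neg, Real.exp_log (by positivity), inv_div]
      rw [e2] at h1
      calc (1 + ε₀) * pValue B ≤ 2 * (2 * (α m / (4 * m))) := by
            refine mul_le_mul (by linarith) h1 ?_ (by norm_num)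
            exact pValue_nonneg B
        _ = α m / m := by field_simp; norm_num)
    (by
      have h1 : B * η ≤ 1 := by
        calc B * η ≤ 10 * x * η := by gcongr
          _ ≤ 1 := by linarith
      calc η * (1 + B) * Real.exp (3 / 2 + B * η)
          ≤ η * (1 + 10 * x) * Real.exp (5 / 2) := by
            gcongr
            linarith
        _ ≤ ε₀ * Real.exp (-(5 / 2)) * Real.exp (5 / 2) := by gcongr
        _ = ε₀ := by rw [mul_assoc, ← Real.exp_add]; simp)
  have hodds : odds ((1 + ε₀) * α m) ≤ 2 / D * α m := by
    unfold odds
    calc (1 + ε₀) * α m / (1 - (1 + ε₀) * α m) ≤ 2 * α m / D := by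
          gcongr
          linarith
      _ = 2 / D * α m := by ring
  have hodds2 : odds ((1 + ε₀) * α m) / (1 - (1 + ε₀) * α m)
      ≤ 2 / D * α m * (m * p * (1 / (D * c))) := by
    calc odds ((1 + ε₀) * α m) / (1 - (1 + ε₀) * α m) ≤ 2 / D * α m / D := by gcongr
      _ = 2 / D * α m * (c * (1 / (D * c))) := by field_simp
      _ ≤ _ := by gcongr
  -- δ/p is at most e^(Cu) ≤ m^40, while the tail is at most exp(-m^(1/4)) ≤ m^(-41) for large m;
  -- the product is at most 1/m.
  have htail : (P m).δ / p * Real.exp (-(η ^ 2 * m / (2 * (1 + u)))) ≤ ε / 4 := by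
    have e1 : η ^ 2 * m = Real.exp (x / 4) * Real.exp (x / 4) := by
      rw [← hmexp, hη, sq, ← Real.exp_add, ← Real.exp_add, ← Real.exp_add]
      congr 1; ring
    have h1 : 2 * (1 + u) ≤ Real.exp (x / 4) := by
      have : 80 / C * x = 2 * (40 / C * x) := by ring
      linarith
    have h2 : Real.exp (x / 4) ≤ η ^ 2 * m / (2 * (1 + u)) := by
      rw [e1, le_div_iff₀ (by positivity)]
      gcongr
    have h3 : (P m).δ / p = Real.exp (Real.log ((P m).δ / p)) :=
      (Real.exp_log (by positivity)).symm
    rw [h3, ← Real.exp_add]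
    refine le_trans (Real.exp_le_exp.mpr ?_) hne.le
    linarith
  calc (P m).δ * falseRej (m := m) p u (α m) center
      ≤ (P m).δ * (odds ((1 + ε₀) * α m) * (m * p)
        + odds ((1 + ε₀) * α m) / (1 - (1 + ε₀) * α m)
        + m * (2 * Real.exp (-(η ^ 2 * m / (2 * (1 + u)))))) := by gcongr
    _ ≤ (P m).δ * (2 / D * α m * (m * p) + 2 / D * α m * (m * p * (1 / (D * c)))
        + m * (2 * Real.exp (-(η ^ 2 * m / (2 * (1 + u)))))) := by gcongr
    _ = m * p * ((P m).δ * α m * K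
        + 2 * ((P m).δ / p * Real.exp (-(η ^ 2 * m / (2 * (1 + u)))))) := by
        rw [hK]; field_simp
    _ ≤ m * p * (ε / 2 + 2 * (ε / 4)) := by gcongr
    _ = m * p * ε := by ring

lemma eventually_falseRej_center_le (h : Regime P ρ α C)
    (hpu : (fun m : ℕ => (P m).p * (P m).u ρ ^ 2) =o[atTop] (fun m : ℕ => (m : ℝ)))
    {ε : ℝ} (hε : 0 < ε) :
    ∀ᶠ m : ℕ in atTop, (P m).δ * falseRej (m := m) (P m).p ((P m).u ρ) (α m) center
      ≤ m * (P m).p * ε := by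
  filter_upwards [eventually_falseRej_center_le_of_small_level h hpu hε,
    eventually_falseRej_center_le_of_large_level h hε] with m h1 h2
  rcases le_or_gt (α m) ((P m).p ^ 4) with h3 | h3
  · exact h1 h3
  · exact h2 h3

end

end EquicorrBH

/-! ### The main theorem. -/

theorem theorem4p4 (ρ : ℝ) (hρ : ρ ∈ Set.Icc (0 : ℝ) 1)
    (P : ℕ → Params) (hP : AsymptoticFramework P ρ)
    (α : ℕ → ℝ) (hα : ∀ m, α m ∈ Set.Ioo (0 : ℝ) 1)
    (αinf : ℝ) (hαinf : αinf < 1) (hαlim : Tendsto α atTop (𝓝 αinf))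
    (s : EReal) (hs : 0 < s)
    (hmp : Tendsto (fun m : ℕ => (((m : ℝ) * (P m).p : ℝ) : EReal)) atTop (𝓝 s))
    (hlog : (fun m : ℕ => Real.log ((P m).δ / (P m).p)) =o[atTop] fun m : ℕ => (m : ℝ))
    (hs_zero : Tendsto (fun m => sSeq (P m) ρ (α m)) atTop (𝓝 0))
    (hs_log : Tendsto (fun m =>
        2 * sSeq (P m) ρ (α m) * Real.log ((P m).f / odds (α m))
          - Real.log (Real.log ((P m).f / odds (α m)))) atTop atBot) :
    -- BH applied to the latent variables `Z`
    IsABOS P ρ (fun m => (P m).reducedLaw ρ m) (fun m z => (P m).bhRule ρ (α m) z) ∧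
    -- BH applied to the observable deviations `U = X - X̄`
    ((fun m : ℕ => (P m).p * (P m).u ρ ^ 2) =o[atTop] (fun m : ℕ => (m : ℝ)) →
      IsABOS P ρ (fun m => (P m).observedLaw ρ m)
        (fun m x => (P m).bhRule ρ (α m) (center x))) := by
  obtain ⟨C, h⟩ := regime_of_framework hP hα hαinf hαlim hs hmp hlog hs_zero hs_log
  constructor
  · exact isABOS_of_falseRej hρ.2 h (fun m => id) (fun m => measurable_id)
      (fun m z j => by simp) (fun m c x => rfl) (fun ε hε => eventually_falseRej_id_le h hε)
  · intro hpu
    -- Optimality is first obtained for the deviations of Z; the equality of risks then transfers it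
    -- to those of X.
    have key := isABOS_of_falseRej hρ.2 h (fun m => center) (fun m => measurable_center)
      (fun m z j => by simp [center]) (fun m c x => center_mul c x)
      (fun ε hε => eventually_falseRej_center_le h hpu hε)
    unfold IsABOS at key ⊢
    refine key.congr fun m => ?_
    rw [risk_observed_center (P m) hρ m (fun y => (P m).bhRule ρ (α m) y)
      (fun i => measurableSet_mem_bhRule (P m) ρ (hα m).1.le i)]
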